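/- **Setting.** There are $n$ validators, at most $f$ of them Byzantine, with $n\ge 3f+2p+1$. Every validator $V$ keeps an entity $V.A$ for each user actor $A$ and an entity $V.X$ for each reactive actor $X$. A *user-actor transaction* has a sender $A$ (a user actor), a sequence number $sn\in\mathbb N$, a list of owned objects that it consumes, and either only code (a *UA transaction*) or in addition a recipient $X$, a reactive actor (a *UA-RA transaction*). Reactive actors may in turn send transactions to reactive actors. The objects created by an execution are new: an object determines the transaction that created it. $V.A$ is *ready* for $tx$ if it has executed the transaction of $A$ with sequence number $tx.sn-1$ (no condition for the first sequence number) and owns all objects consumed by $tx$. Signatures cannot be forged, messages between honest validators and from correct users are eventually delivered, local computations eventually happen, and timers may expire at any moment. A correct user signs at most one transaction per sequence number of its actor, in order, and sends it to all validators. Other users and Byzantine validators are arbitrary. The validators run the following protocol (Mangrove). * *Locks.* $V.A$ FP-locks and SP-locks at most one transaction for each sequence number, and locks are never changed. On receipt of a transaction from the user it FP-locks it unless a conflicting one (same sender and sequence number) is FP-locked. * *UA transactions (Parallel Optimistic Broadcast).* $V.A$ broadcasts a vote for a received UA transaction that it has FP-locked. With $n-p$ votes, or with a proof made of $n-p$ votes,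 it broadcasts the proof and decides; with $n-p-2f$ votes it SP-locks the transaction if no conflicting one is SP-locked and proposes it to the Transaction Agreement instance $(A,sn)$, and it decides what this instance decides, unless it has decided before. A decided UA transaction is executed at $V.A$ when $V.A$ is ready for it. * *UA-RA transactions.* When $V.A$ has received and FP-locked such a transaction and is ready for it, it puts it into the pool of $V.X$. The entities $V.X$ run consecutive instances $k=0,1,\dots$ of Parallel Optimistic Agreement on blocks of transactions with recipient $X$. The leader of instance $k$ (a common function of $k$, honest for infinitely many $k$) broadcasts its pool. $V.X$ broadcasts, once, a vote together with its pool as fallback block: a vote for the leader's block $B$ if every reactive actor transaction of $B$ is in its pool and $V.A$, for every UA-RA transaction in $B$ with sender $A$, has verified the signature, has FP-locked the transaction and was ready for it; a vote for $\bot$ if that fails or the timer expires. With $n-p$ votes for $B$, or a proof made of them, it broadcasts the proof and decides $B$. In the slow path, with $n-f$ votes, it tries to SP-lock all UA-RA transactions of a block with $n-p-2f$ votes and proposes that block to Quorum Consensus instance $(X,k)$; if there is no such block or an SP-lock fails, it proposes the transactions that are present in at least $n-2f$ received fallback blocks, without the UA-RA transactions that it fails to SP-lock. For each UA-RA transaction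 in the block decided by Quorum Consensus, $V.A$ SP-locks it if it can and proposes its SP-locked transaction to Transaction Agreement $(A,sn)$; $V.X$ then decides the block without the UA-RA transactions that were not decided there. A decided block is executed at $V.X$ in a deterministic order, skipping transactions that were executed before; the effects of a UA-RA transaction are then reported to $V.A$, which executes it when it is ready for it. * *Primitives.* Quorum Consensus and Transaction Agreement are any primitives with these properties. Agreement: all honest decisions of an instance are equal. Quorum Validity: a transaction in the proposal of every honest validator that proposes is in the decided block (if every honest validator that proposes to a Transaction Agreement instance proposes $v$, only $v$ can be decided), and a decided transaction has been proposed by at least $n-3f$ honest validators. Termination: if all honest validators propose, or one honest validator decides, then all honest validators decide. A Transaction Agreement decision may be empty. A user-actor transaction is *emitted* if it is signed and put on the network by its user at a moment such that, at that moment or later, some honest $V.A$ ($A$ the sender) is ready for it. **Theorem.** In every execution: 1. (Validity) If a correct user emits a user-actor transaction $tx$, then every honest validator $V$ eventually executes $tx$, at $V.A$ for the sender $A$ and, if $tx$ is a UA-RA transaction with recipient $X$, also at $V.X$. 2. (Integrity) Every honest validator executes each user-actor transaction at most once (only at the entities of its sender and of its recipient, and at most once at each of them), and only if it was emitted. 3.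 (Agreement) If $tx_1,tx_2$ are user-actor transactions (each of them UA or UA-RA) with the same sender and the same sequence number, and honest validators $V_1,V_2$ execute $tx_1$ and $tx_2$ respectively (at any entity), then $tx_1=tx_2$. -/

import Mathlib

universe u

namespace Mangrove

noncomputable section

open scoped Classical

/-! ### Transactions -/

/-- What a user transaction asks for: a UA transaction carries only `Code`, a UA-RA transaction names a
reactive actor as recipient and carries `Code_pre`, `Call`, `Code_post`. -/
inductive UserBody (RA Code : Type u) : Type u
  | ua (code : Code)
  | uara (recipient : RA) (pre call post : Code)

/-- A transaction issued by a user actor, `⟨A, sn, [O₁, …, Oₖ], …⟩`. -/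
structure UserTx (UA RA Obj Code : Type u) : Type u where
  sender : UA
  sn : ℕ
  consumed : List Obj
  body : UserBody RA Code

/-- A transaction issued by a reactive actor (no sequence number). -/
structure ReactiveTx (RA Obj Code : Type u) : Type u where
  sender : RA
  recipient : RA
  consumed : List Obj
  pre : Code
  call : Code
  post : Code

inductive Tx (UA RA Obj Code : Type u) : Type u
  | user (tx : UserTx UA RA Obj Code)
  | reactive (tx : ReactiveTx RA Obj Code)

/-- The recipient of a user transaction; `none` for a UA transaction. -/
def UserTx.recipient {UA RA Obj Code : Type u} (tx : UserTx UA RA Obj Code) : Option RA :=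
  match tx.body with
  | .ua _ => none
  | .uara X _ _ _ => some X

def Tx.recipient {UA RA Obj Code : Type u} : Tx UA RA Obj Code → Option RA
  | .user tx => tx.recipient
  | .reactive tx => some tx.recipient

/-- What running a transaction at a reactive actor produces: the new state of the actor (which includes the
objects that the actor owns), the objects created at user actors, and the reactive actor transactions sent
out (those whose consumed objects the actor owns; the others are dropped). -/
structure Effects (UA RA Obj Code RState : Type u) : Type u where
  state : RState
  created : Set (UA × Obj)
  emitted : List (ReactiveTx RA Obj Code)

/-- The static data of a system. -/
structure System where
  /-- the validators -/
  Val : Type u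
  [valFintype : Fintype Val]
  /-- user actors -/
  UA : Type u
  /-- reactive actors -/
  RA : Type u
  /-- owned objects -/
  Obj : Type u
  /-- programs (the fields `Code`, `Call`) -/
  Code : Type u
  /-- states of reactive actors -/
  RState : Type u
  /-- bound on the number of Byzantine validators -/
  f : ℕ
  /-- number of misbehaving validators that the fast path tolerates -/
  p : ℕ
  /-- the Byzantine validators -/
  byz : Finset Val
  /-- the user actors that are controlled by a correct user -/
  correctUser : Set UA
  /-- `leaderOracle` -/
  leader : ℕ → Val
  /-- objects owned at the beginning -/
  genesis : UA → Set Obj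
  /-- initial states of the reactive actors -/
  initState : RA → RState
  /-- `VM.Execute` for a UA transaction: the objects that it creates, with the user actors that receive them -/
  runUA : UserTx UA RA Obj Code → Set (UA × Obj)
  /-- `VM.Execute` of `Code_pre`, `Call`, `Code_post` at a reactive actor, a deterministic function of the
  state of the actor -/
  runRA : RA → RState → Tx UA RA Obj Code → Effects UA RA Obj Code RState
  /-- The identity of an object determines the transaction that created it (`none` for an initial object), so
  that an object which was consumed is never created again. -/
  origin : Obj → Option (Tx UA RA Obj Code)
  origin_genesis : ∀ A, ∀ o ∈ genesis A, origin o = none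
  origin_runUA : ∀ tx, ∀ c ∈ runUA tx, origin c.2 = some (.user tx)
  origin_runRA : ∀ X st tx, ∀ c ∈ (runRA X st tx).created, origin c.2 = some tx

attribute [instance] System.valFintype

variable (M : System.{u})

abbrev System.UTx : Type u := UserTx M.UA M.RA M.Obj M.Code
abbrev System.RTx : Type u := ReactiveTx M.RA M.Obj M.Code
abbrev System.Trans : Type u := Tx M.UA M.RA M.Obj M.Code
abbrev System.Block : Type u := Finset M.Trans
/-- A POA vote message: a vote for a block or `⊥` (`none`), and a fallback block. -/
abbrev System.Vote : Type u := Option M.Block × M.Block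

/-- The number of validators. -/
def System.n : ℕ := Fintype.card M.Val
def System.Honest (V : M.Val) : Prop := V ∉ M.byz
/-- The number of validators with a given property. -/
def System.count (P : M.Val → Prop) : ℕ := (Finset.univ.filter P).card

/-! ### Local states -/

/-- The state of the entity `V.A` of a validator `V` for a user actor `A`. -/
structure UAEntity : Type u where
  fpLocked : ℕ → Option M.UTx
  spLocked : ℕ → Option M.UTx
  /-- transactions delivered from the user -/
  received : Set M.UTx
  /-- UA-RA transactions that were sent on to the recipient's entity -/
  forwarded : Set M.UTx
  /-- POB: the transactions that this entity has broadcast a (non-`⊥`) vote for -/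
  voted : Set M.UTx
  /-- POB: the votes received from each validator -/
  votesFrom : M.Val → Set M.UTx
  /-- POB: the transactions whose proof this entity has broadcast -/
  proofs : Set M.UTx
  /-- POB: the decision of the instance with number `sn` -/
  pobDecided : ℕ → Option M.UTx
  pending : Set M.UTx
  /-- messages `Executed(tx, effects)` from the recipients' entities, waiting to be processed -/
  inbox : Set (M.UTx × Set (M.UA × M.Obj))
  owned : Set M.Obj
  /-- the transactions executed at this entity, in order -/
  log : List M.UTx
  /-- proposals to the Transaction Agreement instances of `A` -/
  taProposed : ℕ → Option M.UTx
  /-- decisions of the Transaction Agreement instances of `A`; the inner `none` is the empty decision -/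
  taDecided : ℕ → Option (Option M.UTx)

/-- The state of the entity `V.X` of a validator `V` for a reactive actor `X`. -/
structure RAEntity : Type u where
  pool : M.Block
  /-- the current POA instance -/
  inst : ℕ
  st : M.RState
  /-- the transactions executed at this entity (the set `executed`), in order -/
  log : List M.Trans
  /-- the block broadcast as a leader -/
  proposal : ℕ → Option M.Block
  /-- the block received from the leader -/
  block : ℕ → Option M.Block
  /-- the transactions for which the request to FP-lock was answered positively -/
  fpOk : ℕ → Set M.UTx
  /-- the vote broadcast -/
  vote : ℕ → Option M.Vote
  /-- the votes received from each validator -/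
  votesFrom : ℕ → M.Val → Option M.Vote
  /-- the block whose proof was broadcast -/
  proof : ℕ → Option M.Block
  /-- `candidateB[k]`, for the first attempt of the slow path -/
  cand : ℕ → Option M.Block
  /-- answers to the requests to SP-lock the transactions of `candidateB[k]` -/
  reply : ℕ → M.UTx → Option Bool
  /-- `candidateB₂[k]`, made of the fallback blocks -/
  candFb : ℕ → Option M.Block
  /-- answers to the requests to SP-lock the transactions of `candidateB₂[k]` -/
  replyFb : ℕ → M.UTx → Option Bool
  qcProposed : ℕ → Option M.Block
  qcDecided : ℕ → Option M.Block
  /-- the decision of POA -/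
  decided : ℕ → Option M.Block

structure State : Type u where
  /-- the transactions that have been signed by their users and put on the network -/
  issued : Set M.UTx
  /-- the next sequence number that a correct user will use, `sns[A]` -/
  nextSn : M.UA → ℕ
  ua : M.Val → M.UA → UAEntity M
  ra : M.Val → M.RA → RAEntity M

def State.init : State M where
  issued := ∅
  nextSn := fun _ => 0
  ua := fun _ A =>
    { fpLocked := fun _ => none, spLocked := fun _ => none, received := ∅, forwarded := ∅, voted := ∅
      votesFrom := fun _ => ∅, proofs := ∅, pobDecided := fun _ => none, pending := ∅, inbox := ∅
      owned := M.genesis A, log := [], taProposed := fun _ => none, taDecided := fun _ => none }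
  ra := fun _ X =>
    { pool := ∅, inst := 0, st := M.initState X, log := [], proposal := fun _ => none
      block := fun _ => none, fpOk := fun _ => ∅, vote := fun _ => none, votesFrom := fun _ _ => none
      proof := fun _ => none, cand := fun _ => none, reply := fun _ _ => none, candFb := fun _ => none
      replyFb := fun _ _ => none, qcProposed := fun _ => none, qcDecided := fun _ => none
      decided := fun _ => none }

variable {M}

/-- `executed[sn]` at `V.A`. -/
def UAEntity.Executed (e : UAEntity M) (sn : ℕ) : Prop := ∃ tx ∈ e.log, tx.sn = sn

/-- `executed[tx.sn - 1]` (nothing is required for the first sequence number `0`) and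
`tx.consumedObjects ⊆ ownedObjects`, at `V.A`. -/
def UAEntity.Ready (e : UAEntity M) (tx : M.UTx) : Prop :=
  (∀ m, tx.sn = m + 1 → e.Executed m) ∧ ∀ o ∈ tx.consumed, o ∈ e.owned

/-- FP-lock `tx` unless a transaction is FP-locked already. -/
def UAEntity.tryFPLock (e : UAEntity M) (tx : M.UTx) : UAEntity M :=
  if e.fpLocked tx.sn = none then { e with fpLocked := Function.update e.fpLocked tx.sn (some tx) } else e

/-- SP-lock `tx` unless a transaction is SP-locked already. -/
def UAEntity.trySPLock (e : UAEntity M) (tx : M.UTx) : UAEntity M :=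
  if e.spLocked tx.sn = none then { e with spLocked := Function.update e.spLocked tx.sn (some tx) } else e

/-- Propose to Transaction Agreement, at most once in each instance. -/
def UAEntity.proposeTA (e : UAEntity M) (sn : ℕ) (tx : Option M.UTx) : UAEntity M :=
  if e.taProposed sn = none then { e with taProposed := Function.update e.taProposed sn tx } else e

/-- `pob.Decide(tx)`, at most once in each instance; the decided transaction goes to `pending` if its
signature is valid (`sig`). -/
def UAEntity.pobDecide (e : UAEntity M) (sig : Prop) (tx : M.UTx) : UAEntity M :=
  if e.pobDecided tx.sn = none then
    { e with
      pobDecided := Function.update e.pobDecided tx.sn (some tx)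
      pending := e.pending ∪ {t | t = tx ∧ sig} }
  else e

/-- Remove the consumed objects and record the execution of `tx` at `V.A`. -/
def UAEntity.execute (e : UAEntity M) (tx : M.UTx) : UAEntity M :=
  { e with owned := e.owned \ {o | o ∈ tx.consumed}, log := e.log ++ [tx] }

/-- `poa.Decide(k, B)`, at most once in each instance. -/
def RAEntity.decide (e : RAEntity M) (k : ℕ) (B : M.Block) : RAEntity M :=
  if e.decided k = none then { e with decided := Function.update e.decided k (some B) } else e

/-- The number of votes for the block `B` received in instance `k`. -/
def RAEntity.votesFor (e : RAEntity M) (k : ℕ) (B : M.Block) : ℕ :=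
  M.count fun W => ∃ fb, e.votesFrom k W = some (some B, fb)

/-- The number of all votes received in instance `k`. -/
def RAEntity.votesTotal (e : RAEntity M) (k : ℕ) : ℕ :=
  M.count fun W => e.votesFrom k W ≠ none

/-- The fallback block received from `W`. -/
def RAEntity.fallbackFrom (e : RAEntity M) (k : ℕ) (W : M.Val) : M.Block :=
  match e.votesFrom k W with
  | some v => v.2
  | none => ∅

/-- The transactions that are present in at least `n - 2f` of the fallback blocks received. -/
def RAEntity.fallback (e : RAEntity M) (k : ℕ) : M.Block :=
  (Finset.univ.biUnion (e.fallbackFrom k)).filter fun tx =>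
    M.n - 2 * M.f ≤ M.count fun W => tx ∈ e.fallbackFrom k W

/-- The conditions under which `V.X` works on the leader's block `B`: it is in instance `k`, has received `B`,
and every RA-RA transaction of `B` is in its pool. -/
def RAEntity.Considers (e : RAEntity M) (k : ℕ) (B : M.Block) : Prop :=
  e.inst = k ∧ e.block k = some B ∧ ∀ r : M.RTx, Tx.reactive r ∈ B → Tx.reactive r ∈ e.pool

/-- Replace the state of `V.A`. -/
def State.setUA (s : State M) (V : M.Val) (A : M.UA) (e : UAEntity M) : State M :=
  { s with ua := fun v a => if v = V ∧ a = A then e else s.ua v a }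

/-- Replace the state of `V.X`. -/
def State.setRA (s : State M) (V : M.Val) (X : M.RA) (e : RAEntity M) : State M :=
  { s with ra := fun v x => if v = V ∧ x = X then e else s.ra v x }

/-- At validator `V`, hand newly created objects to the user actors that own them. -/
def State.grant (s : State M) (V : M.Val) (c : Set (M.UA × M.Obj)) : State M :=
  { s with ua := fun v a =>
      if v = V then { s.ua v a with owned := (s.ua v a).owned ∪ {o | (a, o) ∈ c} } else s.ua v a }

/-- At validator `V`, put transactions into the pools of their recipients, unless executed there before. -/
def State.toPools (s : State M) (V : M.Val) (txs : List M.Trans) : State M :=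
  { s with ra := fun v x =>
      if v = V then
        { s.ra v x with pool := (s.ra v x).pool ∪
            (txs.filter fun t => t.recipient = some x ∧ t ∉ (s.ra v x).log).toFinset }
      else s.ra v x }

/-- At validator `V`, deliver the messages `Executed(tx, effects)` to the senders of user transactions (they
are ignored if `executed[tx.sn]` holds). -/
def State.report (s : State M) (V : M.Val) (out : List (M.Trans × Set (M.UA × M.Obj))) : State M :=
  { s with ua := fun v a =>
      if v = V then
        { s.ua v a with inbox := (s.ua v a).inbox ∪
            {m | m.1.sender = a ∧ ¬ (s.ua v a).Executed m.1.sn ∧ (Tx.user m.1, m.2) ∈ out} }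
      else s.ua v a }

/-- The objects created by the reactive actor transactions of an execution of a block. -/
def createdByReactive (out : List (M.Trans × Set (M.UA × M.Obj))) : Set (M.UA × M.Obj) :=
  {c | ∃ (r : M.RTx) (C : Set (M.UA × M.Obj)), (Tx.reactive r, C) ∈ out ∧ c ∈ C}

/-! ### Execution of a decided block -/

/-- Intermediate result of the execution of a block. -/
structure Batch (M : System.{u}) : Type u where
  st : M.RState
  log : List M.Trans
  /-- the executed transactions with the objects that they created -/
  out : List (M.Trans × Set (M.UA × M.Obj))
  emitted : List M.RTx

/-- Execute one transaction at `X`; a transaction executed before is skipped. -/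
def Batch.run (X : M.RA) (b : Batch M) (tx : M.Trans) : Batch M :=
  if tx ∈ b.log then b
  else
    let r := M.runRA X b.st tx
    { st := r.state, log := b.log ++ [tx], out := b.out ++ [(tx, r.created)],
      emitted := b.emitted ++ r.emitted }

/-- Execute the transactions of a block in a deterministic order (that of `Finset.toList`). -/
def RAEntity.runBlock (e : RAEntity M) (X : M.RA) (B : M.Block) : Batch M :=
  B.toList.foldl (Batch.run X) { st := e.st, log := e.log, out := [], emitted := [] }

/-- The handler of `poa.Decide(k, B)` at `V.X`: execute the block, send the emitted transactions to their
recipients and the effects of user transactions to their senders, and go to instance `k + 1`. -/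
def State.execBlock (s : State M) (V : M.Val) (X : M.RA) (B : M.Block) : State M :=
  let e := s.ra V X
  let b := e.runBlock X B
  (((s.setRA V X { e with pool := e.pool \ B, inst := e.inst + 1, st := b.st, log := b.log }).toPools V
    (b.emitted.map Tx.reactive)).report V b.out).grant V (createdByReactive b.out)

/-! ### Proofs (aggregated signatures) -/

/-- `proof(tx)` can be verified: it aggregates the votes of `n - p` validators. The signatures of honest
validators cannot be forged. -/
def State.PobProof (s : State M) (tx : M.UTx) : Prop :=
  ∃ S : Finset M.Val, M.n - M.p ≤ S.card ∧ ∀ W ∈ S, M.Honest W → tx ∈ (s.ua W tx.sender).voted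

/-- `proof(B)` for the `k`-th instance of POA of `X` can be verified. -/
def State.PoaProof (s : State M) (X : M.RA) (k : ℕ) (B : M.Block) : Prop :=
  ∃ S : Finset M.Val, M.n - M.p ≤ S.card ∧
    ∀ W ∈ S, M.Honest W → ∃ fb, (s.ra W X).vote k = some (some B, fb)

/-! ### Steps of the system -/

/-- The events of the system. Unless stated otherwise, `V` is the (honest) validator that acts. -/
inductive Label (M : System.{u}) : Type u
  /-- a user signs a transaction and puts it on the network -/
  | issue (tx : M.UTx)
  /-- `V.A` delivers `tx` from the user -/
  | recvTx (V : M.Val) (tx : M.UTx)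
  /-- `V.A` sends a UA-RA transaction to `V.X` -/
  | forward (V : M.Val) (tx : M.UTx)
  /-- POB: `V.A` delivers a vote from `W.A` -/
  | pobRecvVote (V W : M.Val) (tx : M.UTx)
  /-- POB: decision on `n - p` votes -/
  | pobFast (V : M.Val) (tx : M.UTx)
  /-- POB: `V.A` delivers a proof from `W.A` -/
  | pobRecvProof (V W : M.Val) (tx : M.UTx)
  /-- POB: SP-lock and propose to Transaction Agreement, on `n - p - 2f` votes -/
  | pobPropose (V : M.Val) (tx : M.UTx)
  /-- POB: decision by Transaction Agreement -/
  | pobSlow (V : M.Val) (tx : M.UTx)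
  /-- `V.A` executes a pending UA transaction -/
  | execUA (V : M.Val) (tx : M.UTx)
  /-- `V.A` processes the message `Executed(tx, effects)` with created objects `c` -/
  | execUARA (V : M.Val) (tx : M.UTx) (c : Set (M.UA × M.Obj))
  /-- POA: the leader broadcasts its pool -/
  | propose (V : M.Val) (X : M.RA) (k : ℕ)
  /-- POA: delivery of the leader's block -/
  | recvBlock (V : M.Val) (X : M.RA) (k : ℕ) (B : M.Block)
  /-- POA: `V.X` asks `V.A` to FP-lock `tx` -/
  | fpLock (V : M.Val) (X : M.RA) (k : ℕ) (tx : M.UTx)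
  /-- POA: `V.A` gives a positive answer to a request to FP-lock -/
  | fpAck (V : M.Val) (X : M.RA) (k : ℕ) (tx : M.UTx)
  /-- POA: vote for the leader's block -/
  | voteBlock (V : M.Val) (X : M.RA) (k : ℕ)
  /-- POA: vote for `⊥` -/
  | voteBot (V : M.Val) (X : M.RA) (k : ℕ)
  /-- POA: delivery of a vote from `W.X` -/
  | recvVote (V W : M.Val) (X : M.RA) (k : ℕ) (v : M.Vote)
  /-- POA: decision on `n - p` votes -/
  | fastDecide (V : M.Val) (X : M.RA) (k : ℕ)
  /-- POA: delivery of a proof from `W.X` -/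
  | recvProof (V W : M.Val) (X : M.RA) (k : ℕ) (B : M.Block)
  /-- POA: start of the slow path -/
  | startSlow (V : M.Val) (X : M.RA) (k : ℕ)
  /-- POA: `V.A` answers a request to SP-lock for `candidateB` -/
  | spLock (V : M.Val) (X : M.RA) (k : ℕ) (tx : M.UTx)
  /-- POA: all answers for `candidateB` are there -/
  | endCand (V : M.Val) (X : M.RA) (k : ℕ)
  /-- POA: `V.A` answers a request to SP-lock for `candidateB₂` -/
  | spLockFb (V : M.Val) (X : M.RA) (k : ℕ) (tx : M.UTx)
  /-- POA: all answers for `candidateB₂` are there -/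
  | endFallback (V : M.Val) (X : M.RA) (k : ℕ)
  /-- Quorum Consensus decides at `V.X` -/
  | qcDecide (V : M.Val) (X : M.RA) (k : ℕ) (B : M.Block)
  /-- POA: `V.A` proposes to Transaction Agreement for a transaction decided in Quorum Consensus -/
  | uaInitiate (V : M.Val) (X : M.RA) (k : ℕ) (tx : M.UTx)
  /-- Transaction Agreement decides at `V.A` -/
  | taDecide (V : M.Val) (A : M.UA) (sn : ℕ) (d : Option M.UTx)
  /-- POA: decision in the slow path -/
  | slowDecide (V : M.Val) (X : M.RA) (k : ℕ)
  /-- `V.X` executes the decided block of its current instance -/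
  | execBlock (V : M.Val) (X : M.RA)

/-- The transitions. Timers are abstracted: a timer may expire at any moment. Messages from Byzantine
validators and transactions of incorrect users are arbitrary, except that signatures of others cannot be
forged. Only the states of honest validators are tracked. -/
inductive Step : Label M → State M → State M → Prop
  /-- A correct user signs one transaction for each sequence number, in order. -/
  | issue (s : State M) (tx : M.UTx) :
      tx ∉ s.issued →
      (tx.sender ∈ M.correctUser → tx.sn = s.nextSn tx.sender) →
      Step (.issue tx) s
        { s with
          issued := insert tx s.issued
          nextSn := Function.update s.nextSn tx.sender (s.nextSn tx.sender + 1) }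
  /-- The entity FP-locks the transaction if no conflicting one is FP-locked; for a UA transaction this is the
  POB handler, which then broadcasts a vote. -/
  | recvTx (s : State M) (V : M.Val) (tx : M.UTx) (e : UAEntity M) :
      M.Honest V → tx ∈ s.issued → tx ∉ (s.ua V tx.sender).received →
      e = (s.ua V tx.sender).tryFPLock tx →
      Step (.recvTx V tx) s (s.setUA V tx.sender
        { e with
          received := insert tx e.received
          voted := e.voted ∪ {t | t = tx ∧ tx.recipient = none ∧ e.fpLocked tx.sn = some tx} })
  | forward (s : State M) (V : M.Val) (tx : M.UTx) (X : M.RA) (e : UAEntity M) :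
      M.Honest V → e = s.ua V tx.sender → tx.recipient = some X →
      tx ∈ e.received → tx ∉ e.forwarded → e.fpLocked tx.sn = some tx → e.Ready tx →
      Step (.forward V tx) s
        ((s.setUA V tx.sender { e with forwarded := insert tx e.forwarded }).toPools V [Tx.user tx])
  | pobRecvVote (s : State M) (V W : M.Val) (tx : M.UTx) (e : UAEntity M) :
      M.Honest V → e = s.ua V tx.sender → tx ∉ e.votesFrom W →
      (M.Honest W → tx ∈ (s.ua W tx.sender).voted) →
      Step (.pobRecvVote V W tx) s (s.setUA V tx.sender
        { e with votesFrom := Function.update e.votesFrom W (insert tx (e.votesFrom W)) })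
  | pobFast (s : State M) (V : M.Val) (tx : M.UTx) (e : UAEntity M) :
      M.Honest V → e = s.ua V tx.sender → e.pobDecided tx.sn = none →
      M.n - M.p ≤ M.count (fun W => tx ∈ e.votesFrom W) →
      Step (.pobFast V tx) s (s.setUA V tx.sender
        ({ e with proofs := insert tx e.proofs }.pobDecide (tx ∈ s.issued) tx))
  | pobRecvProof (s : State M) (V W : M.Val) (tx : M.UTx) (e : UAEntity M) :
      M.Honest V → e = s.ua V tx.sender → tx ∉ e.proofs → s.PobProof tx →
      (M.Honest W → tx ∈ (s.ua W tx.sender).proofs) →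
      Step (.pobRecvProof V W tx) s (s.setUA V tx.sender
        ({ e with proofs := insert tx e.proofs }.pobDecide (tx ∈ s.issued) tx))
  | pobPropose (s : State M) (V : M.Val) (tx : M.UTx) (e : UAEntity M) :
      M.Honest V → e = s.ua V tx.sender → e.taProposed tx.sn = none →
      M.n - M.p - 2 * M.f ≤ M.count (fun W => tx ∈ e.votesFrom W) →
      (e.spLocked tx.sn = none ∨ e.spLocked tx.sn = some tx) →
      Step (.pobPropose V tx) s (s.setUA V tx.sender ((e.trySPLock tx).proposeTA tx.sn (some tx)))
  | pobSlow (s : State M) (V : M.Val) (tx : M.UTx) (e : UAEntity M) :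
      M.Honest V → e = s.ua V tx.sender → e.pobDecided tx.sn = none →
      e.taDecided tx.sn = some (some tx) →
      Step (.pobSlow V tx) s (s.setUA V tx.sender (e.pobDecide (tx ∈ s.issued) tx))
  | execUA (s : State M) (V : M.Val) (tx : M.UTx) (e : UAEntity M) :
      M.Honest V → e = s.ua V tx.sender → tx ∈ e.pending → tx.recipient = none → e.Ready tx →
      Step (.execUA V tx) s ((s.setUA V tx.sender
        ({ e with pending := e.pending \ {tx} }.execute tx)).grant V (M.runUA tx))
  | execUARA (s : State M) (V : M.Val) (tx : M.UTx) (c : Set (M.UA × M.Obj)) (e : UAEntity M) :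
      M.Honest V → e = s.ua V tx.sender → (tx, c) ∈ e.inbox → e.Ready tx →
      Step (.execUARA V tx c) s ((s.setUA V tx.sender
        ({ e with inbox := e.inbox \ {(tx, c)} }.execute tx)).grant V c)
  | propose (s : State M) (V : M.Val) (X : M.RA) (k : ℕ) (e : RAEntity M) :
      M.Honest V → e = s.ra V X → M.leader k = V → e.inst = k → e.proposal k = none →
      Step (.propose V X k) s
        (s.setRA V X { e with proposal := Function.update e.proposal k (some e.pool) })
  /-- Blocks for `X` consist of transactions whose recipient is `X`; others are ignored. -/
  | recvBlock (s : State M) (V : M.Val) (X : M.RA) (k : ℕ) (B : M.Block) (e : RAEntity M) :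
      M.Honest V → e = s.ra V X → e.block k = none →
      (M.Honest (M.leader k) → (s.ra (M.leader k) X).proposal k = some B) →
      (∀ tx ∈ B, tx.recipient = some X) →
      Step (.recvBlock V X k B) s (s.setRA V X { e with block := Function.update e.block k (some B) })
  | fpLock (s : State M) (V : M.Val) (X : M.RA) (k : ℕ) (tx : M.UTx) (B : M.Block) :
      M.Honest V → (s.ra V X).Considers k B → Tx.user tx ∈ B → tx ∈ s.issued →
      (s.ua V tx.sender).fpLocked tx.sn = none →
      Step (.fpLock V X k tx) s (s.setUA V tx.sender ((s.ua V tx.sender).tryFPLock tx))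
  | fpAck (s : State M) (V : M.Val) (X : M.RA) (k : ℕ) (tx : M.UTx) (B : M.Block) (e : RAEntity M) :
      M.Honest V → e = s.ra V X → e.Considers k B → Tx.user tx ∈ B → tx ∈ s.issued →
      tx ∉ e.fpOk k →
      (s.ua V tx.sender).fpLocked tx.sn = some tx → (s.ua V tx.sender).Ready tx →
      Step (.fpAck V X k tx) s
        (s.setRA V X { e with fpOk := Function.update e.fpOk k (insert tx (e.fpOk k)) })
  | voteBlock (s : State M) (V : M.Val) (X : M.RA) (k : ℕ) (B : M.Block) (e : RAEntity M) :
      M.Honest V → e = s.ra V X → e.Considers k B → e.vote k = none →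
      (∀ tx : M.UTx, Tx.user tx ∈ B → tx ∈ e.fpOk k) →
      Step (.voteBlock V X k) s
        (s.setRA V X { e with vote := Function.update e.vote k (some (some B, e.pool)) })
  /-- A negative answer to a request to FP-lock, or an expired timer, leads to a vote for `⊥`. -/
  | voteBot (s : State M) (V : M.Val) (X : M.RA) (k : ℕ) (e : RAEntity M) :
      M.Honest V → e = s.ra V X → e.inst = k → e.vote k = none →
      Step (.voteBot V X k) s
        (s.setRA V X { e with vote := Function.update e.vote k (some (none, e.pool)) })
  | recvVote (s : State M) (V W : M.Val) (X : M.RA) (k : ℕ) (v : M.Vote) (e : RAEntity M) :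
      M.Honest V → e = s.ra V X → e.votesFrom k W = none →
      (M.Honest W → (s.ra W X).vote k = some v) →
      Step (.recvVote V W X k v) s (s.setRA V X
        { e with votesFrom :=
            Function.update e.votesFrom k (Function.update (e.votesFrom k) W (some v)) })
  | fastDecide (s : State M) (V : M.Val) (X : M.RA) (k : ℕ) (B : M.Block) (e : RAEntity M) :
      M.Honest V → e = s.ra V X → e.proof k = none → M.n - M.p ≤ e.votesFor k B →
      Step (.fastDecide V X k) s
        (s.setRA V X ({ e with proof := Function.update e.proof k (some B) }.decide k B))
  | recvProof (s : State M) (V W : M.Val) (X : M.RA) (k : ℕ) (B : M.Block) (e : RAEntity M) :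
      M.Honest V → e = s.ra V X → e.proof k = none → s.PoaProof X k B →
      (M.Honest W → (s.ra W X).proof k = some B) →
      Step (.recvProof V W X k B) s
        (s.setRA V X ({ e with proof := Function.update e.proof k (some B) }.decide k B))
  /-- After the timer, with `n - f` votes, some block having `n - p - 2f` of them. -/
  | startSlow_cand (s : State M) (V : M.Val) (X : M.RA) (k : ℕ) (B : M.Block) (e : RAEntity M) :
      M.Honest V → e = s.ra V X → e.inst = k → e.cand k = none → e.candFb k = none →
      M.n - M.f ≤ e.votesTotal k → M.n - M.p - 2 * M.f ≤ e.votesFor k B →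
      Step (.startSlow V X k) s (s.setRA V X { e with cand := Function.update e.cand k (some B) })
  /-- After the timer, with `n - f` votes, no block having `n - p - 2f` of them. -/
  | startSlow_fallback (s : State M) (V : M.Val) (X : M.RA) (k : ℕ) (e : RAEntity M) :
      M.Honest V → e = s.ra V X → e.inst = k → e.cand k = none → e.candFb k = none →
      M.n - M.f ≤ e.votesTotal k → (∀ B, e.votesFor k B < M.n - M.p - 2 * M.f) →
      Step (.startSlow V X k) s
        (s.setRA V X { e with candFb := Function.update e.candFb k (some (e.fallback k)) })
  | spLock (s : State M) (V : M.Val) (X : M.RA) (k : ℕ) (tx : M.UTx) (B : M.Block)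
      (e : RAEntity M) (d : UAEntity M) :
      M.Honest V → e = s.ra V X → e.cand k = some B → Tx.user tx ∈ B → e.reply k tx = none →
      d = (s.ua V tx.sender).trySPLock tx →
      Step (.spLock V X k tx) s ((s.setUA V tx.sender d).setRA V X
        { e with
          reply := Function.update e.reply k
                    (Function.update (e.reply k) tx (some (decide (d.spLocked tx.sn = some tx)))) })
  | endCand_success (s : State M) (V : M.Val) (X : M.RA) (k : ℕ) (B : M.Block) (e : RAEntity M) :
      M.Honest V → e = s.ra V X → e.cand k = some B → e.candFb k = none → e.qcProposed k = none →
      (∀ tx : M.UTx, Tx.user tx ∈ B → e.reply k tx = some true) →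
      Step (.endCand V X k) s
        (s.setRA V X { e with qcProposed := Function.update e.qcProposed k (some B) })
  | endCand_failure (s : State M) (V : M.Val) (X : M.RA) (k : ℕ) (B : M.Block) (e : RAEntity M) :
      M.Honest V → e = s.ra V X → e.cand k = some B → e.candFb k = none → e.qcProposed k = none →
      (∀ tx : M.UTx, Tx.user tx ∈ B → e.reply k tx ≠ none) →
      (∃ tx : M.UTx, Tx.user tx ∈ B ∧ e.reply k tx = some false) →
      Step (.endCand V X k) s
        (s.setRA V X { e with candFb := Function.update e.candFb k (some (e.fallback k)) })
  | spLockFb (s : State M) (V : M.Val) (X : M.RA) (k : ℕ) (tx : M.UTx) (B : M.Block)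
      (e : RAEntity M) (d : UAEntity M) :
      M.Honest V → e = s.ra V X → e.candFb k = some B → Tx.user tx ∈ B → e.replyFb k tx = none →
      d = (s.ua V tx.sender).trySPLock tx →
      Step (.spLockFb V X k tx) s ((s.setUA V tx.sender d).setRA V X
        { e with
          replyFb := Function.update e.replyFb k
                    (Function.update (e.replyFb k) tx (some (decide (d.spLocked tx.sn = some tx)))) })
  /-- Propose the RA-RA transactions and the SP-locked UA-RA transactions of `candidateB₂`. -/
  | endFallback (s : State M) (V : M.Val) (X : M.RA) (k : ℕ) (B : M.Block) (e : RAEntity M) :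
      M.Honest V → e = s.ra V X → e.candFb k = some B → e.qcProposed k = none →
      (∀ tx : M.UTx, Tx.user tx ∈ B → e.replyFb k tx ≠ none) →
      Step (.endFallback V X k) s (s.setRA V X
        { e with
          qcProposed := Function.update e.qcProposed k
            (some (B.filter fun t => ∀ tx : M.UTx, t = Tx.user tx → e.replyFb k tx = some true)) })
  | qcDecide (s : State M) (V : M.Val) (X : M.RA) (k : ℕ) (B : M.Block) (e : RAEntity M) :
      M.Honest V → e = s.ra V X → e.qcDecided k = none →
      Step (.qcDecide V X k B) s
        (s.setRA V X { e with qcDecided := Function.update e.qcDecided k (some B) })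
  /-- SP-lock `tx` if possible, and propose the SP-locked transaction. -/
  | uaInitiate (s : State M) (V : M.Val) (X : M.RA) (k : ℕ) (tx : M.UTx) (B : M.Block)
      (d : UAEntity M) :
      M.Honest V → (s.ra V X).qcDecided k = some B → Tx.user tx ∈ B →
      (s.ua V tx.sender).taProposed tx.sn = none → d = (s.ua V tx.sender).trySPLock tx →
      Step (.uaInitiate V X k tx) s (s.setUA V tx.sender (d.proposeTA tx.sn (d.spLocked tx.sn)))
  | taDecide (s : State M) (V : M.Val) (A : M.UA) (sn : ℕ) (v : Option M.UTx) (e : UAEntity M) :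
      M.Honest V → e = s.ua V A → e.taDecided sn = none →
      Step (.taDecide V A sn v) s
        (s.setUA V A { e with taDecided := Function.update e.taDecided sn (some v) })
  /-- Once all Transaction Agreements have decided, decide the block without the transactions that failed. -/
  | slowDecide (s : State M) (V : M.Val) (X : M.RA) (k : ℕ) (B : M.Block) (e : RAEntity M) :
      M.Honest V → e = s.ra V X → e.qcDecided k = some B → e.decided k = none →
      (∀ tx : M.UTx, Tx.user tx ∈ B → (s.ua V tx.sender).taDecided tx.sn ≠ none) →
      Step (.slowDecide V X k) s (s.setRA V X (e.decide k
        (B.filter fun t => ∀ tx : M.UTx, t = Tx.user tx →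
          (s.ua V tx.sender).taDecided tx.sn = some (some tx))))
  | execBlock (s : State M) (V : M.Val) (X : M.RA) (B : M.Block) :
      M.Honest V → (s.ra V X).decided (s.ra V X).inst = some B →
      Step (.execBlock V X) s (s.execBlock V X B)

/-- The events that must happen if they stay possible: local computations and timers of honest validators,
delivery of messages sent by honest validators, and of transactions sent by correct users. Whether users issue
transactions, what Byzantine validators and incorrect users send, and the decisions of the two consensus
primitives are not constrained here. -/
def Label.Fair : Label M → Prop
  | .issue _ => False
  | .recvTx _ tx => tx.sender ∈ M.correctUser
  | .pobRecvVote _ W _ => M.Honest W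
  | .pobRecvProof _ W _ => M.Honest W
  | .recvBlock _ _ k _ => M.Honest (M.leader k)
  | .recvVote _ W _ _ _ => M.Honest W
  | .recvProof _ W _ _ _ => M.Honest W
  | .qcDecide _ _ _ _ => False
  | .taDecide _ _ _ _ => False
  | _ => True

/-! ### Executions -/

/-- A sequence of states, with the event (if any) that leads from each state to the next one. -/
structure Run (M : System.{u}) : Type u where
  state : ℕ → State M
  label : ℕ → Option (Label M)

namespace Run

/-- The sequence starts in the initial state and follows the transitions. -/
structure IsExecution (r : Run M) : Prop where
  init : r.state 0 = State.init M
  step : ∀ t l, r.label t = some l → Step l (r.state t) (r.state (t + 1))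
  idle : ∀ t, r.label t = none → r.state (t + 1) = r.state t

/-- Eventual delivery and progress: an event of the kind `Label.Fair` does not stay possible forever without
happening. -/
def IsFair (r : Run M) : Prop :=
  ∀ l : Label M, l.Fair → ∀ t, (∀ t' ≥ t, ∃ s', Step l (r.state t') s') →
    ∃ t' ≥ t, r.label t' = some l

def QCProposes (r : Run M) (V : M.Val) (X : M.RA) (k : ℕ) (B : M.Block) : Prop :=
  ∃ t, ((r.state t).ra V X).qcProposed k = some B

def QCDecides (r : Run M) (V : M.Val) (X : M.RA) (k : ℕ) (B : M.Block) : Prop :=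
  ∃ t, ((r.state t).ra V X).qcDecided k = some B

def TAProposes (r : Run M) (V : M.Val) (A : M.UA) (sn : ℕ) (tx : M.UTx) : Prop :=
  ∃ t, ((r.state t).ua V A).taProposed sn = some tx

def TADecides (r : Run M) (V : M.Val) (A : M.UA) (sn : ℕ) (d : Option M.UTx) : Prop :=
  ∃ t, ((r.state t).ua V A).taDecided sn = some d

/-- The specification of the primitive Quorum Consensus (one instance for each `X` and `k`). -/
structure QuorumConsensusSpec (r : Run M) : Prop where
  agreement : ∀ X k V W B B', M.Honest V → M.Honest W → r.QCDecides V X k B → r.QCDecides W X k B' →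
    B = B'
  /-- a transaction in the proposal of every honest validator (that proposes) is decided -/
  validity_all : ∀ X k V B tx, M.Honest V → r.QCDecides V X k B →
    (∀ W B', M.Honest W → r.QCProposes W X k B' → tx ∈ B') → tx ∈ B
  /-- a decided transaction is in the proposals of at least `n - 3f` honest validators -/
  validity_quorum : ∀ t X k V B tx, M.Honest V → ((r.state t).ra V X).qcDecided k = some B → tx ∈ B →
    M.n - 3 * M.f ≤ M.count fun W =>
      M.Honest W ∧ ∃ B', ((r.state t).ra W X).qcProposed k = some B' ∧ tx ∈ B'
  /-- if all honest validators propose, all of them decide -/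
  termination : ∀ X k, (∀ W, M.Honest W → ∃ B, r.QCProposes W X k B) →
    ∀ V, M.Honest V → ∃ B, r.QCDecides V X k B
  /-- if one honest validator decides, all of them decide -/
  totality : ∀ X k W B, M.Honest W → r.QCDecides W X k B →
    ∀ V, M.Honest V → ∃ B', r.QCDecides V X k B'

/-- The specification of the primitive Transaction Agreement (one instance for each `A` and `sn`). The decision
may be empty (`none`). -/
structure TransactionAgreementSpec (r : Run M) : Prop where
  agreement : ∀ A sn V W d d', M.Honest V → M.Honest W → r.TADecides V A sn d → r.TADecides W A sn d' →
    d = d'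
  /-- if all honest validators (that propose) propose the same value, only that value can be decided -/
  validity_all : ∀ A sn V d tx, M.Honest V → r.TADecides V A sn d →
    (∀ W tx', M.Honest W → r.TAProposes W A sn tx' → tx' = tx) → d = some tx
  /-- a decided value was proposed by at least `n - 3f` honest validators -/
  validity_quorum : ∀ t A sn V tx, M.Honest V → ((r.state t).ua V A).taDecided sn = some (some tx) →
    M.n - 3 * M.f ≤ M.count fun W => M.Honest W ∧ ((r.state t).ua W A).taProposed sn = some tx
  /-- if all honest validators propose, all of them decide -/
  termination : ∀ A sn, (∀ W, M.Honest W → ∃ tx, r.TAProposes W A sn tx) →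
    ∀ V, M.Honest V → ∃ d, r.TADecides V A sn d
  /-- if one honest validator decides, all of them decide -/
  totality : ∀ A sn W d, M.Honest W → r.TADecides W A sn d →
    ∀ V, M.Honest V → ∃ d', r.TADecides V A sn d'

/-! ### Notions of the theorem -/

/-- A user transaction is emitted: it is signed and broadcast at a moment from which on some honest `V.A` will
eventually have executed the transaction with the previous sequence number and own the consumed objects. -/
def Emitted (r : Run M) (tx : M.UTx) : Prop :=
  ∃ t, r.label t = some (.issue tx) ∧
    ∃ V, M.Honest V ∧ ∃ t' ≥ t, ((r.state t').ua V tx.sender).Ready tx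

/-- The entity `V.A` executes `tx`. -/
def ExecutesUA (r : Run M) (V : M.Val) (A : M.UA) (tx : M.UTx) : Prop :=
  ∃ t, tx ∈ ((r.state t).ua V A).log

/-- The entity `V.X` executes `tx`. -/
def ExecutesRA (r : Run M) (V : M.Val) (X : M.RA) (tx : M.UTx) : Prop :=
  ∃ t, Tx.user tx ∈ ((r.state t).ra V X).log

/-- Some entity of `V` executes `tx`. -/
def Executes (r : Run M) (V : M.Val) (tx : M.UTx) : Prop :=
  (∃ A, r.ExecutesUA V A tx) ∨ ∃ X, r.ExecutesRA V X tx

/-- `V` executes `tx` completely: at the entity of the sender, and, for a UA-RA transaction, at the entity of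
the recipient. -/
def ExecutesFully (r : Run M) (V : M.Val) (tx : M.UTx) : Prop :=
  r.ExecutesUA V tx.sender tx ∧ ∀ X, tx.recipient = some X → r.ExecutesRA V X tx

/-- `tx` is executed at `V` at most once: only at the entities of its sender and of its recipient, and by each
of them at most once. -/
def ExecutesAtMostOnce (r : Run M) (V : M.Val) (tx : M.UTx) : Prop :=
  (∀ A, r.ExecutesUA V A tx → A = tx.sender) ∧
  (∀ X, r.ExecutesRA V X tx → tx.recipient = some X) ∧
  ∀ t, (∀ A, ((r.state t).ua V A).log.count tx ≤ 1) ∧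
    ∀ X, ((r.state t).ra V X).log.count (Tx.user tx) ≤ 1

end Run

end

end Mangrove

/-! Safety is quorum counting. A quorum for a property is a set of validators all of whose honest
members have it. Every SP-lock, hence every proposal to and every non-empty decision of Transaction
Agreement, rests on a quorum of `n - p - 2f` FP-locks (`Admissible.spLocked_spec`), and every fast
decision on one of `n - p`. As `n > 3f + 2p`, the two sizes add up to more than `n + f`, so the two
quorums share an honest validator, and that validator FP-locks only one transaction per slot (sender
and sequence number). Thus a fast decision excludes a conflicting slow one; two slow decisions agree
because Transaction Agreement does. A transaction agreed upon in one of these ways is `Certified`. A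
slot has at most one certified transaction (`Admissible.certified_unique`) and only certified user
transactions are executed, which gives agreement.

Blocks are treated by the same counting. If `n - p` votes exist for `B`, no other block becomes a
candidate, no validator with `n - f` votes can miss the candidate `B`, and no SP-lock for a
transaction of `B` fails. So only `B` is proposed to Quorum Consensus (`Admissible.qcProposed_eq`),
and the slow path can decide nothing but `B`. Honest validators therefore decide the same block in
each instance (`Admissible.decided_unique`), and since execution is deterministic, the state and log
of every `V.X` are those of one common `ledger`, cut off at the instance that `V.X` has reached. The
invariant `Tracked` follows a transaction through the decision, the queues and the log of `V.A` and
yields execution at most once.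

Liveness uses one rule: an event that is enabled as long as a stable goal fails, and that
establishes the goal, makes the goal eventually true (`Live.eventually_of_ge`). Instances of
Parallel Optimistic Agreement never get stuck (`Live.exists_decided`), and whatever one honest
validator decides reaches all others. The delicate point is that readiness spreads from one honest
`V.A` to all others, although owned objects come and go. `Admissible.owned_spec` describes the owned
objects as those obtained and not consumed, which is correct because an object determines its
creator and so is handed out only once. `Live.due_total` and `Live.uaLog_total` then show, by
induction on time, that executions at one honest validator are repeated at all.

For a correct user only one transaction per slot is ever signed, so all locks and decisions of the
slot are for it. A UA transaction is then decided through Transaction Agreement. A UA-RA transaction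
enters all honest pools and stays there until it is executed, so an instance with an honest leader
that is late enough must decide it (`Live.mem_decided`). -/

namespace Mangrove

open scoped Classical
open Filter

variable {M : System.{u}}

/-! ### Projections of updated states -/

section Projections
variable (s : State M) (V v : M.Val) (A a : M.UA) (X x : M.RA)

@[simp] theorem State.setUA_ra (e : UAEntity M) : (s.setUA V A e).ra = s.ra := rfl
@[simp] theorem State.setRA_ua (e : RAEntity M) : (s.setRA V X e).ua = s.ua := rfl
@[simp] theorem State.grant_ra (c : Set (M.UA × M.Obj)) : (s.grant V c).ra = s.ra := rfl
@[simp] theorem State.report_ra (o : List (M.Trans × Set (M.UA × M.Obj))) :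
    (s.report V o).ra = s.ra := rfl
@[simp] theorem State.toPools_ua (l : List M.Trans) : (s.toPools V l).ua = s.ua := rfl

theorem State.setUA_ua (e : UAEntity M) :
    (s.setUA V A e).ua v a = if v = V ∧ a = A then e else s.ua v a := rfl
theorem State.setRA_ra (e : RAEntity M) :
    (s.setRA V X e).ra v x = if v = V ∧ x = X then e else s.ra v x := rfl

@[simp] theorem State.setUA_self (e : UAEntity M) : (s.setUA V A e).ua V A = e := if_pos ⟨rfl, rfl⟩
@[simp] theorem State.setRA_self (e : RAEntity M) : (s.setRA V X e).ra V X = e := if_pos ⟨rfl, rfl⟩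

end Projections

/-! ### Monotone parts of the state -/

/-- `b` keeps the value of `a`, once it is set. -/
def Keeps {α : Type*} (a b : Option α) : Prop := ∀ x, a = some x → b = some x

theorem Keeps.refl {α : Type*} (a : Option α) : Keeps a a := fun _ h => h

theorem Keeps.update {α β : Type*} [DecidableEq α] {g : α → Option β} {a : α} (h : g a = none) (b : Option β) (x : α) :
    Keeps (g x) (Function.update g a b x) := by
  intro y hy
  by_cases hx : x = a
  · subst hx; simp [h] at hy
  · simpa [Function.update_of_ne hx] using hy

/-- `pending`, `inbox` and `owned` are absent because executions remove elements from them. -/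
structure UAEntity.Extends (e e' : UAEntity M) : Prop where
  fpLocked : ∀ sn, Keeps (e.fpLocked sn) (e'.fpLocked sn)
  spLocked : ∀ sn, Keeps (e.spLocked sn) (e'.spLocked sn)
  received : e.received ⊆ e'.received
  forwarded : e.forwarded ⊆ e'.forwarded
  voted : e.voted ⊆ e'.voted
  votesFrom : ∀ W, e.votesFrom W ⊆ e'.votesFrom W
  proofs : e.proofs ⊆ e'.proofs
  pobDecided : ∀ sn, Keeps (e.pobDecided sn) (e'.pobDecided sn)
  log : e.log ⊆ e'.log
  taProposed : ∀ sn, Keeps (e.taProposed sn) (e'.taProposed sn)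
  taDecided : ∀ sn, Keeps (e.taDecided sn) (e'.taDecided sn)

/-- `pool` and `st` are absent: a pool shrinks when a block is executed, and the state is
overwritten. -/
structure RAEntity.Extends (e e' : RAEntity M) : Prop where
  inst : e.inst ≤ e'.inst
  log : e.log ⊆ e'.log
  proposal : ∀ k, Keeps (e.proposal k) (e'.proposal k)
  block : ∀ k, Keeps (e.block k) (e'.block k)
  fpOk : ∀ k, e.fpOk k ⊆ e'.fpOk k
  vote : ∀ k, Keeps (e.vote k) (e'.vote k)
  votesFrom : ∀ k W, Keeps (e.votesFrom k W) (e'.votesFrom k W)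
  proof : ∀ k, Keeps (e.proof k) (e'.proof k)
  cand : ∀ k, Keeps (e.cand k) (e'.cand k)
  reply : ∀ k tx, Keeps (e.reply k tx) (e'.reply k tx)
  candFb : ∀ k, Keeps (e.candFb k) (e'.candFb k)
  replyFb : ∀ k tx, Keeps (e.replyFb k tx) (e'.replyFb k tx)
  qcProposed : ∀ k, Keeps (e.qcProposed k) (e'.qcProposed k)
  qcDecided : ∀ k, Keeps (e.qcDecided k) (e'.qcDecided k)
  decided : ∀ k, Keeps (e.decided k) (e'.decided k)

structure State.Extends (s s' : State M) : Prop where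
  issued : s.issued ⊆ s'.issued
  ua : ∀ V A, (s.ua V A).Extends (s'.ua V A)
  ra : ∀ V X, (s.ra V X).Extends (s'.ra V X)

theorem UAEntity.Extends.refl (e : UAEntity M) : e.Extends e := by
  constructor <;> first | exact List.Subset.refl _ | (intros; first | exact Keeps.refl _ | exact subset_rfl)

theorem RAEntity.Extends.refl (e : RAEntity M) : e.Extends e := by
  constructor <;>
    first | exact List.Subset.refl _ | exact le_rfl | (intros; first | exact Keeps.refl _ | exact subset_rfl)

theorem UAEntity.Extends.trans {a b c : UAEntity M} (h : a.Extends b) (h' : b.Extends c) :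
    a.Extends c where
  fpLocked sn x hx := h'.fpLocked sn x (h.fpLocked sn x hx)
  spLocked sn x hx := h'.spLocked sn x (h.spLocked sn x hx)
  received := h.received.trans h'.received
  forwarded := h.forwarded.trans h'.forwarded
  voted := h.voted.trans h'.voted
  votesFrom W := (h.votesFrom W).trans (h'.votesFrom W)
  proofs := h.proofs.trans h'.proofs
  pobDecided sn x hx := h'.pobDecided sn x (h.pobDecided sn x hx)
  log := List.Subset.trans h.log h'.log
  taProposed sn x hx := h'.taProposed sn x (h.taProposed sn x hx)
  taDecided sn x hx := h'.taDecided sn x (h.taDecided sn x hx)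

theorem RAEntity.Extends.trans {a b c : RAEntity M} (h : a.Extends b) (h' : b.Extends c) :
    a.Extends c where
  inst := h.inst.trans h'.inst
  log := List.Subset.trans h.log h'.log
  proposal k x hx := h'.proposal k x (h.proposal k x hx)
  block k x hx := h'.block k x (h.block k x hx)
  fpOk k := (h.fpOk k).trans (h'.fpOk k)
  vote k x hx := h'.vote k x (h.vote k x hx)
  votesFrom k W x hx := h'.votesFrom k W x (h.votesFrom k W x hx)
  proof k x hx := h'.proof k x (h.proof k x hx)
  cand k x hx := h'.cand k x (h.cand k x hx)
  reply k tx x hx := h'.reply k tx x (h.reply k tx x hx)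
  candFb k x hx := h'.candFb k x (h.candFb k x hx)
  replyFb k tx x hx := h'.replyFb k tx x (h.replyFb k tx x hx)
  qcProposed k x hx := h'.qcProposed k x (h.qcProposed k x hx)
  qcDecided k x hx := h'.qcDecided k x (h.qcDecided k x hx)
  decided k x hx := h'.decided k x (h.decided k x hx)

theorem State.Extends.refl (s : State M) : s.Extends s :=
  ⟨subset_rfl, fun _ _ => .refl _, fun _ _ => .refl _⟩

theorem State.Extends.trans {a b c : State M} (h : a.Extends b) (h' : b.Extends c) : a.Extends c :=
  ⟨h.issued.trans h'.issued, fun V A => (h.ua V A).trans (h'.ua V A),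
    fun V X => (h.ra V X).trans (h'.ra V X)⟩

theorem State.Extends.setUA (s : State M) {V : M.Val} {A : M.UA} {e : UAEntity M}
    (h : (s.ua V A).Extends e) : s.Extends (s.setUA V A e) := by
  refine ⟨subset_rfl, fun v a => ?_, fun _ _ => .refl _⟩
  by_cases hva : v = V ∧ a = A
  · obtain ⟨rfl, rfl⟩ := hva; simpa [State.setUA] using h
  · simpa [State.setUA, hva] using UAEntity.Extends.refl _

theorem State.Extends.setRA (s : State M) {V : M.Val} {X : M.RA} {e : RAEntity M}
    (h : (s.ra V X).Extends e) : s.Extends (s.setRA V X e) := by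
  refine ⟨subset_rfl, fun _ _ => .refl _, fun v a => ?_⟩
  by_cases hva : v = V ∧ a = X
  · obtain ⟨rfl, rfl⟩ := hva; simpa [State.setRA] using h
  · simpa [State.setRA, hva] using RAEntity.Extends.refl _

theorem State.Extends.grant (s : State M) (V : M.Val) (c : Set (M.UA × M.Obj)) :
    s.Extends (s.grant V c) := by
  refine ⟨subset_rfl, fun v a => ?_, fun _ _ => .refl _⟩
  have h := UAEntity.Extends.refl (s.ua v a)
  by_cases hv : v = V
  · simp only [State.grant, hv, if_true] at h ⊢
    exact { h with }
  · simpa [State.grant, hv] using h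

theorem State.Extends.report (s : State M) (V : M.Val) (out : List (M.Trans × Set (M.UA × M.Obj))) :
    s.Extends (s.report V out) := by
  refine ⟨subset_rfl, fun v a => ?_, fun _ _ => .refl _⟩
  have h := UAEntity.Extends.refl (s.ua v a)
  by_cases hv : v = V
  · simp only [State.report, hv, if_true] at h ⊢
    exact { h with }
  · simpa [State.report, hv] using h

theorem State.Extends.toPools (s : State M) (V : M.Val) (txs : List M.Trans) :
    s.Extends (s.toPools V txs) := by
  refine ⟨subset_rfl, fun _ _ => .refl _, fun v a => ?_⟩
  have h := RAEntity.Extends.refl (s.ra v a)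
  by_cases hv : v = V
  · simp only [State.toPools, hv, if_true] at h ⊢
    exact { h with }
  · simpa [State.toPools, hv] using h

theorem UAEntity.extends_tryFPLock (e : UAEntity M) (tx : M.UTx) : e.Extends (e.tryFPLock tx) := by
  unfold UAEntity.tryFPLock
  split_ifs with h
  · exact { UAEntity.Extends.refl e with fpLocked := fun _ => Keeps.update h _ _ }
  · exact .refl e

theorem UAEntity.extends_trySPLock (e : UAEntity M) (tx : M.UTx) : e.Extends (e.trySPLock tx) := by
  unfold UAEntity.trySPLock
  split_ifs with h
  · exact { UAEntity.Extends.refl e with spLocked := fun _ => Keeps.update h _ _ }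
  · exact .refl e

theorem UAEntity.extends_proposeTA (e : UAEntity M) (sn : ℕ) (tx : Option M.UTx) :
    e.Extends (e.proposeTA sn tx) := by
  unfold UAEntity.proposeTA
  split_ifs with h
  · exact { UAEntity.Extends.refl e with taProposed := fun _ => Keeps.update h _ _ }
  · exact .refl e

theorem UAEntity.extends_pobDecide (e : UAEntity M) (sig : Prop) (tx : M.UTx) :
    e.Extends (e.pobDecide sig tx) := by
  unfold UAEntity.pobDecide
  split_ifs with h
  · exact { UAEntity.Extends.refl e with pobDecided := fun _ => Keeps.update h _ _ }
  · exact .refl e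

theorem UAEntity.extends_execute (e : UAEntity M) (tx : M.UTx) : e.Extends (e.execute tx) :=
  { UAEntity.Extends.refl e with log := List.subset_append_left _ _ }

theorem RAEntity.extends_decide (e : RAEntity M) (k : ℕ) (B : M.Block) : e.Extends (e.decide k B) := by
  unfold RAEntity.decide
  split_ifs with h
  · exact { RAEntity.Extends.refl e with decided := fun _ => Keeps.update h _ _ }
  · exact .refl e

theorem Batch.log_subset_run (X : M.RA) (b : Batch M) (tx : M.Trans) : b.log ⊆ (b.run X tx).log := by
  unfold Batch.run
  split_ifs
  · exact List.Subset.refl _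
  · exact List.subset_append_left _ _

theorem Batch.log_subset_foldl (X : M.RA) (l : List M.Trans) (b : Batch M) :
    b.log ⊆ (l.foldl (Batch.run X) b).log := by
  induction l generalizing b with
  | nil => exact List.Subset.refl _
  | cons t l ih => exact List.Subset.trans (b.log_subset_run X t) (ih _)

/-- Every write to an optional field is guarded by that field being unset, and the sets and logs
concerned only receive insertions. -/
theorem Step.extends {l : Label M} {s s' : State M} (h : Step l s s') : s.Extends s' := by
  cases h with
  | issue => exact ⟨Set.subset_insert _ _, fun _ _ => .refl _, fun _ _ => .refl _⟩
  | recvTx _ V tx e _ _ _ he =>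
    subst he
    refine .setUA _ ((UAEntity.extends_tryFPLock _ tx).trans ?_)
    exact { UAEntity.Extends.refl _ with
      received := Set.subset_insert _ _, voted := Set.subset_union_left }
  | forward _ V tx X e _ he =>
    subst he
    refine .trans (.setUA _ ?_) (.toPools _ _ _)
    exact { UAEntity.Extends.refl _ with forwarded := Set.subset_insert _ _ }
  | pobRecvVote _ V W tx e _ he =>
    subst he
    refine .setUA _ { UAEntity.Extends.refl _ with votesFrom := fun W' => ?_ }
    by_cases hW : W' = W
    · subst hW; simp
    · simp [Function.update_of_ne hW]
  | pobFast _ V tx e _ he =>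
    subst he
    refine .setUA _ (.trans ?_ (UAEntity.extends_pobDecide _ _ _))
    exact { UAEntity.Extends.refl _ with proofs := Set.subset_insert _ _ }
  | pobRecvProof _ V W tx e _ he =>
    subst he
    refine .setUA _ (.trans ?_ (UAEntity.extends_pobDecide _ _ _))
    exact { UAEntity.Extends.refl _ with proofs := Set.subset_insert _ _ }
  | pobPropose _ V tx e _ he =>
    subst he
    exact .setUA _ (.trans (UAEntity.extends_trySPLock _ _) (UAEntity.extends_proposeTA _ _ _))
  | pobSlow _ V tx e _ he => subst he; exact .setUA _ (UAEntity.extends_pobDecide _ _ _)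
  | execUA _ V tx e _ he =>
    subst he
    refine .trans (.setUA _ (.trans ?_ (UAEntity.extends_execute _ _))) (.grant _ _ _)
    exact { UAEntity.Extends.refl _ with }
  | execUARA _ V tx c e _ he =>
    subst he
    refine .trans (.setUA _ (.trans ?_ (UAEntity.extends_execute _ _))) (.grant _ _ _)
    exact { UAEntity.Extends.refl _ with }
  | propose _ V X k e _ he _ _ h =>
    subst he; exact .setRA _ { RAEntity.Extends.refl _ with proposal := fun _ => Keeps.update h _ _ }
  | recvBlock _ V X k B e _ he h =>
    subst he; exact .setRA _ { RAEntity.Extends.refl _ with block := fun _ => Keeps.update h _ _ }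
  | fpLock _ V X k tx B => exact .setUA _ (UAEntity.extends_tryFPLock _ _)
  | fpAck _ V X k tx B e _ he =>
    subst he
    refine .setRA _ { RAEntity.Extends.refl _ with fpOk := fun k' => ?_ }
    by_cases hk : k' = k
    · subst hk; simp
    · simp [Function.update_of_ne hk]
  | voteBlock _ V X k B e _ he _ h =>
    subst he; exact .setRA _ { RAEntity.Extends.refl _ with vote := fun _ => Keeps.update h _ _ }
  | voteBot _ V X k e _ he _ h =>
    subst he; exact .setRA _ { RAEntity.Extends.refl _ with vote := fun _ => Keeps.update h _ _ }
  | recvVote _ V W X k v e _ he h =>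
    subst he
    refine .setRA _ { RAEntity.Extends.refl _ with votesFrom := fun k' W' => ?_ }
    by_cases hk : k' = k
    · subst hk; simpa using Keeps.update h _ _
    · simpa [Function.update_of_ne hk] using Keeps.refl _
  | fastDecide _ V X k B e _ he h =>
    subst he
    refine .setRA _ (.trans ?_ (RAEntity.extends_decide _ _ _))
    exact { RAEntity.Extends.refl _ with proof := fun _ => Keeps.update h _ _ }
  | recvProof _ V W X k B e _ he h =>
    subst he
    refine .setRA _ (.trans ?_ (RAEntity.extends_decide _ _ _))
    exact { RAEntity.Extends.refl _ with proof := fun _ => Keeps.update h _ _ }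
  | startSlow_cand _ V X k B e _ he _ h =>
    subst he; exact .setRA _ { RAEntity.Extends.refl _ with cand := fun _ => Keeps.update h _ _ }
  | startSlow_fallback _ V X k e _ he _ _ h =>
    subst he; exact .setRA _ { RAEntity.Extends.refl _ with candFb := fun _ => Keeps.update h _ _ }
  | spLock _ V X k tx B e d _ he _ _ h hd =>
    subst he hd
    refine .trans (.setUA _ (UAEntity.extends_trySPLock _ _)) (.setRA _ ?_)
    refine { RAEntity.Extends.refl _ with reply := fun k' t' => ?_ }
    by_cases hk : k' = k
    · subst hk; simpa using Keeps.update h _ _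
    · simpa [Function.update_of_ne hk] using Keeps.refl _
  | endCand_success _ V X k B e _ he _ _ h =>
    subst he; exact .setRA _ { RAEntity.Extends.refl _ with qcProposed := fun _ => Keeps.update h _ _ }
  | endCand_failure _ V X k B e _ he _ h =>
    subst he; exact .setRA _ { RAEntity.Extends.refl _ with candFb := fun _ => Keeps.update h _ _ }
  | spLockFb _ V X k tx B e d _ he _ _ h hd =>
    subst he hd
    refine .trans (.setUA _ (UAEntity.extends_trySPLock _ _)) (.setRA _ ?_)
    refine { RAEntity.Extends.refl _ with replyFb := fun k' t' => ?_ }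
    by_cases hk : k' = k
    · subst hk; simpa using Keeps.update h _ _
    · simpa [Function.update_of_ne hk] using Keeps.refl _
  | endFallback _ V X k B e _ he _ h =>
    subst he; exact .setRA _ { RAEntity.Extends.refl _ with qcProposed := fun _ => Keeps.update h _ _ }
  | qcDecide _ V X k B e _ he h =>
    subst he; exact .setRA _ { RAEntity.Extends.refl _ with qcDecided := fun _ => Keeps.update h _ _ }
  | uaInitiate _ V X k tx B d _ _ _ _ hd =>
    subst hd
    exact .setUA _ (.trans (UAEntity.extends_trySPLock _ _) (UAEntity.extends_proposeTA _ _ _))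
  | taDecide _ V A sn v e _ he h =>
    subst he; exact .setUA _ { UAEntity.Extends.refl _ with taDecided := fun _ => Keeps.update h _ _ }
  | slowDecide _ V X k B e _ he => subst he; exact .setRA _ (RAEntity.extends_decide _ _ _)
  | execBlock _ V X B =>
    refine .trans (.trans (.trans (.setRA _ ?_) (.toPools _ _ _)) (.report _ _ _)) (.grant _ _ _)
    exact { RAEntity.Extends.refl _ with
      inst := Nat.le_succ _, log := Batch.log_subset_foldl X B.toList ⟨_, _, _, _⟩ }

/-! ### Growth of the state along an execution. -/

namespace Run

theorem IsExecution.step' {r : Run M} (h : r.IsExecution) (t : ℕ) :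
    r.state (t + 1) = r.state t ∨ ∃ l, r.label t = some l ∧ Step l (r.state t) (r.state (t + 1)) := by
  cases hl : r.label t with
  | none => exact .inl (h.idle t hl)
  | some l => exact .inr ⟨l, rfl, h.step t l hl⟩

theorem IsExecution.extends {r : Run M} (h : r.IsExecution) {t t' : ℕ} (htt : t ≤ t') :
    (r.state t).Extends (r.state t') := by
  induction t', htt using Nat.le_induction with
  | base => exact .refl _
  | succ t' _ ih =>
    rcases h.step' t' with he | ⟨l, -, hs⟩
    · rw [he]; exact ih
    · exact ih.trans hs.extends

theorem IsExecution.invariant {r : Run M} (h : r.IsExecution) {P : State M → Prop}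
    (h0 : P (State.init M))
    (hs : ∀ t l, r.label t = some l → Step l (r.state t) (r.state (t + 1)) → P (r.state t) →
      P (r.state (t + 1))) (t : ℕ) : P (r.state t) := by
  induction t with
  | zero => rw [h.init]; exact h0
  | succ t ih =>
    rcases h.step' t with he | ⟨l, hl, hst⟩
    · rw [he]; exact ih
    · exact hs t l hl hst ih

end Run

/-! ### How the fields of the entities change -/

theorem UAEntity.spLocked_trySPLock (e : UAEntity M) (tx : M.UTx) :
    (e.trySPLock tx).spLocked =
      if e.spLocked tx.sn = none then Function.update e.spLocked tx.sn (some tx) else e.spLocked := by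
  unfold UAEntity.trySPLock; split_ifs <;> rfl

theorem UAEntity.taProposed_trySPLock (e : UAEntity M) (tx : M.UTx) :
    (e.trySPLock tx).taProposed = e.taProposed := by
  unfold UAEntity.trySPLock; split_ifs <;> rfl

theorem UAEntity.spLocked_proposeTA (e : UAEntity M) (sn : ℕ) (v : Option M.UTx) :
    (e.proposeTA sn v).spLocked = e.spLocked := by
  unfold UAEntity.proposeTA; split_ifs <;> rfl

theorem UAEntity.spLocked_trySPLock_ne_none (e : UAEntity M) (tx : M.UTx) :
    (e.trySPLock tx).spLocked tx.sn ≠ none := by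
  rw [UAEntity.spLocked_trySPLock]; split_ifs with h <;> simp [h]

theorem UAEntity.spLocked_trySPLock_cases (e : UAEntity M) (tx : M.UTx) (sn : ℕ) :
    (e.trySPLock tx).spLocked sn = e.spLocked sn ∨
      tx.sn = sn ∧ (e.trySPLock tx).spLocked sn = some tx := by
  rw [UAEntity.spLocked_trySPLock]
  split_ifs with h
  · by_cases hsn : sn = tx.sn
    · subst hsn; exact .inr ⟨rfl, by simp⟩
    · exact .inl (by simp [hsn])
  · exact .inl rfl

set_option linter.unusedSimpArgs false
set_option linter.unnecessarySeqFocus false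

namespace Step

variable {l : Label M} {s s' : State M}

/-- Like the other `_cases` lemmas, this isolates the few transitions that write one field, together
with what their guards guarantee at that moment. The invariants below are inductions over these case
distinctions. -/
theorem fpLocked_cases (h : Step l s s') (V : M.Val) (A : M.UA) (sn : ℕ) :
    (s'.ua V A).fpLocked sn = (s.ua V A).fpLocked sn ∨
    ∃ tx : M.UTx, M.Honest V ∧ tx.sender = A ∧ tx.sn = sn ∧ tx ∈ s.issued ∧
      (s'.ua V A).fpLocked sn = some tx := by
  cases h with
  | recvTx _ V' tx e hV hi _ he =>
    subst he
    by_cases hva : V = V' ∧ A = tx.sender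
    · obtain ⟨rfl, rfl⟩ := hva
      simp only [State.setUA_self, UAEntity.tryFPLock]
      split_ifs with h0
      · by_cases hsn : sn = tx.sn
        · subst hsn; exact .inr ⟨tx, hV, rfl, rfl, hi, by simp⟩
        · exact .inl (by simp [hsn])
      · exact .inl rfl
    · exact .inl (by simp [State.setUA_ua, hva])
  | fpLock _ V' X k tx B hV _ _ hi h0 =>
    by_cases hva : V = V' ∧ A = tx.sender
    · obtain ⟨rfl, rfl⟩ := hva
      simp only [State.setUA_self, UAEntity.tryFPLock, if_pos h0]
      by_cases hsn : sn = tx.sn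
      · subst hsn; exact .inr ⟨tx, hV, rfl, rfl, hi, by simp⟩
      · exact .inl (by simp [hsn])
    · exact .inl (by simp [State.setUA_ua, hva])
  -- The remaining transitions write to other fields or other entities, so each branch of the update
  -- leaves the field as it was.
  | _ =>
    subst_vars
    left
    first
    | rfl
    | (simp only [State.setUA, State.setRA, State.grant, State.toPools, State.report, State.execBlock,
        UAEntity.tryFPLock, UAEntity.trySPLock, UAEntity.proposeTA, UAEntity.pobDecide, UAEntity.execute]
       split_ifs <;> first | rfl | (casesm* _ ∧ _; subst_vars; rfl))

/-- An SP-lock is only attempted on evidence: enough votes, membership in one of the two candidate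
blocks, or membership in a block decided by Quorum Consensus. -/
theorem spLocked_cases (h : Step l s s') (V : M.Val) (A : M.UA) (sn : ℕ) :
    (s'.ua V A).spLocked sn = (s.ua V A).spLocked sn ∨
    ∃ tx : M.UTx, M.Honest V ∧ tx.sender = A ∧ tx.sn = sn ∧ (s'.ua V A).spLocked sn = some tx ∧
      ((M.n - M.p - 2 * M.f ≤ M.count fun W => tx ∈ (s.ua V A).votesFrom W) ∨
        ∃ X k B, Tx.user tx ∈ B ∧ ((s.ra V X).cand k = some B ∨ (s.ra V X).candFb k = some B ∨
          (s.ra V X).qcDecided k = some B)) := by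
  cases h with
  | pobPropose _ V' tx e hV he _ hc _ =>
    subst he
    by_cases hva : V = V' ∧ A = tx.sender
    · obtain ⟨rfl, rfl⟩ := hva
      rw [State.setUA_self, UAEntity.spLocked_proposeTA]
      exact (UAEntity.spLocked_trySPLock_cases _ tx sn).imp_right
        fun h => ⟨tx, hV, rfl, h.1, h.2, .inl hc⟩
    · exact .inl (by simp [State.setUA_ua, hva])
  | spLock _ V' X k tx B e d hV he hB htx _ hd =>
    subst he hd
    by_cases hva : V = V' ∧ A = tx.sender
    · obtain ⟨rfl, rfl⟩ := hva
      rw [State.setRA_ua, State.setUA_self]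
      exact (UAEntity.spLocked_trySPLock_cases _ tx sn).imp_right
        fun h => ⟨tx, hV, rfl, h.1, h.2, .inr ⟨X, k, B, htx, .inl hB⟩⟩
    · exact .inl (by simp [State.setUA_ua, hva])
  | spLockFb _ V' X k tx B e d hV he hB htx _ hd =>
    subst he hd
    by_cases hva : V = V' ∧ A = tx.sender
    · obtain ⟨rfl, rfl⟩ := hva
      rw [State.setRA_ua, State.setUA_self]
      exact (UAEntity.spLocked_trySPLock_cases _ tx sn).imp_right
        fun h => ⟨tx, hV, rfl, h.1, h.2, .inr ⟨X, k, B, htx, .inr (.inl hB)⟩⟩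
    · exact .inl (by simp [State.setUA_ua, hva])
  | uaInitiate _ V' X k tx B d hV hB htx _ hd =>
    subst hd
    by_cases hva : V = V' ∧ A = tx.sender
    · obtain ⟨rfl, rfl⟩ := hva
      rw [State.setUA_self, UAEntity.spLocked_proposeTA]
      exact (UAEntity.spLocked_trySPLock_cases _ tx sn).imp_right
        fun h => ⟨tx, hV, rfl, h.1, h.2, .inr ⟨X, k, B, htx, .inr (.inr hB)⟩⟩
    · exact .inl (by simp [State.setUA_ua, hva])
  | _ =>
    subst_vars
    left
    first
    | rfl
    | (simp only [State.setUA, State.setRA, State.grant, State.toPools, State.report, State.execBlock,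
        UAEntity.tryFPLock, UAEntity.trySPLock, UAEntity.proposeTA, UAEntity.pobDecide, UAEntity.execute]
       split_ifs <;> first | rfl | (casesm* _ ∧ _; subst_vars; rfl))

theorem taProposed_cases (h : Step l s s') (V : M.Val) (A : M.UA) (sn : ℕ) :
    (s'.ua V A).taProposed sn = (s.ua V A).taProposed sn ∨
    (s'.ua V A).spLocked sn ≠ none ∧ (s'.ua V A).taProposed sn = (s'.ua V A).spLocked sn := by
  cases h with
  | pobPropose _ V' tx e hV he h0 hc hsp =>
    subst he
    by_cases hva : V = V' ∧ A = tx.sender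
    · obtain ⟨rfl, rfl⟩ := hva
      rw [State.setUA_self, UAEntity.spLocked_proposeTA]
      by_cases hsn : sn = tx.sn
      · subst hsn
        refine .inr ⟨UAEntity.spLocked_trySPLock_ne_none _ _, ?_⟩
        rw [UAEntity.proposeTA, if_pos (by rw [UAEntity.taProposed_trySPLock]; exact h0),
          UAEntity.spLocked_trySPLock]
        -- The guard `hsp` excludes an SP-lock on a conflicting transaction, so the proposed
        -- transaction is the locked one.
        rcases hsp with hsp | hsp <;> simp [hsp]
      · left
        rw [UAEntity.proposeTA, if_pos (by rw [UAEntity.taProposed_trySPLock]; exact h0)]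
        simp [hsn, UAEntity.taProposed_trySPLock]
    · exact .inl (by simp [State.setUA_ua, hva])
  | uaInitiate _ V' X k tx B d hV hB htx h0 hd =>
    subst hd
    by_cases hva : V = V' ∧ A = tx.sender
    · obtain ⟨rfl, rfl⟩ := hva
      rw [State.setUA_self, UAEntity.spLocked_proposeTA]
      by_cases hsn : sn = tx.sn
      · subst hsn
        refine .inr ⟨UAEntity.spLocked_trySPLock_ne_none _ _, ?_⟩
        rw [UAEntity.proposeTA, if_pos (by rw [UAEntity.taProposed_trySPLock]; exact h0)]
        simp
      · left
        rw [UAEntity.proposeTA, if_pos (by rw [UAEntity.taProposed_trySPLock]; exact h0)]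
        simp [hsn, UAEntity.taProposed_trySPLock]
    · exact .inl (by simp [State.setUA_ua, hva])
  | _ =>
    subst_vars
    left
    first
    | rfl
    | (simp only [State.setUA, State.setRA, State.grant, State.toPools, State.report, State.execBlock,
        UAEntity.tryFPLock, UAEntity.trySPLock, UAEntity.proposeTA, UAEntity.pobDecide, UAEntity.execute]
       split_ifs <;> first | rfl | (casesm* _ ∧ _; subst_vars; rfl))

theorem received_cases (h : Step l s s') {V : M.Val} {A : M.UA} {t : M.UTx} :
    t ∈ (s'.ua V A).received → t ∈ (s.ua V A).received ∨
    t.sender = A ∧ t ∈ s.issued ∧ (s'.ua V A).fpLocked t.sn ≠ none ∧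
      (t.recipient = none → (s'.ua V A).fpLocked t.sn = some t → t ∈ (s'.ua V A).voted) := by
  cases h with
  | recvTx _ V' tx e hV hi _ he =>
    subst he
    by_cases hva : V = V' ∧ A = tx.sender
    · obtain ⟨rfl, rfl⟩ := hva
      simp only [State.setUA_self, UAEntity.tryFPLock]
      rintro (rfl | ht)
      · refine .inr ⟨rfl, hi, ?_, fun h1 h2 => .inr ⟨rfl, h1, h2⟩⟩
        split_ifs with h0 <;> simp [h0]
      · left; split_ifs at ht <;> exact ht
    · exact fun ht => .inl (by simpa [State.setUA_ua, hva] using ht)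
  | _ =>
    subst_vars
    refine fun h => Or.inl ?_
    revert h
    first
    | exact id
    | (simp only [State.setUA, State.setRA, State.grant, State.toPools, State.report, State.execBlock,
        UAEntity.tryFPLock, UAEntity.trySPLock, UAEntity.proposeTA, UAEntity.pobDecide, UAEntity.execute]
       split_ifs <;> first | exact id | (casesm* _ ∧ _; subst_vars; exact id))

theorem voted_cases (h : Step l s s') {V : M.Val} {A : M.UA} {t : M.UTx} :
    t ∈ (s'.ua V A).voted → t ∈ (s.ua V A).voted ∨
    t.sender = A ∧ t ∈ s.issued ∧ t.recipient = none ∧ (s'.ua V A).fpLocked t.sn = some t := by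
  cases h with
  | recvTx _ V' tx e hV hi _ he =>
    subst he
    by_cases hva : V = V' ∧ A = tx.sender
    · obtain ⟨rfl, rfl⟩ := hva
      simp only [State.setUA_self, UAEntity.tryFPLock]
      rintro (ht | ⟨rfl, h1, h2⟩)
      · left; split_ifs at ht <;> exact ht
      · exact .inr ⟨rfl, hi, h1, h2⟩
    · exact fun ht => .inl (by simpa [State.setUA_ua, hva] using ht)
  | _ =>
    subst_vars
    refine fun h => Or.inl ?_
    revert h
    first
    | exact id
    | (simp only [State.setUA, State.setRA, State.grant, State.toPools, State.report, State.execBlock,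
        UAEntity.tryFPLock, UAEntity.trySPLock, UAEntity.proposeTA, UAEntity.pobDecide, UAEntity.execute]
       split_ifs <;> first | exact id | (casesm* _ ∧ _; subst_vars; exact id))

theorem votesFromUA_cases (h : Step l s s') {V W : M.Val} {A : M.UA} {t : M.UTx} :
    t ∈ (s'.ua V A).votesFrom W → t ∈ (s.ua V A).votesFrom W ∨
    t.sender = A ∧ (M.Honest W → t ∈ (s.ua W A).voted) := by
  cases h with
  | pobRecvVote _ V' W' tx e hV he _ hW =>
    subst he
    by_cases hva : V = V' ∧ A = tx.sender
    · obtain ⟨rfl, rfl⟩ := hva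
      simp only [State.setUA_self]
      by_cases hWW : W = W'
      · subst hWW
        simp only [Function.update_self]
        rintro (rfl | ht)
        · exact .inr ⟨rfl, hW⟩
        · exact .inl ht
      · simp only [Function.update_of_ne hWW]
        exact fun ht => .inl ht
    · exact fun ht => .inl (by simpa [State.setUA_ua, hva] using ht)
  | _ =>
    subst_vars
    refine fun h => Or.inl ?_
    revert h
    first
    | exact id
    | (simp only [State.setUA, State.setRA, State.grant, State.toPools, State.report, State.execBlock,
        UAEntity.tryFPLock, UAEntity.trySPLock, UAEntity.proposeTA, UAEntity.pobDecide, UAEntity.execute]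
       split_ifs <;> first | exact id | (casesm* _ ∧ _; subst_vars; exact id))

theorem proofs_cases (h : Step l s s') {V : M.Val} {A : M.UA} {t : M.UTx} :
    t ∈ (s'.ua V A).proofs → t ∈ (s.ua V A).proofs ∨
    t.sender = A ∧ ((M.n - M.p ≤ M.count fun W => t ∈ (s.ua V A).votesFrom W) ∨ s.PobProof t) := by
  cases h with
  | pobFast _ V' tx e hV he _ hc =>
    subst he
    by_cases hva : V = V' ∧ A = tx.sender
    · obtain ⟨rfl, rfl⟩ := hva
      simp only [State.setUA_self, UAEntity.pobDecide]
      split_ifs <;>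
      · rintro (rfl | ht)
        · exact .inr ⟨rfl, .inl hc⟩
        · exact .inl ht
    · exact fun ht => .inl (by simpa [State.setUA_ua, hva] using ht)
  | pobRecvProof _ V' W tx e hV he _ hc =>
    subst he
    by_cases hva : V = V' ∧ A = tx.sender
    · obtain ⟨rfl, rfl⟩ := hva
      simp only [State.setUA_self, UAEntity.pobDecide]
      split_ifs <;>
      · rintro (rfl | ht)
        · exact .inr ⟨rfl, .inr hc⟩
        · exact .inl ht
    · exact fun ht => .inl (by simpa [State.setUA_ua, hva] using ht)
  | _ =>
    subst_vars
    refine fun h => Or.inl ?_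
    revert h
    first
    | exact id
    | (simp only [State.setUA, State.setRA, State.grant, State.toPools, State.report, State.execBlock,
        UAEntity.tryFPLock, UAEntity.trySPLock, UAEntity.proposeTA, UAEntity.pobDecide, UAEntity.execute]
       split_ifs <;> first | exact id | (casesm* _ ∧ _; subst_vars; exact id))

theorem forwarded_cases (h : Step l s s') {V : M.Val} {A : M.UA} {t : M.UTx} :
    t ∈ (s'.ua V A).forwarded → t ∈ (s.ua V A).forwarded ∨
    t.sender = A ∧ ∀ X, t.recipient = some X →
      Tx.user t ∈ (s'.ra V X).pool ∨ Tx.user t ∈ (s'.ra V X).log := by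
  cases h with
  | forward _ V' tx X e hV he hX =>
    subst he
    by_cases hva : V = V' ∧ A = tx.sender
    · obtain ⟨rfl, rfl⟩ := hva
      simp only [State.toPools_ua, State.setUA_self]
      rintro (rfl | ht)
      · refine .inr ⟨rfl, fun Y hY => ?_⟩
        simp only [State.toPools, State.setUA_ra, if_true]
        by_cases hl : Tx.user t ∈ (s.ra V Y).log
        · exact .inr hl
        · left
          simp [Tx.recipient, hY, hl]
      · exact .inl ht
    · exact fun ht => .inl (by simpa [State.setUA_ua, hva] using ht)
  | _ =>
    subst_vars
    refine fun h => Or.inl ?_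
    revert h
    first
    | exact id
    | (simp only [State.setUA, State.setRA, State.grant, State.toPools, State.report, State.execBlock,
        UAEntity.tryFPLock, UAEntity.trySPLock, UAEntity.proposeTA, UAEntity.pobDecide, UAEntity.execute]
       split_ifs <;> first | exact id | (casesm* _ ∧ _; subst_vars; exact id))

/-- The ways in which decisions, pending transactions and the log of `V.A` change. -/
theorem pob_cases (h : Step l s s') (V : M.Val) (A : M.UA) :
    ((s'.ua V A).pobDecided = (s.ua V A).pobDecided ∧ (s'.ua V A).pending = (s.ua V A).pending ∧
      (s'.ua V A).log = (s.ua V A).log) ∨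
    (∃ tx : M.UTx, tx.sender = A ∧ (s'.ua V A).pobDecided =
        Function.update (s.ua V A).pobDecided tx.sn (some tx) ∧ (s.ua V A).pobDecided tx.sn = none ∧
      (s'.ua V A).pending = (s.ua V A).pending ∪ {t | t = tx ∧ tx ∈ s.issued} ∧
      (s'.ua V A).log = (s.ua V A).log ∧
      ((tx ∈ (s'.ua V A).proofs ∧ ((M.n - M.p ≤ M.count fun W => tx ∈ (s.ua V A).votesFrom W) ∨
          s.PobProof tx)) ∨
        (s.ua V A).taDecided tx.sn = some (some tx))) ∨
    (∃ tx : M.UTx, M.Honest V ∧ tx.sender = A ∧ (s'.ua V A).pobDecided = (s.ua V A).pobDecided ∧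
      (s.ua V A).Ready tx ∧ (s'.ua V A).log = (s.ua V A).log ++ [tx] ∧
      ((tx.recipient = none ∧ tx ∈ (s.ua V A).pending ∧
        (s'.ua V A).pending = (s.ua V A).pending \ {tx} ∧ l = .execUA V tx) ∨
       ((s'.ua V A).pending = (s.ua V A).pending ∧ ∃ c, (tx, c) ∈ (s.ua V A).inbox ∧
        (s'.ua V A).inbox = (s.ua V A).inbox \ {(tx, c)} ∧ l = .execUARA V tx c))) := by
  cases h with
  | pobFast _ V' tx e hV he h0 hc =>
    subst he
    by_cases hva : V = V' ∧ A = tx.sender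
    · obtain ⟨rfl, rfl⟩ := hva
      simp only [State.setUA_self, UAEntity.pobDecide, if_pos h0]
      exact .inr (.inl ⟨tx, rfl, by trivial, h0, by trivial, by trivial, .inl ⟨.inl rfl, .inl hc⟩⟩)
    · exact .inl (by simp [State.setUA_ua, hva])
  | pobRecvProof _ V' W tx e hV he _ hc =>
    subst he
    by_cases hva : V = V' ∧ A = tx.sender
    · obtain ⟨rfl, rfl⟩ := hva
      simp only [State.setUA_self, UAEntity.pobDecide]
      split_ifs with h0
      · exact .inr (.inl ⟨tx, rfl, by trivial, h0, by trivial, by trivial, .inl ⟨.inl rfl, .inr hc⟩⟩)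
      · exact .inl ⟨rfl, rfl, rfl⟩
    · exact .inl (by simp [State.setUA_ua, hva])
  | pobSlow _ V' tx e hV he h0 hc =>
    subst he
    by_cases hva : V = V' ∧ A = tx.sender
    · obtain ⟨rfl, rfl⟩ := hva
      simp only [State.setUA_self, UAEntity.pobDecide, if_pos h0]
      exact .inr (.inl ⟨tx, rfl, by trivial, h0, by trivial, by trivial, .inr hc⟩)
    · exact .inl (by simp [State.setUA_ua, hva])
  | execUA _ V' tx e hV he hp hr hR =>
    subst he
    by_cases hva : V = V' ∧ A = tx.sender
    · obtain ⟨rfl, rfl⟩ := hva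
      simp only [State.grant, State.setUA_self, UAEntity.execute, if_true]
      exact .inr (.inr ⟨tx, hV, rfl, by trivial, hR, by trivial, .inl ⟨hr, hp, by trivial, rfl⟩⟩)
    · left
      simp only [State.grant, State.setUA_ua, hva, if_false]
      split_ifs <;> exact ⟨rfl, rfl, rfl⟩
  | execUARA _ V' tx c e hV he hp hR =>
    subst he
    by_cases hva : V = V' ∧ A = tx.sender
    · obtain ⟨rfl, rfl⟩ := hva
      simp only [State.grant, State.setUA_self, UAEntity.execute, if_true]
      exact .inr (.inr ⟨tx, hV, rfl, by trivial, hR, by trivial, .inr ⟨by trivial, c, hp, by trivial, rfl⟩⟩)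
    · left
      simp only [State.grant, State.setUA_ua, hva, if_false]
      split_ifs <;> exact ⟨rfl, rfl, rfl⟩
  | _ =>
    subst_vars
    left
    first
    | (refine ⟨?_, ?_, ?_⟩ <;> rfl)
    | (simp only [State.setUA, State.setRA, State.grant, State.toPools, State.report, State.execBlock,
        UAEntity.tryFPLock, UAEntity.trySPLock, UAEntity.proposeTA, UAEntity.pobDecide, UAEntity.execute]
       split_ifs <;> first | (refine ⟨?_, ?_, ?_⟩ <;> rfl) | (casesm* _ ∧ _; subst_vars; (refine ⟨?_, ?_, ?_⟩ <;> rfl)))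

theorem inbox_cases (h : Step l s s') {V : M.Val} {A : M.UA} {m : M.UTx × Set (M.UA × M.Obj)} :
    m ∈ (s'.ua V A).inbox → m ∈ (s.ua V A).inbox ∨
    m.1.sender = A ∧ ∃ X B, l = .execBlock V X ∧ (s.ra V X).decided (s.ra V X).inst = some B ∧
      (Tx.user m.1, m.2) ∈ ((s.ra V X).runBlock X B).out := by
  cases h with
  | execBlock _ V' X B hV hB =>
    intro hm
    simp only [State.execBlock, State.grant, State.report, State.toPools_ua, State.setRA_ua] at hm
    split_ifs at hm with hv
    · subst hv
      rcases hm with hm | ⟨h1, -, h2⟩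
      · exact .inl hm
      · exact .inr ⟨h1, X, B, rfl, hB, h2⟩
    · exact .inl hm
  | execUA _ V' tx e hV he hp hr hR =>
    subst he
    intro hm
    by_cases hva : V = V' ∧ A = tx.sender
    · obtain ⟨rfl, rfl⟩ := hva
      simp only [State.grant, State.setUA_self, UAEntity.execute, if_true] at hm
      exact .inl hm
    · left
      simp only [State.grant, State.setUA_ua, hva, if_false] at hm
      split_ifs at hm <;> exact hm
  | execUARA _ V' tx c e hV he hp hR =>
    subst he
    intro hm
    by_cases hva : V = V' ∧ A = tx.sender
    · obtain ⟨rfl, rfl⟩ := hva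
      simp only [State.grant, State.setUA_self, UAEntity.execute, if_true] at hm
      exact .inl hm.1
    · left
      simp only [State.grant, State.setUA_ua, hva, if_false] at hm
      split_ifs at hm <;> exact hm
  | _ =>
    subst_vars
    refine fun h => Or.inl ?_
    revert h
    first
    | exact id
    | (simp only [State.setUA, State.setRA, State.grant, State.toPools, State.report, State.execBlock,
        UAEntity.tryFPLock, UAEntity.trySPLock, UAEntity.proposeTA, UAEntity.pobDecide, UAEntity.execute]
       split_ifs <;> first | exact id | (casesm* _ ∧ _; subst_vars; exact id))

end Step

theorem Batch.log_run_mem (X : M.RA) (b : Batch M) (tx : M.Trans) : tx ∈ (b.run X tx).log := by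
  unfold Batch.run
  split_ifs with h
  · exact h
  · simp

theorem Batch.mem_log_foldl (X : M.RA) (l : List M.Trans) (b : Batch M) {t : M.Trans} (ht : t ∈ l) :
    t ∈ (l.foldl (Batch.run X) b).log := by
  induction l generalizing b with
  | nil => simp at ht
  | cons a l ih =>
    rcases List.mem_cons.1 ht with rfl | ht
    · exact Batch.log_subset_foldl X l _ (b.log_run_mem X t)
    · exact ih _ ht

set_option linter.unusedSimpArgs false
set_option linter.unnecessarySeqFocus false

/-! ### Changes of the fields of `V.X`. -/

namespace Step

variable {l : Label M} {s s' : State M}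

theorem inst_cases (h : Step l s s') (V : M.Val) (X : M.RA) :
    ((s'.ra V X).inst = (s.ra V X).inst ∧ (s'.ra V X).st = (s.ra V X).st ∧
      (s'.ra V X).log = (s.ra V X).log) ∨
    ∃ B, M.Honest V ∧ l = .execBlock V X ∧ (s.ra V X).decided (s.ra V X).inst = some B ∧
      s' = s.execBlock V X B ∧
      (s'.ra V X).inst = (s.ra V X).inst + 1 ∧ (s'.ra V X).st = ((s.ra V X).runBlock X B).st ∧
      (s'.ra V X).log = ((s.ra V X).runBlock X B).log := by
  cases h with
  | execBlock _ V' X' B hV hB =>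
    by_cases hva : V = V' ∧ X = X'
    · obtain ⟨rfl, rfl⟩ := hva
      exact .inr ⟨B, hV, rfl, hB, rfl, by simp [State.execBlock, State.toPools]⟩
    · left
      simp only [State.execBlock, State.grant_ra, State.report_ra, State.toPools, State.setRA_ra, hva,
        if_false]
      split_ifs <;> exact ⟨rfl, rfl, rfl⟩
  | _ =>
    try subst ‹_ = s.ra _ _›
    subst_vars
    left
    first
    | (refine ⟨?_, ?_, ?_⟩ <;> rfl)
    | (simp only [State.setUA, State.setRA, State.grant, State.toPools, State.report, State.execBlock,
        RAEntity.decide]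
       split_ifs <;> first | (refine ⟨?_, ?_, ?_⟩ <;> rfl) | (casesm* _ ∧ _; subst_vars; (refine ⟨?_, ?_, ?_⟩ <;> rfl)))

/-- User transactions enter pools through `forward` alone, whose guards supply the FP-lock and
readiness; executing a block adds only reactive transactions. -/
theorem pool_cases (h : Step l s s') {V : M.Val} {X : M.RA} {t : M.Trans} :
    t ∈ (s'.ra V X).pool → t ∈ (s.ra V X).pool ∨
    t.recipient = some X ∧ ∀ tx : M.UTx, t = .user tx → M.Honest V ∧
      tx ∈ (s.ua V tx.sender).received ∧ (s.ua V tx.sender).fpLocked tx.sn = some tx ∧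
      (s.ua V tx.sender).Ready tx := by
  cases h with
  | forward _ V' tx X' e hV he hX hr _ hfp hR =>
    subst he
    simp only [State.toPools, State.setUA_ra]
    split_ifs with hv
    · subst hv
      intro ht
      rcases Finset.mem_union.1 ht with ht | ht
      · exact .inl ht
      · rw [List.mem_toFinset, List.mem_filter, List.mem_singleton] at ht
        obtain ⟨rfl, hd⟩ := ht
        obtain ⟨h1, -⟩ := of_decide_eq_true hd
        refine .inr ⟨h1, fun tx' h => ?_⟩
        cases h
        exact ⟨hV, hr, hfp, hR⟩
    · exact .inl
  | execBlock _ V' X' B hV hB =>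
    simp only [State.execBlock, State.grant_ra, State.report_ra, State.toPools, State.setRA_ra]
    split_ifs with hv hva
    · obtain ⟨rfl, rfl⟩ := hva
      intro ht
      rcases Finset.mem_union.1 ht with ht | ht
      · exact .inl (Finset.mem_sdiff.1 ht).1
      · rw [List.mem_toFinset, List.mem_filter, List.mem_map] at ht
        obtain ⟨⟨r, -, rfl⟩, hd⟩ := ht
        obtain ⟨h1, -⟩ := of_decide_eq_true hd
        exact .inr ⟨h1, fun tx' h => by cases h⟩
    · intro ht
      rcases Finset.mem_union.1 ht with ht | ht
      · exact .inl ht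
      · rw [List.mem_toFinset, List.mem_filter, List.mem_map] at ht
        obtain ⟨⟨r, -, rfl⟩, hd⟩ := ht
        obtain ⟨h1, -⟩ := of_decide_eq_true hd
        exact .inr ⟨h1, fun tx' h => by cases h⟩
    · rename_i hva; exact absurd hva.1 hv
    · exact .inl
  | _ =>
    try subst ‹_ = s.ra _ _›
    subst_vars
    refine fun h => Or.inl ?_
    revert h
    first
    | exact id
    | (simp only [State.setUA, State.setRA, State.grant, State.toPools, State.report, State.execBlock,
        RAEntity.decide]
       split_ifs <;> first | exact id | (casesm* _ ∧ _; subst_vars; exact id))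

/-- Only `execBlock` removes from a pool, and what it removes belongs to the block, all of which is
in the log afterwards. -/
theorem pool_subset (h : Step l s s') {V : M.Val} {X : M.RA} {t : M.Trans}
    (ht : t ∈ (s.ra V X).pool) : t ∈ (s'.ra V X).pool ∨ t ∈ (s'.ra V X).log := by
  revert ht
  cases h with
  | forward _ V' tx X' e hV he hX hr _ hfp hR =>
    simp only [State.toPools, State.setUA_ra]
    split_ifs with hv
    · exact fun ht => .inl (Finset.mem_union_left _ ht)
    · exact .inl
  | execBlock _ V' X' B hV hB =>
    simp only [State.execBlock, State.grant_ra, State.report_ra, State.toPools, State.setRA_ra]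
    split_ifs with hv hva
    · obtain ⟨rfl, rfl⟩ := hva
      intro ht
      by_cases htB : t ∈ B
      · exact .inr (Batch.mem_log_foldl _ _ _ (Finset.mem_toList.2 htB))
      · exact .inl (Finset.mem_union_left _ (Finset.mem_sdiff.2 ⟨ht, htB⟩))
    · exact fun ht => .inl (Finset.mem_union_left _ ht)
    · rename_i hva; exact absurd hva.1 hv
    · exact .inl
  | _ =>
    try subst ‹_ = s.ra _ _›
    subst_vars
    refine fun h => Or.inl ?_
    revert h
    first
    | exact id
    | (simp only [State.setUA, State.setRA, State.grant, State.toPools, State.report, State.execBlock,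
        RAEntity.decide]
       split_ifs <;> first | exact id | (casesm* _ ∧ _; subst_vars; exact id))

theorem proposal_cases (h : Step l s s') (V : M.Val) (X : M.RA) (k : ℕ) :
    (s'.ra V X).proposal k = (s.ra V X).proposal k ∨
    (s.ra V X).inst = k ∧ (s'.ra V X).proposal k = some (s.ra V X).pool := by
  cases h with
  | propose _ V' X' k' e hV he _ hk _ =>
    subst he
    by_cases hva : V = V' ∧ X = X'
    · obtain ⟨rfl, rfl⟩ := hva
      simp only [State.setRA_self]
      by_cases hkk : k = k'
      · subst hkk; exact .inr ⟨hk, by simp⟩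
      · exact .inl (by simp [hkk])
    · exact .inl (by simp [State.setRA_ra, hva])
  | _ =>
    try subst ‹_ = s.ra _ _›
    subst_vars
    left
    first
    | rfl
    | (simp only [State.setUA, State.setRA, State.grant, State.toPools, State.report, State.execBlock,
        RAEntity.decide]
       split_ifs <;> first | rfl | (casesm* _ ∧ _; subst_vars; rfl))

theorem block_cases (h : Step l s s') (V : M.Val) (X : M.RA) (k : ℕ) :
    (s'.ra V X).block k = (s.ra V X).block k ∨
    ∃ B, (s'.ra V X).block k = some B ∧ (∀ t ∈ B, t.recipient = some X) ∧
      (M.Honest (M.leader k) → (s.ra (M.leader k) X).proposal k = some B) := by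
  cases h with
  | recvBlock _ V' X' k' B e hV he _ hp hr =>
    subst he
    by_cases hva : V = V' ∧ X = X'
    · obtain ⟨rfl, rfl⟩ := hva
      simp only [State.setRA_self]
      by_cases hkk : k = k'
      · subst hkk; exact .inr ⟨B, by simp, hr, hp⟩
      · exact .inl (by simp [hkk])
    · exact .inl (by simp [State.setRA_ra, hva])
  | _ =>
    try subst ‹_ = s.ra _ _›
    subst_vars
    left
    first
    | rfl
    | (simp only [State.setUA, State.setRA, State.grant, State.toPools, State.report, State.execBlock,
        RAEntity.decide]
       split_ifs <;> first | rfl | (casesm* _ ∧ _; subst_vars; rfl))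

theorem fpOk_cases (h : Step l s s') {V : M.Val} {X : M.RA} {k : ℕ} {t : M.UTx} :
    t ∈ (s'.ra V X).fpOk k → t ∈ (s.ra V X).fpOk k ∨
    M.Honest V ∧ t ∈ s.issued ∧ (s.ua V t.sender).fpLocked t.sn = some t ∧
      (s.ua V t.sender).Ready t := by
  cases h with
  | fpAck _ V' X' k' tx B e hV he _ _ hi _ hfp hR =>
    subst he
    by_cases hva : V = V' ∧ X = X'
    · obtain ⟨rfl, rfl⟩ := hva
      simp only [State.setRA_self]
      by_cases hkk : k = k'
      · subst hkk
        simp only [Function.update_self]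
        rintro (rfl | ht)
        · exact .inr ⟨hV, hi, hfp, hR⟩
        · exact .inl ht
      · exact fun ht => .inl (by simpa [hkk] using ht)
    · exact fun ht => .inl (by simpa [State.setRA_ra, hva] using ht)
  | _ =>
    try subst ‹_ = s.ra _ _›
    subst_vars
    refine fun h => Or.inl ?_
    revert h
    first
    | exact id
    | (simp only [State.setUA, State.setRA, State.grant, State.toPools, State.report, State.execBlock,
        RAEntity.decide]
       split_ifs <;> first | exact id | (casesm* _ ∧ _; subst_vars; exact id))

theorem vote_cases (h : Step l s s') (V : M.Val) (X : M.RA) (k : ℕ) :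
    (s'.ra V X).vote k = (s.ra V X).vote k ∨
    M.Honest V ∧ (s.ra V X).inst = k ∧ ∃ v, (s'.ra V X).vote k = some (v, (s.ra V X).pool) ∧
      ∀ B, v = some B → (s.ra V X).block k = some B ∧
        ∀ tx : M.UTx, Tx.user tx ∈ B → tx ∈ (s.ra V X).fpOk k := by
  cases h with
  | voteBlock _ V' X' k' B e hV he hc h0 hok =>
    subst he
    by_cases hva : V = V' ∧ X = X'
    · obtain ⟨rfl, rfl⟩ := hva
      simp only [State.setRA_self]
      by_cases hkk : k = k'
      · subst hkk
        refine .inr ⟨hV, hc.1, some B, by simp, fun B' hB' => ?_⟩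
        cases hB'
        exact ⟨hc.2.1, hok⟩
      · exact .inl (by simp [hkk])
    · exact .inl (by simp [State.setRA_ra, hva])
  | voteBot _ V' X' k' e hV he hk h0 =>
    subst he
    by_cases hva : V = V' ∧ X = X'
    · obtain ⟨rfl, rfl⟩ := hva
      simp only [State.setRA_self]
      by_cases hkk : k = k'
      · subst hkk
        exact .inr ⟨hV, hk, none, by simp, fun B' hB' => by simp at hB'⟩
      · exact .inl (by simp [hkk])
    · exact .inl (by simp [State.setRA_ra, hva])
  | _ =>
    try subst ‹_ = s.ra _ _›
    subst_vars
    left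
    first
    | rfl
    | (simp only [State.setUA, State.setRA, State.grant, State.toPools, State.report, State.execBlock,
        RAEntity.decide]
       split_ifs <;> first | rfl | (casesm* _ ∧ _; subst_vars; rfl))

theorem votesFrom_cases (h : Step l s s') (V W : M.Val) (X : M.RA) (k : ℕ) :
    (s'.ra V X).votesFrom k W = (s.ra V X).votesFrom k W ∨
    ∃ v, (s'.ra V X).votesFrom k W = some v ∧ (M.Honest W → (s.ra W X).vote k = some v) := by
  cases h with
  | recvVote _ V' W' X' k' v e hV he h0 hv =>
    subst he
    by_cases hva : V = V' ∧ X = X'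
    · obtain ⟨rfl, rfl⟩ := hva
      simp only [State.setRA_self]
      by_cases hkk : k = k'
      · subst hkk
        by_cases hw : W = W'
        · subst hw; exact .inr ⟨v, by simp, hv⟩
        · exact .inl (by simp [hw])
      · exact .inl (by simp [hkk])
    · exact .inl (by simp [State.setRA_ra, hva])
  | _ =>
    try subst ‹_ = s.ra _ _›
    subst_vars
    left
    first
    | rfl
    | (simp only [State.setUA, State.setRA, State.grant, State.toPools, State.report, State.execBlock,
        RAEntity.decide]
       split_ifs <;> first | rfl | (casesm* _ ∧ _; subst_vars; rfl))

theorem proof_cases (h : Step l s s') (V : M.Val) (X : M.RA) (k : ℕ) :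
    (s'.ra V X).proof k = (s.ra V X).proof k ∨
    ∃ B, (s'.ra V X).proof k = some B ∧
      (M.n - M.p ≤ (s.ra V X).votesFor k B ∨ s.PoaProof X k B) := by
  cases h with
  | fastDecide _ V' X' k' B e hV he h0 hc =>
    subst he
    by_cases hva : V = V' ∧ X = X'
    · obtain ⟨rfl, rfl⟩ := hva
      simp only [State.setRA_self, RAEntity.decide]
      by_cases hkk : k = k'
      · subst hkk
        right; refine ⟨B, ?_, .inl hc⟩
        split_ifs <;> simp
      · left; split_ifs <;> simp [hkk]
    · exact .inl (by simp [State.setRA_ra, hva])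
  | recvProof _ V' W X' k' B e hV he h0 hc =>
    subst he
    by_cases hva : V = V' ∧ X = X'
    · obtain ⟨rfl, rfl⟩ := hva
      simp only [State.setRA_self, RAEntity.decide]
      by_cases hkk : k = k'
      · subst hkk
        right; refine ⟨B, ?_, .inr hc⟩
        split_ifs <;> simp
      · left; split_ifs <;> simp [hkk]
    · exact .inl (by simp [State.setRA_ra, hva])
  | _ =>
    try subst ‹_ = s.ra _ _›
    subst_vars
    left
    first
    | rfl
    | (simp only [State.setUA, State.setRA, State.grant, State.toPools, State.report, State.execBlock,
        RAEntity.decide]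
       split_ifs <;> first | rfl | (casesm* _ ∧ _; subst_vars; rfl))

theorem decided_cases (h : Step l s s') (V : M.Val) (X : M.RA) (k : ℕ) :
    (s'.ra V X).decided k = (s.ra V X).decided k ∨
    ∃ B, (s'.ra V X).decided k = some B ∧ ((s'.ra V X).proof k = some B ∨
      ∃ B₀, (s.ra V X).qcDecided k = some B₀ ∧
        (∀ tx : M.UTx, Tx.user tx ∈ B₀ → (s.ua V tx.sender).taDecided tx.sn ≠ none) ∧
        B = B₀.filter fun t => ∀ tx : M.UTx, t = .user tx →
          (s.ua V tx.sender).taDecided tx.sn = some (some tx)) := by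
  cases h with
  | fastDecide _ V' X' k' B e hV he h0 hc =>
    subst he
    by_cases hva : V = V' ∧ X = X'
    · obtain ⟨rfl, rfl⟩ := hva
      simp only [State.setRA_self, RAEntity.decide]
      by_cases hkk : k = k'
      · subst hkk
        split_ifs with hd
        · right; refine ⟨B, ?_, .inl ?_⟩ <;> simp
        · exact .inl rfl
      · left; split_ifs <;> simp [hkk]
    · exact .inl (by simp [State.setRA_ra, hva])
  | recvProof _ V' W X' k' B e hV he h0 hc =>
    subst he
    by_cases hva : V = V' ∧ X = X'
    · obtain ⟨rfl, rfl⟩ := hva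
      simp only [State.setRA_self, RAEntity.decide]
      by_cases hkk : k = k'
      · subst hkk
        split_ifs with hd
        · right; refine ⟨B, ?_, .inl ?_⟩ <;> simp
        · exact .inl rfl
      · left; split_ifs <;> simp [hkk]
    · exact .inl (by simp [State.setRA_ra, hva])
  | slowDecide _ V' X' k' B e hV he hq h0 hta =>
    subst he
    by_cases hva : V = V' ∧ X = X'
    · obtain ⟨rfl, rfl⟩ := hva
      simp only [State.setRA_self, RAEntity.decide, if_pos h0]
      by_cases hkk : k = k'
      · subst hkk
        exact .inr ⟨_, Function.update_self .., .inr ⟨B, hq, hta, rfl⟩⟩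
      · left; simp [hkk]
    · exact .inl (by simp [State.setRA_ra, hva])
  | _ =>
    try subst ‹_ = s.ra _ _›
    subst_vars
    left
    first
    | rfl
    | (simp only [State.setUA, State.setRA, State.grant, State.toPools, State.report, State.execBlock,
        RAEntity.decide]
       split_ifs <;> first | rfl | (casesm* _ ∧ _; subst_vars; rfl))

theorem cand_cases (h : Step l s s') (V : M.Val) (X : M.RA) (k : ℕ) :
    (s'.ra V X).cand k = (s.ra V X).cand k ∨
    ∃ B, (s'.ra V X).cand k = some B ∧ M.n - M.f ≤ (s.ra V X).votesTotal k ∧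
      M.n - M.p - 2 * M.f ≤ (s.ra V X).votesFor k B := by
  cases h with
  | startSlow_cand _ V' X' k' B e hV he _ _ _ h1 h2 =>
    subst he
    by_cases hva : V = V' ∧ X = X'
    · obtain ⟨rfl, rfl⟩ := hva
      simp only [State.setRA_self]
      by_cases hkk : k = k'
      · subst hkk; exact .inr ⟨B, by simp, h1, h2⟩
      · exact .inl (by simp [hkk])
    · exact .inl (by simp [State.setRA_ra, hva])
  | _ =>
    try subst ‹_ = s.ra _ _›
    subst_vars
    left
    first
    | rfl
    | (simp only [State.setUA, State.setRA, State.grant, State.toPools, State.report, State.execBlock,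
        RAEntity.decide]
       split_ifs <;> first | rfl | (casesm* _ ∧ _; subst_vars; rfl))

theorem candFb_cases (h : Step l s s') (V : M.Val) (X : M.RA) (k : ℕ) :
    (s'.ra V X).candFb k = (s.ra V X).candFb k ∨
    (s'.ra V X).candFb k = some ((s.ra V X).fallback k) ∧
      (M.n - M.f ≤ (s.ra V X).votesTotal k ∧
        (∀ B, (s.ra V X).votesFor k B < M.n - M.p - 2 * M.f) ∨
       ∃ B, (s.ra V X).cand k = some B ∧
        ∃ tx : M.UTx, Tx.user tx ∈ B ∧ (s.ra V X).reply k tx = some false) := by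
  cases h with
  | startSlow_fallback _ V' X' k' e hV he _ _ _ h1 h2 =>
    subst he
    by_cases hva : V = V' ∧ X = X'
    · obtain ⟨rfl, rfl⟩ := hva
      simp only [State.setRA_self]
      by_cases hkk : k = k'
      · subst hkk; exact .inr ⟨by simp, .inl ⟨h1, h2⟩⟩
      · exact .inl (by simp [hkk])
    · exact .inl (by simp [State.setRA_ra, hva])
  | endCand_failure _ V' X' k' B e hV he hB _ _ _ h2 =>
    subst he
    by_cases hva : V = V' ∧ X = X'
    · obtain ⟨rfl, rfl⟩ := hva
      simp only [State.setRA_self]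
      by_cases hkk : k = k'
      · subst hkk; exact .inr ⟨by simp, .inr ⟨B, hB, h2⟩⟩
      · exact .inl (by simp [hkk])
    · exact .inl (by simp [State.setRA_ra, hva])
  | _ =>
    try subst ‹_ = s.ra _ _›
    subst_vars
    left
    first
    | rfl
    | (simp only [State.setUA, State.setRA, State.grant, State.toPools, State.report, State.execBlock,
        RAEntity.decide]
       split_ifs <;> first | rfl | (casesm* _ ∧ _; subst_vars; rfl))

theorem reply_cases (h : Step l s s') (V : M.Val) (X : M.RA) (k : ℕ) (t : M.UTx) :
    (s'.ra V X).reply k t = (s.ra V X).reply k t ∨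
    (s'.ua V t.sender).spLocked t.sn ≠ none ∧
    ∃ b, (s'.ra V X).reply k t = some b ∧ (b = true ↔ (s'.ua V t.sender).spLocked t.sn = some t) := by
  cases h with
  | spLock _ V' X' k' tx B e d hV he hB htx _ hd =>
    subst he hd
    by_cases hva : V = V' ∧ X = X'
    · obtain ⟨rfl, rfl⟩ := hva
      simp only [State.setRA_self, State.setRA_ua]
      by_cases hkk : k = k'
      · subst hkk
        by_cases ht : t = tx
        · subst ht
          simp only [State.setUA_self]
          exact .inr ⟨UAEntity.spLocked_trySPLock_ne_none _ _, _, by simp, decide_eq_true_iff⟩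
        · exact .inl (by simp [ht])
      · exact .inl (by simp [hkk])
    · exact .inl (by simp [State.setRA_ra, hva])
  | _ =>
    try subst ‹_ = s.ra _ _›
    subst_vars
    left
    first
    | rfl
    | (simp only [State.setUA, State.setRA, State.grant, State.toPools, State.report, State.execBlock,
        RAEntity.decide]
       split_ifs <;> first | rfl | (casesm* _ ∧ _; subst_vars; rfl))

theorem replyFb_cases (h : Step l s s') (V : M.Val) (X : M.RA) (k : ℕ) (t : M.UTx) :
    (s'.ra V X).replyFb k t = (s.ra V X).replyFb k t ∨
    (s'.ua V t.sender).spLocked t.sn ≠ none ∧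
    ∃ b, (s'.ra V X).replyFb k t = some b ∧ (b = true ↔ (s'.ua V t.sender).spLocked t.sn = some t) := by
  cases h with
  | spLockFb _ V' X' k' tx B e d hV he hB htx _ hd =>
    subst he hd
    by_cases hva : V = V' ∧ X = X'
    · obtain ⟨rfl, rfl⟩ := hva
      simp only [State.setRA_self, State.setRA_ua]
      by_cases hkk : k = k'
      · subst hkk
        by_cases ht : t = tx
        · subst ht
          simp only [State.setUA_self]
          exact .inr ⟨UAEntity.spLocked_trySPLock_ne_none _ _, _, by simp, decide_eq_true_iff⟩
        · exact .inl (by simp [ht])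
      · exact .inl (by simp [hkk])
    · exact .inl (by simp [State.setRA_ra, hva])
  | _ =>
    try subst ‹_ = s.ra _ _›
    subst_vars
    left
    first
    | rfl
    | (simp only [State.setUA, State.setRA, State.grant, State.toPools, State.report, State.execBlock,
        RAEntity.decide]
       split_ifs <;> first | rfl | (casesm* _ ∧ _; subst_vars; rfl))

theorem qcProposed_cases (h : Step l s s') (V : M.Val) (X : M.RA) (k : ℕ) :
    (s'.ra V X).qcProposed k = (s.ra V X).qcProposed k ∨
    (∃ B, (s'.ra V X).qcProposed k = some B ∧ (s.ra V X).cand k = some B ∧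
      ∀ tx : M.UTx, Tx.user tx ∈ B → (s.ra V X).reply k tx = some true) ∨
    (∃ B, (s.ra V X).candFb k = some B ∧
      (∀ tx : M.UTx, Tx.user tx ∈ B → (s.ra V X).replyFb k tx ≠ none) ∧
      (s'.ra V X).qcProposed k = some (B.filter fun t => ∀ tx : M.UTx, t = Tx.user tx →
        (s.ra V X).replyFb k tx = some true)) := by
  cases h with
  | endCand_success _ V' X' k' B e hV he hB _ _ h2 =>
    subst he
    by_cases hva : V = V' ∧ X = X'
    · obtain ⟨rfl, rfl⟩ := hva
      simp only [State.setRA_self]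
      by_cases hkk : k = k'
      · subst hkk; exact .inr (.inl ⟨B, by simp, hB, h2⟩)
      · exact .inl (by simp [hkk])
    · exact .inl (by simp [State.setRA_ra, hva])
  | endFallback _ V' X' k' B e hV he hB _ h2 =>
    subst he
    by_cases hva : V = V' ∧ X = X'
    · obtain ⟨rfl, rfl⟩ := hva
      simp only [State.setRA_self]
      by_cases hkk : k = k'
      · subst hkk; exact .inr (.inr ⟨B, hB, h2, by simp⟩)
      · exact .inl (by simp [hkk])
    · exact .inl (by simp [State.setRA_ra, hva])
  | _ =>
    try subst ‹_ = s.ra _ _›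
    subst_vars
    left
    first
    | rfl
    | (simp only [State.setUA, State.setRA, State.grant, State.toPools, State.report, State.execBlock,
        RAEntity.decide]
       split_ifs <;> first | rfl | (casesm* _ ∧ _; subst_vars; rfl))

end Step

/-! ### Quorums -/

/-- All honest members of some set of at least `q` validators have the property `P`. -/
def System.Quorum (M : System.{u}) (q : ℕ) (P : M.Val → Prop) : Prop :=
  ∃ S : Finset M.Val, q ≤ S.card ∧ ∀ W ∈ S, M.Honest W → P W

theorem System.Quorum.mono {q q' : ℕ} {P P' : M.Val → Prop} (h : M.Quorum q P) (hq : q' ≤ q)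
    (hP : ∀ W, M.Honest W → P W → P' W) : M.Quorum q' P' :=
  let ⟨S, hS, h⟩ := h
  ⟨S, hq.trans hS, fun W hW hon => hP W hon (h W hW hon)⟩

theorem System.Quorum.of_count {q : ℕ} {P P' : M.Val → Prop} (h : q ≤ M.count P')
    (hP : ∀ W, M.Honest W → P' W → P W) : M.Quorum q P :=
  ⟨Finset.univ.filter P', h, fun W hW hon => hP W hon (Finset.mem_filter.1 hW).2⟩

/-- By inclusion-exclusion the two sets share more validators than there are Byzantine ones. -/
theorem System.Quorum.inter {q q' : ℕ} {P P' : M.Val → Prop} (h : M.Quorum q P)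
    (h' : M.Quorum q' P') (hq : M.n + M.byz.card < q + q') : ∃ W, M.Honest W ∧ P W ∧ P' W := by
  obtain ⟨S, hS, h⟩ := h
  obtain ⟨S', hS', h'⟩ := h'
  have h1 := Finset.card_union_add_card_inter S S'
  have h2 : (S ∪ S').card ≤ M.n := Finset.card_le_univ _
  have h3 : M.byz.card < (S ∩ S').card := by omega
  obtain ⟨W, hW, hWb⟩ := Finset.exists_mem_notMem_of_card_lt_card h3
  obtain ⟨hW1, hW2⟩ := Finset.mem_inter.1 hW
  exact ⟨W, hWb, h W hW1 hWb, h' W hW2 hWb⟩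

theorem System.Quorum.exists {q : ℕ} {P : M.Val → Prop} (h : M.Quorum q P)
    (hq : M.byz.card < q) : ∃ W, M.Honest W ∧ P W := by
  obtain ⟨S, hS, h⟩ := h
  obtain ⟨W, hW, hWb⟩ := Finset.exists_mem_notMem_of_card_lt_card (hq.trans_le hS)
  exact ⟨W, hWb, h W hW hWb⟩

/-- Nothing is known about the Byzantine members of a quorum, so passing to an actual count may lose
all of them. -/
theorem System.Quorum.le_count {q : ℕ} {P P' : M.Val → Prop} (h : M.Quorum q P)
    (hP : ∀ W, M.Honest W → P W → P' W) : q ≤ M.count P' + M.byz.card := by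
  obtain ⟨S, hS, h⟩ := h
  have h1 : S ⊆ Finset.univ.filter P' ∪ M.byz := fun W hW => by
    by_cases hon : W ∈ M.byz
    · exact Finset.mem_union_right _ hon
    · exact Finset.mem_union_left _ (Finset.mem_filter.2 ⟨Finset.mem_univ _, hP W hon (h W hW hon)⟩)
  exact hS.trans ((Finset.card_le_card h1).trans (Finset.card_union_le _ _))

theorem System.count_mono {P P' : M.Val → Prop} (h : ∀ W, P W → P' W) : M.count P ≤ M.count P' :=
  Finset.card_le_card (Finset.monotone_filter_right _ fun W _ => h W)

theorem System.count_pos {P : M.Val → Prop} (h : 0 < M.count P) : ∃ W, P W := by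
  obtain ⟨W, hW⟩ := Finset.card_pos.1 h
  exact ⟨W, (Finset.mem_filter.1 hW).2⟩

theorem System.quorum_honest (M : System.{u}) : M.Quorum M.n M.Honest :=
  ⟨Finset.univ, le_rfl, fun _ _ h => h⟩

/-! ### Monotonicity of quorums along executions -/

/-- `V.A` has FP-locked `tx`. -/
def State.FP (s : State M) (V : M.Val) (tx : M.UTx) : Prop :=
  (s.ua V tx.sender).fpLocked tx.sn = some tx

/-- `V.A` has SP-locked `tx`. -/
def State.SP (s : State M) (V : M.Val) (tx : M.UTx) : Prop :=
  (s.ua V tx.sender).spLocked tx.sn = some tx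

/-- `V.X` has broadcast a vote for `B` in instance `k`. -/
def State.VotedFor (s : State M) (V : M.Val) (X : M.RA) (k : ℕ) (B : M.Block) : Prop :=
  ∃ fb, (s.ra V X).vote k = some (some B, fb)

/-- The vote of `V.X` in instance `k` has `t` in its fallback block. -/
def State.FallbackHas (s : State M) (V : M.Val) (X : M.RA) (k : ℕ) (t : M.Trans) : Prop :=
  ∃ v, (s.ra V X).vote k = some v ∧ t ∈ v.2

namespace State.Extends

variable {s s' : State M} (h : s.Extends s')
include h

theorem fp {V : M.Val} {tx : M.UTx} (hf : s.FP V tx) : s'.FP V tx := (h.ua _ _).fpLocked _ _ hf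

theorem sp {V : M.Val} {tx : M.UTx} (hf : s.SP V tx) : s'.SP V tx := (h.ua _ _).spLocked _ _ hf

theorem votedFor {V : M.Val} {X : M.RA} {k : ℕ} {B : M.Block} (hv : s.VotedFor V X k B) :
    s'.VotedFor V X k B := hv.imp fun _ => (h.ra _ _).vote _ _

theorem fallbackHas {V : M.Val} {X : M.RA} {k : ℕ} {t : M.Trans} (hv : s.FallbackHas V X k t) :
    s'.FallbackHas V X k t := hv.imp fun _ => And.imp_left ((h.ra _ _).vote _ _)

theorem pobProof {tx : M.UTx} (hp : s.PobProof tx) : s'.PobProof tx :=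
  hp.imp fun _ hS => ⟨hS.1, fun W hW hon => (h.ua _ _).voted (hS.2 W hW hon)⟩

theorem poaProof {X : M.RA} {k : ℕ} {B : M.Block} (hp : s.PoaProof X k B) : s'.PoaProof X k B :=
  hp.imp fun _ hS => ⟨hS.1, fun W hW hon => h.votedFor (hS.2 W hW hon)⟩

end State.Extends

/-- This transports negative information: a field that is set to something else, or that answers
negatively, stays so. -/
theorem Keeps.eq_of_ne_none {α : Type*} {a b : Option α} (h : Keeps a b) (ha : a ≠ none) : b = a := by
  cases a with
  | none => exact absurd rfl ha
  | some x => exact h x rfl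

theorem Step.issued_cases {l : Label M} {s s' : State M} (h : Step l s s') {tx : M.UTx}
    (ht : tx ∈ s'.issued) : tx ∈ s.issued ∨ l = .issue tx := by
  cases h with
  | issue _ tx' =>
    rcases ht with rfl | ht
    · exact .inr rfl
    · exact .inl ht
  | _ => exact .inl ht

/-! ### Invariants of executions that need no bound on the Byzantine validators. -/

namespace Run

variable {r : Run M}

section Invariants

variable (hr : r.IsExecution)
include hr

theorem IsExecution.issued_spec {t : ℕ} {tx : M.UTx} (h : tx ∈ (r.state t).issued) :
    ∃ t₀ < t, r.label t₀ = some (.issue tx) := by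
  induction t with
  | zero => rw [hr.init] at h; exact absurd h (Set.notMem_empty _)
  | succ t ih =>
    rcases hr.step' t with he | ⟨l, hl, hs⟩
    · rw [he] at h
      obtain ⟨t₀, h1, h2⟩ := ih h
      exact ⟨t₀, h1.trans (Nat.lt_succ_self t), h2⟩
    · rcases hs.issued_cases h with h | rfl
      · obtain ⟨t₀, h1, h2⟩ := ih h
        exact ⟨t₀, h1.trans (Nat.lt_succ_self t), h2⟩
      · exact ⟨t, Nat.lt_succ_self t, hl⟩

/-- Readiness is not stable, since objects get consumed. The later invariants therefore record the
property `Emitted` of the whole run at the moment when an honest validator checks readiness. -/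
theorem IsExecution.emitted {t : ℕ} {tx : M.UTx} {V : M.Val} (h : tx ∈ (r.state t).issued)
    (hV : M.Honest V) (hR : ((r.state t).ua V tx.sender).Ready tx) : r.Emitted tx :=
  let ⟨t₀, h1, h2⟩ := hr.issued_spec h
  ⟨t₀, h2, V, hV, t, h1.le, hR⟩

theorem IsExecution.fpLocked_spec (t : ℕ) : ∀ V A sn tx,
    ((r.state t).ua V A).fpLocked sn = some tx →
      M.Honest V ∧ tx.sender = A ∧ tx.sn = sn ∧ tx ∈ (r.state t).issued := by
  refine hr.invariant (P := fun s => ∀ V A sn tx, (s.ua V A).fpLocked sn = some tx →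
      M.Honest V ∧ tx.sender = A ∧ tx.sn = sn ∧ tx ∈ s.issued) ?_ ?_ t
  · intro V A sn tx h; simp [State.init] at h
  · intro t l _ hs ih V A sn tx h
    rcases hs.fpLocked_cases V A sn with he | ⟨tx', hV, h1, h2, h3, h4⟩
    · obtain ⟨h1, h2, h3, h4⟩ := ih V A sn tx (he ▸ h)
      exact ⟨h1, h2, h3, hs.extends.issued h4⟩
    · obtain rfl : tx = tx' := by rw [h4] at h; exact (Option.some.inj h).symm
      exact ⟨hV, h1, h2, hs.extends.issued h3⟩

/-- On receipt the slot becomes FP-locked if it was free, and the vote is cast in the same step if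
the lock is on this transaction. Since the lock never changes, no later lock can make a missing vote
due. -/
theorem IsExecution.received_spec (t : ℕ) : ∀ V A tx, tx ∈ ((r.state t).ua V A).received →
    tx.sender = A ∧ tx ∈ (r.state t).issued ∧ ((r.state t).ua V A).fpLocked tx.sn ≠ none ∧
      (tx.recipient = none → ((r.state t).ua V A).fpLocked tx.sn = some tx →
        tx ∈ ((r.state t).ua V A).voted) := by
  refine hr.invariant (P := fun s => ∀ V A tx, tx ∈ (s.ua V A).received →
    tx.sender = A ∧ tx ∈ s.issued ∧ (s.ua V A).fpLocked tx.sn ≠ none ∧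
      (tx.recipient = none → (s.ua V A).fpLocked tx.sn = some tx → tx ∈ (s.ua V A).voted)) ?_ ?_ t
  · intro V A tx h; simp [State.init] at h
  · intro t l _ hs ih V A tx h
    rcases hs.received_cases h with h | ⟨h1, h2, h3⟩
    · obtain ⟨h1, h2, h3, h4⟩ := ih V A tx h
      have he := ((hs.extends.ua V A).fpLocked tx.sn).eq_of_ne_none h3
      rw [he]
      exact ⟨h1, hs.extends.issued h2, h3, fun h5 h6 => (hs.extends.ua V A).voted (h4 h5 h6)⟩
    · exact ⟨h1, hs.extends.issued h2, h3⟩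

theorem IsExecution.voted_spec (t : ℕ) : ∀ V A tx, tx ∈ ((r.state t).ua V A).voted →
    tx.sender = A ∧ tx ∈ (r.state t).issued ∧ tx.recipient = none ∧ (r.state t).FP V tx := by
  refine hr.invariant (P := fun s => ∀ V A tx, tx ∈ (s.ua V A).voted →
    tx.sender = A ∧ tx ∈ s.issued ∧ tx.recipient = none ∧ s.FP V tx) ?_ ?_ t
  · intro V A tx h; simp [State.init] at h
  · intro t l _ hs ih V A tx h
    rcases hs.voted_cases h with h | ⟨rfl, h2, h3, h4⟩
    · obtain ⟨h1, h2, h3, h4⟩ := ih V A tx h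
      exact ⟨h1, hs.extends.issued h2, h3, hs.extends.fp h4⟩
    · exact ⟨rfl, hs.extends.issued h2, h3, h4⟩

theorem IsExecution.votesFromUA_spec (t : ℕ) : ∀ V A W tx, tx ∈ ((r.state t).ua V A).votesFrom W →
    tx.sender = A ∧ (M.Honest W → tx ∈ ((r.state t).ua W A).voted) := by
  refine hr.invariant (P := fun s => ∀ V A W tx, tx ∈ (s.ua V A).votesFrom W →
    tx.sender = A ∧ (M.Honest W → tx ∈ (s.ua W A).voted)) ?_ ?_ t
  · intro V A W tx h; simp [State.init] at h
  · intro t l _ hs ih V A W tx h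
    rcases hs.votesFromUA_cases h with h | ⟨h1, h2⟩
    · obtain ⟨h1, h2⟩ := ih V A W tx h
      exact ⟨h1, fun hW => (hs.extends.ua W A).voted (h2 hW)⟩
    · exact ⟨h1, fun hW => (hs.extends.ua W A).voted (h2 hW)⟩

theorem IsExecution.voted_quorum {t : ℕ} {V : M.Val} {A : M.UA} {tx : M.UTx} {q : ℕ}
    (h : q ≤ M.count fun W => tx ∈ ((r.state t).ua V A).votesFrom W) :
    M.Quorum q fun W => tx ∈ ((r.state t).ua W A).voted :=
  .of_count h fun W hW hm => (hr.votesFromUA_spec t V A W tx hm).2 hW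

theorem IsExecution.proofs_spec (t : ℕ) : ∀ V A tx, tx ∈ ((r.state t).ua V A).proofs →
    tx.sender = A ∧ (r.state t).PobProof tx := by
  refine hr.invariant (P := fun s => ∀ V A tx, tx ∈ (s.ua V A).proofs →
    tx.sender = A ∧ s.PobProof tx) ?_ ?_ t
  · intro V A tx h; simp [State.init] at h
  · intro t l _ hs ih V A tx h
    rcases hs.proofs_cases h with h | ⟨rfl, h2⟩
    · obtain ⟨h1, h2⟩ := ih V A tx h
      exact ⟨h1, hs.extends.pobProof h2⟩
    · refine ⟨rfl, hs.extends.pobProof ?_⟩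
      rcases h2 with h2 | h2
      · exact hr.voted_quorum h2
      · exact h2

theorem IsExecution.pool_spec (t : ℕ) : ∀ V X x, x ∈ ((r.state t).ra V X).pool →
    x.recipient = some X ∧ ∀ tx : M.UTx, x = .user tx → (r.state t).FP V tx ∧ r.Emitted tx := by
  refine hr.invariant (P := fun s => ∀ V X x, x ∈ (s.ra V X).pool →
    x.recipient = some X ∧ ∀ tx : M.UTx, x = .user tx → s.FP V tx ∧ r.Emitted tx) ?_ ?_ t
  · intro V X tx h; simp [State.init] at h
  · intro t l _ hs ih V X x h
    rcases hs.pool_cases h with h | ⟨h1, h2⟩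
    · obtain ⟨h1, h2⟩ := ih V X x h
      exact ⟨h1, fun tx hx => (h2 tx hx).imp_left hs.extends.fp⟩
    · refine ⟨h1, fun tx hx => ?_⟩
      obtain ⟨h3, h4, h5, h6⟩ := h2 tx hx
      exact ⟨hs.extends.fp h5, hr.emitted (hr.received_spec t V _ tx h4).2.1 h3 h6⟩

theorem IsExecution.block_spec (t : ℕ) : ∀ V X k B, ((r.state t).ra V X).block k = some B →
    (∀ x ∈ B, x.recipient = some X) ∧
      (M.Honest (M.leader k) → ((r.state t).ra (M.leader k) X).proposal k = some B) := by
  refine hr.invariant (P := fun s => ∀ V X k B, (s.ra V X).block k = some B →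
    (∀ x ∈ B, x.recipient = some X) ∧
      (M.Honest (M.leader k) → (s.ra (M.leader k) X).proposal k = some B)) ?_ ?_ t
  · intro V X k B h; simp [State.init] at h
  · intro t l _ hs ih V X k B h
    rcases hs.block_cases V X k with he | ⟨B', h1, h2, h3⟩
    · obtain ⟨h1, h2⟩ := ih V X k B (he ▸ h)
      exact ⟨h1, fun hl => (hs.extends.ra _ _).proposal _ _ (h2 hl)⟩
    · obtain rfl : B = B' := by rw [h1] at h; exact (Option.some.inj h).symm
      exact ⟨h2, fun hl => (hs.extends.ra _ _).proposal _ _ (h3 hl)⟩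

theorem IsExecution.fpOk_spec (t : ℕ) : ∀ V X k tx, tx ∈ ((r.state t).ra V X).fpOk k →
    (r.state t).FP V tx ∧ r.Emitted tx := by
  refine hr.invariant (P := fun s => ∀ V X k tx, tx ∈ (s.ra V X).fpOk k →
    s.FP V tx ∧ r.Emitted tx) ?_ ?_ t
  · intro V X k tx h; simp [State.init] at h
  · intro t l _ hs ih V X k tx h
    rcases hs.fpOk_cases h with h | ⟨h1, h2, h3, h4⟩
    · exact (ih V X k tx h).imp_left hs.extends.fp
    · exact ⟨hs.extends.fp h3, hr.emitted h2 h1 h4⟩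

/-- The fallback block in a vote. -/
theorem IsExecution.vote_fallback_spec (t : ℕ) : ∀ V X k x, (r.state t).FallbackHas V X k x →
    x.recipient = some X ∧ ∀ tx : M.UTx, x = .user tx → (r.state t).FP V tx ∧ r.Emitted tx := by
  refine hr.invariant (P := fun s => ∀ V X k x, s.FallbackHas V X k x →
    x.recipient = some X ∧ ∀ tx : M.UTx, x = .user tx → s.FP V tx ∧ r.Emitted tx) ?_ ?_ t
  · intro V X k x h; simp [State.init, State.FallbackHas] at h
  · rintro t l _ hs ih V X k x ⟨v, hv, hx⟩
    have key : x.recipient = some X ∧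
        ∀ tx : M.UTx, x = .user tx → (r.state t).FP V tx ∧ r.Emitted tx := by
      rcases hs.vote_cases V X k with he | ⟨_, _, v', h1, _⟩
      · exact ih V X k x ⟨v, he ▸ hv, hx⟩
      · obtain rfl : v = (v', ((r.state t).ra V X).pool) := by
          rw [h1] at hv; exact (Option.some.inj hv).symm
        exact hr.pool_spec t V X x hx
    exact ⟨key.1, fun tx hx => (key.2 tx hx).imp_left hs.extends.fp⟩

/-- The block that a vote is for. -/
theorem IsExecution.votedFor_spec (t : ℕ) : ∀ V X k B, (r.state t).VotedFor V X k B →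
    ((r.state t).ra V X).block k = some B ∧
      ∀ tx : M.UTx, Tx.user tx ∈ B → (r.state t).FP V tx ∧ r.Emitted tx := by
  refine hr.invariant (P := fun s => ∀ V X k B, s.VotedFor V X k B →
    (s.ra V X).block k = some B ∧
      ∀ tx : M.UTx, Tx.user tx ∈ B → s.FP V tx ∧ r.Emitted tx) ?_ ?_ t
  · intro V X k B h; simp [State.init, State.VotedFor] at h
  · rintro t l _ hs ih V X k B ⟨fb, hv⟩
    rcases hs.vote_cases V X k with he | ⟨_, _, v', h1, h2⟩
    · obtain ⟨h1, h2⟩ := ih V X k B ⟨fb, he ▸ hv⟩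
      exact ⟨(hs.extends.ra _ _).block _ _ h1, fun tx hx => (h2 tx hx).imp_left hs.extends.fp⟩
    · obtain rfl : v' = some B := by rw [h1] at hv; cases hv; rfl
      obtain ⟨h3, h4⟩ := h2 B rfl
      exact ⟨(hs.extends.ra _ _).block _ _ h3,
        fun tx hx => (hr.fpOk_spec t V X k tx (h4 tx hx)).imp_left hs.extends.fp⟩

theorem IsExecution.votesFrom_spec (t : ℕ) : ∀ V X k W v,
    ((r.state t).ra V X).votesFrom k W = some v → M.Honest W →
      ((r.state t).ra W X).vote k = some v := by
  refine hr.invariant (P := fun s => ∀ V X k W v, (s.ra V X).votesFrom k W = some v → M.Honest W →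
      (s.ra W X).vote k = some v) ?_ ?_ t
  · intro V X k W v h; simp [State.init] at h
  · intro t l _ hs ih V X k W v h hW
    rcases hs.votesFrom_cases V W X k with he | ⟨v', h1, h2⟩
    · exact (hs.extends.ra _ _).vote _ _ (ih V X k W v (he ▸ h) hW)
    · obtain rfl : v = v' := by rw [h1] at h; exact (Option.some.inj h).symm
      exact (hs.extends.ra _ _).vote _ _ (h2 hW)

theorem IsExecution.votesFor_quorum {t : ℕ} {V : M.Val} {X : M.RA} {k q : ℕ} {B : M.Block}
    (h : q ≤ ((r.state t).ra V X).votesFor k B) :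
    M.Quorum q fun W => (r.state t).VotedFor W X k B :=
  .of_count h fun W hW ⟨fb, hm⟩ => ⟨fb, hr.votesFrom_spec t V X k W _ hm hW⟩

theorem IsExecution.proof_spec (t : ℕ) : ∀ V X k B, ((r.state t).ra V X).proof k = some B →
    (r.state t).PoaProof X k B := by
  refine hr.invariant (P := fun s => ∀ V X k B, (s.ra V X).proof k = some B →
    s.PoaProof X k B) ?_ ?_ t
  · intro V X k B h; simp [State.init] at h
  · intro t l _ hs ih V X k B h
    rcases hs.proof_cases V X k with he | ⟨B', h1, h2⟩
    · exact hs.extends.poaProof (ih V X k B (he ▸ h))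
    · obtain rfl : B = B' := by rw [h1] at h; exact (Option.some.inj h).symm
      refine hs.extends.poaProof ?_
      rcases h2 with h2 | h2
      · exact hr.votesFor_quorum h2
      · exact h2

/-- The bound on `votesTotal` is kept for the fallback block that is formed if this candidate fails.
-/
theorem IsExecution.cand_spec (t : ℕ) : ∀ V X k B, ((r.state t).ra V X).cand k = some B →
    M.n - M.f ≤ ((r.state t).ra V X).votesTotal k ∧
    M.Quorum (M.n - M.p - 2 * M.f) fun W => (r.state t).VotedFor W X k B := by
  refine hr.invariant (P := fun s => ∀ V X k B, (s.ra V X).cand k = some B →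
    M.n - M.f ≤ (s.ra V X).votesTotal k ∧
    M.Quorum (M.n - M.p - 2 * M.f) fun W => s.VotedFor W X k B) ?_ ?_ t
  · intro V X k B h; simp [State.init] at h
  · intro t l _ hs ih V X k B h
    have hmono : ((r.state t).ra V X).votesTotal k ≤ ((r.state (t + 1)).ra V X).votesTotal k :=
      System.count_mono fun W hW =>
        (((hs.extends.ra V X).votesFrom k W).eq_of_ne_none hW).symm ▸ hW
    rcases hs.cand_cases V X k with he | ⟨B', h1, h2, h3⟩
    · obtain ⟨h1, h2⟩ := ih V X k B (he ▸ h)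
      exact ⟨h1.trans hmono, h2.mono le_rfl fun _ _ => hs.extends.votedFor⟩
    · obtain rfl : B = B' := by rw [h1] at h; exact (Option.some.inj h).symm
      exact ⟨h2.trans hmono, (hr.votesFor_quorum h3).mono le_rfl fun _ _ => hs.extends.votedFor⟩

/-- The answer is computed right after the attempt to lock, when the slot is certainly locked.
SP-locks never change, so positive and negative answers both remain accurate. -/
theorem IsExecution.reply_spec (t : ℕ) : ∀ V X k tx b,
    (((r.state t).ra V X).reply k tx = some b ∨ ((r.state t).ra V X).replyFb k tx = some b) →
      ((r.state t).ua V tx.sender).spLocked tx.sn ≠ none ∧ (b = true ↔ (r.state t).SP V tx) := by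
  refine hr.invariant (P := fun s => ∀ V X k tx b,
    ((s.ra V X).reply k tx = some b ∨ (s.ra V X).replyFb k tx = some b) →
      (s.ua V tx.sender).spLocked tx.sn ≠ none ∧ (b = true ↔ s.SP V tx)) ?_ ?_ t
  · intro V X k tx b h; simp [State.init] at h
  · intro t l _ hs ih V X k tx b h
    have old : (((r.state t).ra V X).reply k tx = some b ∨
        ((r.state t).ra V X).replyFb k tx = some b) →
        ((r.state (t + 1)).ua V tx.sender).spLocked tx.sn ≠ none ∧
          (b = true ↔ (r.state (t + 1)).SP V tx) := fun h => by
      obtain ⟨h1, h2⟩ := ih V X k tx b h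
      have he := ((hs.extends.ua V tx.sender).spLocked tx.sn).eq_of_ne_none h1
      unfold State.SP at *
      rw [he]; exact ⟨h1, h2⟩
    rcases h with h | h
    · rcases hs.reply_cases V X k tx with he | ⟨h1, b', h2, h3⟩
      · exact old (.inl (he ▸ h))
      · obtain rfl : b = b' := by rw [h2] at h; exact (Option.some.inj h).symm
        exact ⟨h1, h3⟩
    · rcases hs.replyFb_cases V X k tx with he | ⟨h1, b', h2, h3⟩
      · exact old (.inr (he ▸ h))
      · obtain rfl : b = b' := by rw [h2] at h; exact (Option.some.inj h).symm
        exact ⟨h1, h3⟩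

end Invariants

end Run

/-! ### The slow path: candidate blocks, proposals and SP-locks. -/

theorem RAEntity.mem_fallbackFrom {e : RAEntity M} {k : ℕ} {W : M.Val} {x : M.Trans} :
    x ∈ e.fallbackFrom k W ↔ ∃ v, e.votesFrom k W = some v ∧ x ∈ v.2 := by
  unfold RAEntity.fallbackFrom
  cases h : e.votesFrom k W <;> simp

/-- The threshold `n - 2f` is positive, so meeting it already implies presence in some received
fallback block. -/
theorem RAEntity.mem_fallback {e : RAEntity M} {k : ℕ} {x : M.Trans} (hn : 2 * M.f < M.n) :
    x ∈ e.fallback k ↔ M.n - 2 * M.f ≤ M.count fun W => x ∈ e.fallbackFrom k W := by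
  unfold RAEntity.fallback
  rw [Finset.mem_filter, and_iff_right_iff_imp]
  intro h
  obtain ⟨W, hW⟩ := System.count_pos (lt_of_lt_of_le (by omega) h)
  exact Finset.mem_biUnion.2 ⟨W, Finset.mem_univ _, hW⟩

namespace Run

variable {r : Run M}

/-- The assumptions of the safety properties. -/
structure Admissible (r : Run M) : Prop where
  byz : M.byz.card ≤ M.f
  size : 3 * M.f + 2 * M.p + 1 ≤ M.n
  exec : r.IsExecution
  qc : r.QuorumConsensusSpec
  ta : r.TransactionAgreementSpec

/-- A vote of `V.X` in instance `k` that is not for `B`. -/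
def VotedAgainst (s : State M) (V : M.Val) (X : M.RA) (k : ℕ) (B : M.Block) : Prop :=
  ∃ v, (s.ra V X).vote k = some v ∧ v.1 ≠ some B

/-- The vote of `V.X` in instance `k` does not have `x` in its fallback block. -/
def FallbackLacks (s : State M) (V : M.Val) (X : M.RA) (k : ℕ) (x : M.Trans) : Prop :=
  ∃ v, (s.ra V X).vote k = some v ∧ x ∉ v.2

variable (hr : r.Admissible)
include hr

theorem Admissible.fallback_upper {t : ℕ} {V : M.Val} {X : M.RA} {k : ℕ} {x : M.Trans}
    (h : x ∈ ((r.state t).ra V X).fallback k) :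
    M.Quorum (M.n - 2 * M.f) fun W => (r.state t).FallbackHas W X k x := by
  have := hr.size
  rw [RAEntity.mem_fallback (by omega)] at h
  refine .of_count h fun W hW hx => ?_
  obtain ⟨v, hv, hx⟩ := RAEntity.mem_fallbackFrom.1 hx
  exact ⟨v, hr.exec.votesFrom_spec t V X k W v hv hW, hx⟩

/-- Among `n - f` received votes at most `f` are Byzantine. If all honest ones carry `x`, then `x`
reaches the threshold `n - 2f`. -/
theorem Admissible.fallback_lower {t : ℕ} {V : M.Val} {X : M.RA} {k : ℕ}
    (h : M.n - M.f ≤ ((r.state t).ra V X).votesTotal k) (x : M.Trans) :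
    x ∈ ((r.state t).ra V X).fallback k ∨ ∃ W, M.Honest W ∧ FallbackLacks (r.state t) W X k x := by
  by_contra! hcon
  obtain ⟨h1, h2⟩ := hcon
  have := hr.size
  have := hr.byz
  rw [RAEntity.mem_fallback (by omega)] at h1
  have hQ : M.Quorum (M.n - M.f) fun W => ((r.state t).ra V X).votesFrom k W ≠ none :=
    .of_count h fun _ _ h => h
  have := hQ.le_count (P' := fun W => x ∈ ((r.state t).ra V X).fallbackFrom k W) fun W hW hv => by
    obtain ⟨v, hv⟩ := Option.ne_none_iff_exists'.1 hv
    by_contra hx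
    exact h2 W hW ⟨v, hr.exec.votesFrom_spec t V X k W v hv hW,
      fun hxv => hx (RAEntity.mem_fallbackFrom.2 ⟨v, hv, hxv⟩)⟩
  omega

/-- Of at least `n - f` votes, at most `n - p - 2f - 1` are for `B`, which leaves `p + f + 1`
others. Together with `n - p` votes for `B` this exceeds `n + f`. -/
theorem Admissible.votedAgainst_quorum {t : ℕ} {V : M.Val} {X : M.RA} {k : ℕ} {B : M.Block}
    (h : M.n - M.f ≤ ((r.state t).ra V X).votesTotal k)
    (hB : ((r.state t).ra V X).votesFor k B < M.n - M.p - 2 * M.f) :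
    M.Quorum (M.p + M.f + 1) fun W => VotedAgainst (r.state t) W X k B := by
  have := hr.size
  obtain ⟨S, hS, h1⟩ : ∃ S : Finset M.Val, M.n - M.f ≤ S.card ∧
      ∀ W ∈ S, ((r.state t).ra V X).votesFrom k W ≠ none :=
    ⟨_, h, fun W hW => by simpa using hW⟩
  obtain ⟨S', hS', h2⟩ : ∃ S' : Finset M.Val, S'.card < M.n - M.p - 2 * M.f ∧
      ∀ W, (∃ fb, ((r.state t).ra V X).votesFrom k W = some (some B, fb)) → W ∈ S' :=
    ⟨_, hB, fun W hW => by simpa using hW⟩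
  refine ⟨S \ S', ?_, fun W hW hon => ?_⟩
  · have := Finset.le_card_sdiff S' S
    omega
  · obtain ⟨hW1, hW2⟩ := Finset.mem_sdiff.1 hW
    obtain ⟨⟨v, b⟩, hv⟩ := Option.ne_none_iff_exists'.1 (h1 W hW1)
    exact ⟨_, hr.exec.votesFrom_spec t V X k W _ hv hon,
      fun he => hW2 (h2 W ⟨b, by rw [hv, ← he]⟩)⟩

/-- Where the second candidate of the slow path comes from. -/
theorem Admissible.candFb_spec (t : ℕ) : ∀ V X k B, ((r.state t).ra V X).candFb k = some B →
    (∀ x ∈ B, M.Quorum (M.n - 2 * M.f) fun W => (r.state t).FallbackHas W X k x) ∧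
    (∀ x, x ∈ B ∨ ∃ W, M.Honest W ∧ FallbackLacks (r.state t) W X k x) ∧
    ((∀ B', M.Quorum (M.p + M.f + 1) fun W => VotedAgainst (r.state t) W X k B') ∨
      ∃ B', ((r.state t).ra V X).cand k = some B' ∧ ∃ tx : M.UTx, Tx.user tx ∈ B' ∧
        ((r.state t).ua V tx.sender).spLocked tx.sn ≠ none ∧ ¬ (r.state t).SP V tx) := by
  refine hr.exec.invariant (P := fun s => ∀ V X k B, (s.ra V X).candFb k = some B →
    (∀ x ∈ B, M.Quorum (M.n - 2 * M.f) fun W => s.FallbackHas W X k x) ∧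
    (∀ x, x ∈ B ∨ ∃ W, M.Honest W ∧ FallbackLacks s W X k x) ∧
    ((∀ B', M.Quorum (M.p + M.f + 1) fun W => VotedAgainst s W X k B') ∨
      ∃ B', (s.ra V X).cand k = some B' ∧ ∃ tx : M.UTx, Tx.user tx ∈ B' ∧
        (s.ua V tx.sender).spLocked tx.sn ≠ none ∧ ¬ s.SP V tx)) ?_ ?_ t
  · intro V X k B h; simp [State.init] at h
  · intro t l _ hs ih V X k B h
    have hext := hs.extends
    have key : (∀ x ∈ B, M.Quorum (M.n - 2 * M.f) fun W => (r.state t).FallbackHas W X k x) ∧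
        (∀ x, x ∈ B ∨ ∃ W, M.Honest W ∧ FallbackLacks (r.state t) W X k x) ∧
        ((∀ B', M.Quorum (M.p + M.f + 1) fun W => VotedAgainst (r.state t) W X k B') ∨
          ∃ B', ((r.state t).ra V X).cand k = some B' ∧ ∃ tx : M.UTx, Tx.user tx ∈ B' ∧
            ((r.state t).ua V tx.sender).spLocked tx.sn ≠ none ∧ ¬ (r.state t).SP V tx) := by
      rcases hs.candFb_cases V X k with he | ⟨h1, h2⟩
      · exact ih V X k B (he ▸ h)
      · obtain rfl : B = ((r.state t).ra V X).fallback k := by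
          rw [h1] at h; exact (Option.some.inj h).symm
        refine ⟨fun x => hr.fallback_upper, hr.fallback_lower ?_, ?_⟩
        · rcases h2 with h2 | ⟨B', h2, -⟩
          · exact h2.1
          · exact (hr.exec.cand_spec t V X k B' h2).1
        · rcases h2 with h2 | ⟨B', h2, tx, h3, h4⟩
          · exact .inl fun B' => hr.votedAgainst_quorum h2.1 (h2.2 B')
          · obtain ⟨h5, h6⟩ := hr.exec.reply_spec t V X k tx false (.inl h4)
            exact .inr ⟨B', h2, tx, h3, h5, fun hsp => by simpa using h6.2 hsp⟩
    refine ⟨fun x hx => (key.1 x hx).mono le_rfl fun _ _ => hext.fallbackHas,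
      fun x => (key.2.1 x).imp_right fun ⟨W, hW, v, hv, hx⟩ =>
        ⟨W, hW, v, (hext.ra _ _).vote _ _ hv, hx⟩, ?_⟩
    rcases key.2.2 with h3 | ⟨B', h3, tx, h4, h5, h6⟩
    · exact .inl fun B' => (h3 B').mono le_rfl fun W _ ⟨v, hv, hB⟩ =>
        ⟨v, (hext.ra _ _).vote _ _ hv, hB⟩
    -- A failed lock means that the slot is held by another transaction; stated this way, the
    -- failure persists.
    · have he := ((hext.ua V tx.sender).spLocked tx.sn).eq_of_ne_none h5
      unfold State.SP at *
      exact .inr ⟨B', (hext.ra _ _).cand _ _ h3, tx, h4, by rwa [he], by rwa [he]⟩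

/-- What is proposed to Quorum Consensus. -/
theorem Admissible.qcProposed_spec (t : ℕ) : ∀ V X k B, ((r.state t).ra V X).qcProposed k = some B →
    (∀ tx : M.UTx, Tx.user tx ∈ B → (r.state t).SP V tx) ∧
    (((r.state t).ra V X).cand k = some B ∨ ∃ Bf, ((r.state t).ra V X).candFb k = some Bf ∧
      (∀ tx : M.UTx, Tx.user tx ∈ Bf → ((r.state t).ua V tx.sender).spLocked tx.sn ≠ none) ∧
      ∀ x, x ∈ B ↔ x ∈ Bf ∧ ∀ tx : M.UTx, x = Tx.user tx → (r.state t).SP V tx) := by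
  refine hr.exec.invariant (P := fun s => ∀ V X k B, (s.ra V X).qcProposed k = some B →
    (∀ tx : M.UTx, Tx.user tx ∈ B → s.SP V tx) ∧
    ((s.ra V X).cand k = some B ∨ ∃ Bf, (s.ra V X).candFb k = some Bf ∧
      (∀ tx : M.UTx, Tx.user tx ∈ Bf → (s.ua V tx.sender).spLocked tx.sn ≠ none) ∧
      ∀ x, x ∈ B ↔ x ∈ Bf ∧ ∀ tx : M.UTx, x = Tx.user tx → s.SP V tx)) ?_ ?_ t
  · intro V X k B h; simp [State.init] at h
  · intro t l _ hs ih V X k B h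
    have hext := hs.extends
    have key : (∀ tx : M.UTx, Tx.user tx ∈ B → (r.state t).SP V tx) ∧
        (((r.state t).ra V X).cand k = some B ∨ ∃ Bf, ((r.state t).ra V X).candFb k = some Bf ∧
          (∀ tx : M.UTx, Tx.user tx ∈ Bf → ((r.state t).ua V tx.sender).spLocked tx.sn ≠ none) ∧
          ∀ x, x ∈ B ↔ x ∈ Bf ∧ ∀ tx : M.UTx, x = Tx.user tx → (r.state t).SP V tx) := by
      rcases hs.qcProposed_cases V X k with he | ⟨B', h1, h2, h3⟩ | ⟨Bf, h1, h2, h3⟩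
      · exact ih V X k B (he ▸ h)
      · obtain rfl : B = B' := by rw [h1] at h; exact (Option.some.inj h).symm
        exact ⟨fun tx htx => (hr.exec.reply_spec t V X k tx true (.inl (h3 tx htx))).2.1 rfl,
          .inl h2⟩
      · rw [h3] at h
        obtain rfl := Option.some.inj h
        have hrep : ∀ tx : M.UTx, Tx.user tx ∈ Bf →
            ((r.state t).ua V tx.sender).spLocked tx.sn ≠ none ∧
            (((r.state t).ra V X).replyFb k tx = some true ↔ (r.state t).SP V tx) := fun tx htx => by
          obtain ⟨b, hb⟩ := Option.ne_none_iff_exists'.1 (h2 tx htx)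
          obtain ⟨h4, h5⟩ := hr.exec.reply_spec t V X k tx b (.inr hb)
          exact ⟨h4, by rw [hb, ← h5]; simp⟩
        refine ⟨fun tx htx => ?_, .inr ⟨Bf, h1, fun tx htx => (hrep tx htx).1, fun x => ?_⟩⟩
        · obtain ⟨h4, h5⟩ := Finset.mem_filter.1 htx
          exact (hrep tx h4).2.1 (h5 tx rfl)
        · rw [Finset.mem_filter]
          refine and_congr_right fun hx => forall_congr' fun tx => ?_
          refine forall_congr' fun he => ?_
          subst he
          exact (hrep tx hx).2
    refine ⟨fun tx htx => hext.sp (key.1 tx htx), key.2.imp ((hext.ra _ _).cand _ _) ?_⟩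
    rintro ⟨Bf, h1, h2, h3⟩
    have he := fun tx htx => ((hext.ua V tx.sender).spLocked tx.sn).eq_of_ne_none (h2 tx htx)
    refine ⟨Bf, (hext.ra _ _).candFb _ _ h1, fun tx htx => by rw [he tx htx]; exact h2 tx htx,
      fun x => (h3 x).trans ?_⟩
    refine and_congr_right fun hx => forall_congr' fun tx => forall_congr' fun hxt => ?_
    subst hxt
    unfold State.SP
    rw [he tx hx]

/-- The thresholds `n - p - 2f` and `n - 2f` both exceed `f`, so an honest validator vouches for
each transaction, by its vote for the block or by its fallback block. -/
theorem Admissible.fp_of_qcProposed {t : ℕ} {V : M.Val} {X : M.RA} {k : ℕ} {B : M.Block}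
    (h : ((r.state t).ra V X).qcProposed k = some B) {x : M.Trans} (hx : x ∈ B) :
    x.recipient = some X ∧ ∀ tx : M.UTx, x = .user tx → r.Emitted tx := by
  have := hr.size
  have := hr.byz
  rcases (hr.qcProposed_spec t V X k B h).2 with hc | ⟨Bf, hc, -, hB⟩
  · obtain ⟨W, -, hW⟩ := (hr.exec.cand_spec t V X k B hc).2.exists (by omega)
    obtain ⟨h1, h2⟩ := hr.exec.votedFor_spec t W X k B hW
    exact ⟨(hr.exec.block_spec t W X k B h1).1 x hx, fun tx htx => (h2 tx (htx ▸ hx)).2⟩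
  · obtain ⟨W, -, hW⟩ := ((hr.candFb_spec t V X k Bf hc).1 x ((hB x).1 hx).1).exists (by omega)
    obtain ⟨h1, h2⟩ := hr.exec.vote_fallback_spec t W X k x hW
    exact ⟨h1, fun tx htx => (h2 tx htx).2⟩

theorem Admissible.exists_proposer {t : ℕ} {V : M.Val} {X : M.RA} {k : ℕ} {B : M.Block}
    (hV : M.Honest V) (h : ((r.state t).ra V X).qcDecided k = some B) {x : M.Trans} (hx : x ∈ B) :
    ∃ W B', M.Honest W ∧ ((r.state t).ra W X).qcProposed k = some B' ∧ x ∈ B' := by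
  have := hr.size
  obtain ⟨W, hW, B', h1, h2⟩ := System.count_pos
    (lt_of_lt_of_le (by omega) (hr.qc.validity_quorum t X k V B x hV h hx))
  exact ⟨W, B', hW, h1, h2⟩

/-- An SP-locked transaction is FP-locked by many validators. -/
theorem Admissible.spLocked_spec (t : ℕ) : ∀ V A sn tx,
    ((r.state t).ua V A).spLocked sn = some tx → tx.sender = A ∧ tx.sn = sn ∧
      M.Quorum (M.n - M.p - 2 * M.f) fun W => (r.state t).FP W tx := by
  refine hr.exec.invariant (P := fun s => ∀ V A sn tx, (s.ua V A).spLocked sn = some tx →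
    tx.sender = A ∧ tx.sn = sn ∧ M.Quorum (M.n - M.p - 2 * M.f) fun W => s.FP W tx) ?_ ?_ t
  · intro V A sn tx h; simp [State.init] at h
  · intro t l _ hs ih V A sn tx h
    have hext := hs.extends
    rcases hs.spLocked_cases V A sn with he | ⟨tx', hV, h1, h2, h3, h4⟩
    · obtain ⟨h1, h2, h3⟩ := ih V A sn tx (he ▸ h)
      exact ⟨h1, h2, h3.mono le_rfl fun _ _ => hext.fp⟩
    · obtain rfl : tx = tx' := by rw [h3] at h; exact (Option.some.inj h).symm
      refine ⟨h1, h2, .mono (P := fun W => (r.state t).FP W tx) ?_ le_rfl fun _ _ => hext.fp⟩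
      rcases h4 with h4 | ⟨X, k, B, hB, h4 | h4 | h4⟩
      · exact (hr.exec.voted_quorum h4).mono le_rfl
          fun W _ hW => (hr.exec.voted_spec t W A tx hW).2.2.2
      · exact (hr.exec.cand_spec t V X k B h4).2.mono le_rfl
          fun W _ hW => ((hr.exec.votedFor_spec t W X k B hW).2 tx hB).1
      -- Here even `n - 2f` honest-or-Byzantine pools contain the transaction, and honest pools hold
      -- only FP-locked ones.
      · exact ((hr.candFb_spec t V X k B h4).1 _ hB).mono (by omega)
          fun W _ hW => ((hr.exec.vote_fallback_spec t W X k _ hW).2 tx rfl).1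
      -- Some honest `W` has by now proposed a block with `tx` and so had SP-locked `tx`; the
      -- induction hypothesis applies to the lock of `W`. This uses Quorum Validity at the moment
      -- `t` and not merely for the whole run.
      · obtain ⟨W, B', hW, h5, h6⟩ := hr.exists_proposer hV h4 hB
        exact (ih W _ _ tx ((hr.qcProposed_spec t W X k B' h5).1 tx h6)).2.2

theorem Admissible.taProposed_spec (t : ℕ) : ∀ V A sn tx,
    ((r.state t).ua V A).taProposed sn = some tx → ((r.state t).ua V A).spLocked sn = some tx := by
  refine hr.exec.invariant (P := fun s => ∀ V A sn tx, (s.ua V A).taProposed sn = some tx →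
    (s.ua V A).spLocked sn = some tx) ?_ ?_ t
  · intro V A sn tx h; simp [State.init] at h
  · intro t l _ hs ih V A sn tx h
    rcases hs.taProposed_cases V A sn with he | ⟨-, he⟩
    · exact (hs.extends.ua V A).spLocked _ _ (ih V A sn tx (he ▸ h))
    · rw [← he]; exact h

theorem Admissible.taDecided_spec {t : ℕ} {V : M.Val} {A : M.UA} {sn : ℕ} {tx : M.UTx}
    (hV : M.Honest V) (h : ((r.state t).ua V A).taDecided sn = some (some tx)) :
    tx.sender = A ∧ tx.sn = sn ∧ M.Quorum (M.n - M.p - 2 * M.f) fun W => (r.state t).FP W tx := by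
  have := hr.size
  obtain ⟨W, hW, h1⟩ := System.count_pos
    (lt_of_lt_of_le (by omega) (hr.ta.validity_quorum t A sn V tx hV h))
  exact hr.spLocked_spec t W A sn tx (hr.taProposed_spec t W A sn tx h1)

/-! ### Certified transactions -/

omit hr in
/-- `tx` has been agreed upon, in the fast path or by Transaction Agreement. -/
def _root_.Mangrove.State.Certified (s : State M) (tx : M.UTx) : Prop :=
  M.Quorum (M.n - M.p) (fun W => s.FP W tx) ∨
    ∃ V, M.Honest V ∧ (s.ua V tx.sender).taDecided tx.sn = some (some tx)

end Run

theorem State.Extends.certified {s s' : State M} (h : s.Extends s') {tx : M.UTx}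
    (hc : s.Certified tx) : s'.Certified tx :=
  hc.imp (fun hq => hq.mono le_rfl fun _ _ => h.fp)
    fun ⟨V, hV, hd⟩ => ⟨V, hV, (h.ua _ _).taDecided _ _ hd⟩

theorem State.FP.unique {s : State M} {V : M.Val} {tx₁ tx₂ : M.UTx} (h₁ : s.FP V tx₁)
    (h₂ : s.FP V tx₂) (hA : tx₁.sender = tx₂.sender) (hsn : tx₁.sn = tx₂.sn) : tx₁ = tx₂ := by
  unfold State.FP at h₁ h₂
  rw [hA, hsn, h₂] at h₁
  exact (Option.some.inj h₁).symm

namespace Run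

variable {r : Run M}

section Safety

variable (hr : r.Admissible)
include hr

/-- The inequality `(n - p) + (n - p - 2f) > n + f` is precisely `n > 3f + 2p`. -/
theorem Admissible.eq_of_fp_quorum {s : State M} {tx₁ tx₂ : M.UTx}
    (h₁ : M.Quorum (M.n - M.p) fun W => s.FP W tx₁)
    (h₂ : M.Quorum (M.n - M.p - 2 * M.f) fun W => s.FP W tx₂)
    (hA : tx₁.sender = tx₂.sender) (hsn : tx₁.sn = tx₂.sn) : tx₁ = tx₂ := by
  have := hr.size
  have := hr.byz
  obtain ⟨W, -, h1, h2⟩ := h₁.inter h₂ (by omega)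
  exact h1.unique h2 hA hsn

theorem Admissible.certified_quorum {t : ℕ} {tx : M.UTx} (h : (r.state t).Certified tx) :
    M.Quorum (M.n - M.p - 2 * M.f) fun W => (r.state t).FP W tx := by
  rcases h with h | ⟨V, hV, h⟩
  · exact h.mono (by omega) fun _ _ h => h
  · exact (hr.taDecided_spec hV h).2.2

theorem Admissible.certified_issued {t : ℕ} {tx : M.UTx} (h : (r.state t).Certified tx) :
    tx ∈ (r.state t).issued := by
  have := hr.size
  have := hr.byz
  obtain ⟨W, -, hW⟩ := (hr.certified_quorum h).exists (by omega)
  exact (hr.exec.fpLocked_spec t W _ _ tx hW).2.2.2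

/-- Two quorums of size `n - p - 2f` need not meet in an honest validator. Counting settles the
cases with a fast quorum, and the agreement property of Transaction Agreement settles the last one.
-/
theorem Admissible.certified_unique {t₁ t₂ : ℕ} {tx₁ tx₂ : M.UTx}
    (h₁ : (r.state t₁).Certified tx₁) (h₂ : (r.state t₂).Certified tx₂)
    (hA : tx₁.sender = tx₂.sender) (hsn : tx₁.sn = tx₂.sn) : tx₁ = tx₂ := by
  replace h₁ := (hr.exec.extends (le_max_left t₁ t₂)).certified h₁
  replace h₂ := (hr.exec.extends (le_max_right t₁ t₂)).certified h₂
  have q₁ := hr.certified_quorum h₁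
  have q₂ := hr.certified_quorum h₂
  rcases h₁ with h₁ | ⟨V₁, hV₁, h₁⟩
  · exact hr.eq_of_fp_quorum h₁ q₂ hA hsn
  rcases h₂ with h₂ | ⟨V₂, hV₂, h₂⟩
  · exact (hr.eq_of_fp_quorum h₂ q₁ hA.symm hsn.symm).symm
  · rw [hA, hsn] at h₁
    have := hr.ta.agreement _ _ V₁ V₂ _ _ hV₁ hV₂ ⟨_, h₁⟩ ⟨_, h₂⟩
    exact Option.some.inj this

theorem Admissible.certified_of_pobProof {t : ℕ} {tx : M.UTx} (h : (r.state t).PobProof tx) :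
    (r.state t).Certified tx :=
  .inl (System.Quorum.mono h le_rfl fun W _ hW => (hr.exec.voted_spec t W _ tx hW).2.2.2)

/-! ### Decisions of Parallel Optimistic Agreement -/

theorem Admissible.decided_spec (t : ℕ) : ∀ V X k B, ((r.state t).ra V X).decided k = some B →
    ((r.state t).ra V X).proof k = some B ∨
    ∃ B₀, ((r.state t).ra V X).qcDecided k = some B₀ ∧
      (∀ tx : M.UTx, Tx.user tx ∈ B₀ → ((r.state t).ua V tx.sender).taDecided tx.sn ≠ none) ∧
      ∀ x, x ∈ B ↔ x ∈ B₀ ∧ ∀ tx : M.UTx, x = .user tx →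
        ((r.state t).ua V tx.sender).taDecided tx.sn = some (some tx) := by
  refine hr.exec.invariant (P := fun s => ∀ V X k B, (s.ra V X).decided k = some B →
    (s.ra V X).proof k = some B ∨
    ∃ B₀, (s.ra V X).qcDecided k = some B₀ ∧
      (∀ tx : M.UTx, Tx.user tx ∈ B₀ → (s.ua V tx.sender).taDecided tx.sn ≠ none) ∧
      ∀ x, x ∈ B ↔ x ∈ B₀ ∧ ∀ tx : M.UTx, x = .user tx →
        (s.ua V tx.sender).taDecided tx.sn = some (some tx)) ?_ ?_ t
  · intro V X k B h; simp [State.init] at h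
  · intro t l _ hs ih V X k B h
    have hext := hs.extends
    have slow : (∃ B₀, ((r.state t).ra V X).qcDecided k = some B₀ ∧
        (∀ tx : M.UTx, Tx.user tx ∈ B₀ → ((r.state t).ua V tx.sender).taDecided tx.sn ≠ none) ∧
        ∀ x, x ∈ B ↔ x ∈ B₀ ∧ ∀ tx : M.UTx, x = .user tx →
          ((r.state t).ua V tx.sender).taDecided tx.sn = some (some tx)) →
        ∃ B₀, ((r.state (t + 1)).ra V X).qcDecided k = some B₀ ∧
        (∀ tx : M.UTx, Tx.user tx ∈ B₀ → ((r.state (t + 1)).ua V tx.sender).taDecided tx.sn ≠ none) ∧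
        ∀ x, x ∈ B ↔ x ∈ B₀ ∧ ∀ tx : M.UTx, x = .user tx →
          ((r.state (t + 1)).ua V tx.sender).taDecided tx.sn = some (some tx) := by
      rintro ⟨B₀, h1, h2, h3⟩
      -- Every Transaction Agreement that the filter reads has already decided, so the filtered
      -- block does not change later.
      have he := fun tx htx => ((hext.ua V tx.sender).taDecided tx.sn).eq_of_ne_none (h2 tx htx)
      refine ⟨B₀, (hext.ra _ _).qcDecided _ _ h1, fun tx htx => by rw [he tx htx]; exact h2 tx htx,
        fun x => (h3 x).trans (and_congr_right fun hx => forall_congr' fun tx =>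
          forall_congr' fun hxt => ?_)⟩
      subst hxt
      rw [he tx hx]
    rcases hs.decided_cases V X k with he | ⟨B', h1, h2 | ⟨B₀, h2, h3, h4⟩⟩
    · exact (ih V X k B (he ▸ h)).imp ((hext.ra _ _).proof _ _) slow
    · obtain rfl : B = B' := by rw [h1] at h; exact (Option.some.inj h).symm
      exact .inl h2
    · obtain rfl : B = B' := by rw [h1] at h; exact (Option.some.inj h).symm
      exact .inr (slow ⟨B₀, h2, h3, fun x => by rw [h4, Finset.mem_filter]⟩)

theorem Admissible.decided_mem {t : ℕ} {V : M.Val} {X : M.RA} {k : ℕ} {B : M.Block}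
    (hV : M.Honest V) (h : ((r.state t).ra V X).decided k = some B) {x : M.Trans} (hx : x ∈ B) :
    x.recipient = some X ∧
      ∀ tx : M.UTx, x = .user tx → (r.state t).Certified tx ∧ r.Emitted tx := by
  have := hr.size
  have := hr.byz
  rcases hr.decided_spec t V X k B h with h | ⟨B₀, h1, -, h3⟩
  · have hq := hr.exec.proof_spec t V X k B h
    have hv := fun W (hW : (r.state t).VotedFor W X k B) => hr.exec.votedFor_spec t W X k B hW
    obtain ⟨W, -, hW⟩ := System.Quorum.exists hq (by omega)
    refine ⟨(hr.exec.block_spec t W X k B (hv W hW).1).1 x hx, fun tx htx => ?_⟩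
    subst htx
    exact ⟨.inl (System.Quorum.mono hq le_rfl fun W _ hW => ((hv W hW).2 tx hx).1),
      ((hv W hW).2 tx hx).2⟩
  · obtain ⟨h4, h5⟩ := (h3 x).1 hx
    obtain ⟨W, B', -, h6, h7⟩ := hr.exists_proposer hV h1 h4
    obtain ⟨h8, h9⟩ := hr.fp_of_qcProposed h6 h7
    exact ⟨h8, fun tx htx => ⟨.inr ⟨V, hV, h5 tx htx⟩, h9 tx htx⟩⟩

/-- After a fast decision only the decided block can be proposed to Quorum Consensus. -/
theorem Admissible.qcProposed_eq {t₁ t₂ : ℕ} {V : M.Val} {X : M.RA} {k : ℕ} {B B' : M.Block}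
    (h : (r.state t₁).PoaProof X k B) (h' : ((r.state t₂).ra V X).qcProposed k = some B') :
    B' = B := by
  have := hr.size
  have := hr.byz
  replace h := (hr.exec.extends (le_max_left t₁ t₂)).poaProof h
  replace h' := ((hr.exec.extends (le_max_right t₁ t₂)).ra _ _).qcProposed _ _ h'
  generalize max t₁ t₂ = t at h h'
  -- The `n - p` votes for `B` and the `n - p - 2f` votes behind a candidate share an honest voter,
  -- who votes once.
  have hcand : ∀ B'', ((r.state t).ra V X).cand k = some B'' → B'' = B := fun B'' h1 => by
    obtain ⟨W, -, ⟨fb, h2⟩, ⟨fb', h3⟩⟩ := System.Quorum.inter h (hr.exec.cand_spec t V X k B'' h1).2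
      (by omega)
    rw [h2] at h3
    cases h3
    rfl
  rcases (hr.qcProposed_spec t V X k B' h').2 with h1 | ⟨Bf, h1, -⟩
  · exact hcand B' h1
  · exfalso
    rcases (hr.candFb_spec t V X k Bf h1).2.2 with h2 | ⟨B'', h2, tx, h3, h4, h5⟩
    -- If no block had enough votes, then `p + f + 1` votes are not for `B`, and one honest voter
    -- would be on both sides.
    · obtain ⟨W, -, ⟨fb, h3⟩, ⟨v, h4, h5⟩⟩ := System.Quorum.inter h (h2 B) (by omega)
      rw [h3] at h4
      cases h4
      exact h5 rfl
    · obtain rfl := hcand B'' h2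
      obtain ⟨tx', h6⟩ := Option.ne_none_iff_exists'.1 h4
      obtain ⟨h7, h8, h9⟩ := hr.spLocked_spec t V _ _ tx' h6
      -- If the candidate was `B` but an SP-lock failed, a conflicting `tx'` is SP-locked. Its
      -- FP-lock quorum meets that of the voters for `B`, so there is no conflict after all.
      have hq : M.Quorum (M.n - M.p) fun W => (r.state t).FP W tx :=
        System.Quorum.mono h le_rfl fun W _ hW => ((hr.exec.votedFor_spec t W X k _ hW).2 tx h3).1
      obtain rfl := hr.eq_of_fp_quorum hq h9 h7.symm h8.symm
      exact h5 h6

/-- A slow decision agrees with a fast one. -/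
theorem Admissible.slow_eq_fast {t : ℕ} {V : M.Val} {X : M.RA} {k : ℕ} {B B₀ : M.Block}
    (hV : M.Honest V) (h : (r.state t).PoaProof X k B)
    (h₀ : ((r.state t).ra V X).qcDecided k = some B₀) :
    B₀ = B ∧ ∀ tx : M.UTx, Tx.user tx ∈ B →
      ((r.state t).ua V tx.sender).taDecided tx.sn ≠ none →
        ((r.state t).ua V tx.sender).taDecided tx.sn = some (some tx) := by
  refine ⟨Finset.ext fun x => ⟨fun hx => ?_, fun hx => ?_⟩, fun tx htx hta => ?_⟩
  · obtain ⟨W, B', -, h1, h2⟩ := hr.exists_proposer hV h₀ hx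
    exact hr.qcProposed_eq h h1 ▸ h2
  -- All honest proposals equal `B`, so everything in `B` must be decided.
  · exact hr.qc.validity_all X k V B₀ x hV ⟨t, h₀⟩ fun W B' _ ⟨t', h1⟩ =>
      (hr.qcProposed_eq h h1).symm ▸ hx
  · obtain ⟨d, hd⟩ := Option.ne_none_iff_exists'.1 hta
    rw [hd, hr.ta.validity_all _ _ V d tx hV ⟨t, hd⟩ fun W tx' _ ⟨t', h1⟩ => ?_]
    -- Any proposal to this Transaction Agreement is an SP-locked transaction. Its FP-lock quorum
    -- meets the voters for `B`, who FP-locked `tx`; so all proposals are `tx`, and the decision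
    -- cannot be empty.
    have h2 := ((hr.exec.extends (le_max_right t t')).ua _ _).spLocked _ _
      (hr.taProposed_spec t' W _ _ tx' h1)
    obtain ⟨h3, h4, h5⟩ := hr.spLocked_spec _ W _ _ tx' h2
    have hq : M.Quorum (M.n - M.p) fun W => (r.state (max t t')).FP W tx :=
      System.Quorum.mono ((hr.exec.extends (le_max_left t t')).poaProof h) le_rfl
        fun W _ hW => ((hr.exec.votedFor_spec _ W X k _ hW).2 tx htx).1
    exact (hr.eq_of_fp_quorum hq h5 h3.symm h4.symm).symm

/-- Two fast decisions share an honest voter, a fast and a slow one agree by `slow_eq_fast`, and two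
slow ones apply the same filter to the same block by the agreement of both primitives. -/
theorem Admissible.decided_unique {t₁ t₂ : ℕ} {V W : M.Val} {X : M.RA} {k : ℕ} {B B' : M.Block}
    (hV : M.Honest V) (hW : M.Honest W) (h₁ : ((r.state t₁).ra V X).decided k = some B)
    (h₂ : ((r.state t₂).ra W X).decided k = some B') : B = B' := by
  have := hr.size
  have := hr.byz
  replace h₁ := ((hr.exec.extends (le_max_left t₁ t₂)).ra _ _).decided _ _ h₁
  replace h₂ := ((hr.exec.extends (le_max_right t₁ t₂)).ra _ _).decided _ _ h₂
  generalize max t₁ t₂ = t at h₁ h₂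
  have fast_slow : ∀ {V B B'}, M.Honest V → (r.state t).PoaProof X k B →
      (∃ B₀, ((r.state t).ra V X).qcDecided k = some B₀ ∧
      (∀ tx : M.UTx, Tx.user tx ∈ B₀ → ((r.state t).ua V tx.sender).taDecided tx.sn ≠ none) ∧
      ∀ x, x ∈ B' ↔ x ∈ B₀ ∧ ∀ tx : M.UTx, x = .user tx →
        ((r.state t).ua V tx.sender).taDecided tx.sn = some (some tx)) → B = B' := by
    rintro V B B' hV h ⟨B₀, h1, h2, h3⟩
    obtain ⟨rfl, h4⟩ := hr.slow_eq_fast hV h h1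
    ext x
    rw [h3 x, iff_self_and]
    rintro hx tx rfl
    exact h4 tx hx (h2 tx hx)
  rcases hr.decided_spec t V X k B h₁ with h₁ | h₁ <;>
  rcases hr.decided_spec t W X k B' h₂ with h₂ | h₂
  · obtain ⟨W', -, ⟨fb, h3⟩, ⟨fb', h4⟩⟩ := System.Quorum.inter (hr.exec.proof_spec t V X k B h₁)
      (hr.exec.proof_spec t W X k B' h₂) (by omega)
    rw [h3] at h4
    cases h4
    rfl
  · exact fast_slow hW (hr.exec.proof_spec t V X k B h₁) h₂
  · exact (fast_slow hV (hr.exec.proof_spec t W X k B' h₂) h₁).symm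
  · obtain ⟨B₀, h1, h2, h3⟩ := h₁
    obtain ⟨B₀', h1', h2', h3'⟩ := h₂
    obtain rfl := hr.qc.agreement X k V W B₀ B₀' hV hW ⟨t, h1⟩ ⟨t, h1'⟩
    ext x
    rw [h3 x, h3' x]
    refine and_congr_right fun hx => forall_congr' fun tx => forall_congr' fun hxt => ?_
    subst hxt
    obtain ⟨d, hd⟩ := Option.ne_none_iff_exists'.1 (h2 tx hx)
    obtain ⟨d', hd'⟩ := Option.ne_none_iff_exists'.1 (h2' tx hx)
    rw [hd, hd', hr.ta.agreement _ _ V W d d' hV hW ⟨t, hd⟩ ⟨t, hd'⟩]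

end Safety

end Run

/-! ### The common sequence of decided blocks -/

theorem Batch.mem_foldl_log {X : M.RA} {l : List M.Trans} {b : Batch M} {x : M.Trans}
    (h : x ∈ (l.foldl (Batch.run X) b).log) : x ∈ b.log ∨ x ∈ l := by
  induction l generalizing b with
  | nil => exact .inl h
  | cons a l ih =>
    rcases ih h with h | h
    · unfold Batch.run at h
      split_ifs at h with ha
      · exact .inl h
      · rcases List.mem_append.1 h with h | h
        · exact .inl h
        · exact .inr (by simp_all)
    · exact .inr (List.mem_cons_of_mem _ h)

/-- Execution depends only on state and log. The outputs may start differently because a validator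
begins each block with empty output, whereas the ledger accumulates it. -/
theorem Batch.foldl_congr (X : M.RA) (l : List M.Trans) (b b' : Batch M)
    (hst : b.st = b'.st) (hlog : b.log = b'.log) :
    (l.foldl (Batch.run X) b).st = (l.foldl (Batch.run X) b').st ∧
    (l.foldl (Batch.run X) b).log = (l.foldl (Batch.run X) b').log ∧
    ∃ o, (l.foldl (Batch.run X) b).out = b.out ++ o ∧ (l.foldl (Batch.run X) b').out = b'.out ++ o := by
  induction l generalizing b b' with
  | nil => exact ⟨hst, hlog, [], by simp⟩
  | cons a l ih =>
    simp only [List.foldl_cons]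
    by_cases ha : a ∈ b.log
    · have ha' := ha
      rw [hlog] at ha'
      simp only [Batch.run, if_pos ha, if_pos ha']
      exact ih b b' hst hlog
    · have ha' := ha
      rw [hlog] at ha'
      obtain ⟨h1, h2, o, h3, h4⟩ := ih (b.run X a) (b'.run X a)
        (by simp [Batch.run, if_neg ha, if_neg ha', hst])
        (by simp [Batch.run, if_neg ha', hlog])
      refine ⟨h1, h2, (a, (M.runRA X b.st a).created) :: o, ?_, ?_⟩
      · rw [h3]; simp [Batch.run, if_neg ha]
      · rw [h4]; simp [Batch.run, if_neg ha', hst]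

/-- Properties of the result of executing transactions that do not depend on the transactions. -/
structure Batch.Regular (b : Batch M) : Prop where
  log_eq : b.log = b.out.map Prod.fst
  nodup : b.log.Nodup
  origin : ∀ m ∈ b.out, ∀ c ∈ m.2, M.origin c.2 = some m.1

theorem Batch.Regular.run {X : M.RA} {b : Batch M} (h : b.Regular) (x : M.Trans) :
    (b.run X x).Regular := by
  unfold Batch.run
  split_ifs with hx
  · exact h
  · refine ⟨by simp [h.log_eq], ?_, fun m hm c hc => ?_⟩
    · exact List.nodup_append.2 ⟨h.nodup, List.nodup_singleton _, fun y hy z hz he =>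
        hx (List.mem_singleton.1 hz ▸ he ▸ hy)⟩
    · rcases List.mem_append.1 hm with hm | hm
      · exact h.origin m hm c hc
      · rw [List.mem_singleton] at hm
        subst hm
        exact M.origin_runRA X b.st x c hc

theorem Batch.Regular.foldl {X : M.RA} {b : Batch M} (h : b.Regular) (l : List M.Trans) :
    (l.foldl (Batch.run X) b).Regular := by
  induction l generalizing b with
  | nil => exact h
  | cons a l ih => exact ih (h.run a)

theorem Batch.Regular.created_unique {b : Batch M} (h : b.Regular) {x : M.Trans}
    {c c' : Set (M.UA × M.Obj)} (hc : (x, c) ∈ b.out) (hc' : (x, c') ∈ b.out) : c = c' := by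
  have hn := h.nodup
  rw [h.log_eq] at hn
  exact congrArg Prod.snd (List.inj_on_of_nodup_map hn hc hc' rfl)

theorem Batch.Regular.mem_log {b : Batch M} (h : b.Regular) {x : M.Trans} :
    x ∈ b.log ↔ ∃ c, (x, c) ∈ b.out := by
  rw [h.log_eq]; simp

namespace Run

variable (r : Run M)

/-- The block that honest validators decide in instance `k` of `X` (if they decide). -/
noncomputable def blockAt (X : M.RA) (k : ℕ) : M.Block :=
  if h : ∃ B V t, M.Honest V ∧ ((r.state t).ra V X).decided k = some B then h.choose else ∅

/-- The result of executing the decided blocks of the instances before `k`. -/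
noncomputable def ledger (X : M.RA) : ℕ → Batch M
  | 0 => { st := M.initState X, log := [], out := [], emitted := [] }
  | k + 1 => (r.blockAt X k).toList.foldl (Batch.run X) (ledger X k)

theorem ledger_regular (X : M.RA) (k : ℕ) : (r.ledger X k).Regular := by
  induction k with
  | zero => exact ⟨rfl, List.nodup_nil, fun m hm => by simp [ledger] at hm⟩
  | succ k ih => exact ih.foldl _

theorem ledger_out_mono (X : M.RA) {k k' : ℕ} (h : k ≤ k') :
    (r.ledger X k).out ⊆ (r.ledger X k').out := by
  induction k', h using Nat.le_induction with
  | base => exact List.Subset.refl _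
  | succ k' _ ih =>
    obtain ⟨-, -, o, h3, -⟩ := Batch.foldl_congr X (r.blockAt X k').toList (r.ledger X k')
      (r.ledger X k') rfl rfl
    refine List.Subset.trans ih ?_
    rw [ledger, h3]
    exact List.subset_append_left _ _

/-- A transaction occurs once in the ledger, hence with one set of created objects. -/
theorem ledger_unique (X : M.RA) {k k' : ℕ} {x : M.Trans} {c c' : Set (M.UA × M.Obj)}
    (h : (x, c) ∈ (r.ledger X k).out) (h' : (x, c') ∈ (r.ledger X k').out) : c = c' :=
  (r.ledger_regular X (max k k')).created_unique (r.ledger_out_mono X (le_max_left _ _) h)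
    (r.ledger_out_mono X (le_max_right _ _) h')

variable {r}

section Ledger

variable (hr : r.Admissible)
include hr

theorem Admissible.blockAt_eq {t : ℕ} {V : M.Val} {X : M.RA} {k : ℕ} {B : M.Block}
    (hV : M.Honest V) (h : ((r.state t).ra V X).decided k = some B) : r.blockAt X k = B := by
  have hex : ∃ B V t, M.Honest V ∧ ((r.state t).ra V X).decided k = some B := ⟨B, V, t, hV, h⟩
  obtain ⟨W, t', hW, h'⟩ := hex.choose_spec
  unfold blockAt
  rw [dif_pos hex]
  exact hr.decided_unique hW hV h' h

/-- The block executed next is the common block of that instance, and execution is a function of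
state and log. -/
theorem Admissible.ledger_spec (t : ℕ) : ∀ V X,
    ((r.state t).ra V X).st = (r.ledger X ((r.state t).ra V X).inst).st ∧
    ((r.state t).ra V X).log = (r.ledger X ((r.state t).ra V X).inst).log := by
  refine hr.exec.invariant (P := fun s => ∀ V X,
    (s.ra V X).st = (r.ledger X (s.ra V X).inst).st ∧
    (s.ra V X).log = (r.ledger X (s.ra V X).inst).log) ?_ ?_ t
  · intro V X; exact ⟨rfl, rfl⟩
  · intro t l _ hs ih V X
    rcases hs.inst_cases V X with ⟨h1, h2, h3⟩ | ⟨B, hV, -, hB, -, h1, h2, h3⟩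
    · rw [h1, h2, h3]; exact ih V X
    · rw [h1, h2, h3, ledger, hr.blockAt_eq hV hB]
      obtain ⟨h4, h5, -⟩ := Batch.foldl_congr X B.toList
        { st := ((r.state t).ra V X).st, log := ((r.state t).ra V X).log, out := [], emitted := [] }
        (r.ledger X ((r.state t).ra V X).inst) (ih V X).1 (ih V X).2
      exact ⟨h4, h5⟩

theorem Admissible.runBlock_out {t : ℕ} {V : M.Val} {X : M.RA} {B : M.Block} (hV : M.Honest V)
    (hB : ((r.state t).ra V X).decided ((r.state t).ra V X).inst = some B) :
    (r.ledger X (((r.state t).ra V X).inst + 1)).out =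
      (r.ledger X ((r.state t).ra V X).inst).out ++ (((r.state t).ra V X).runBlock X B).out := by
  obtain ⟨h1, h2⟩ := hr.ledger_spec t V X
  obtain ⟨-, -, o, h4, h5⟩ := Batch.foldl_congr X B.toList
    { st := ((r.state t).ra V X).st, log := ((r.state t).ra V X).log, out := [], emitted := [] }
    (r.ledger X ((r.state t).ra V X).inst) h1 h2
  rw [ledger, hr.blockAt_eq hV hB, h5]
  unfold RAEntity.runBlock
  rw [h4, List.nil_append]

theorem Admissible.raLog_spec (t : ℕ) : ∀ V X x, x ∈ ((r.state t).ra V X).log →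
    x.recipient = some X ∧
      ∀ tx : M.UTx, x = .user tx → (r.state t).Certified tx ∧ r.Emitted tx := by
  refine hr.exec.invariant (P := fun s => ∀ V X x, x ∈ (s.ra V X).log →
    x.recipient = some X ∧
      ∀ tx : M.UTx, x = .user tx → s.Certified tx ∧ r.Emitted tx) ?_ ?_ t
  · intro V X x h; simp [State.init] at h
  · intro t l _ hs ih V X x h
    have key : x.recipient = some X ∧
        ∀ tx : M.UTx, x = .user tx → (r.state t).Certified tx ∧ r.Emitted tx := by
      rcases hs.inst_cases V X with ⟨-, -, h3⟩ | ⟨B, hV, -, hB, -, -, -, h3⟩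
      · exact ih V X x (h3 ▸ h)
      · rw [h3] at h
        rcases Batch.mem_foldl_log h with h | h
        · exact ih V X x h
        · exact hr.decided_mem hV hB (Finset.mem_toList.1 h)
    exact ⟨key.1, fun tx htx => (key.2 tx htx).imp_left hs.extends.certified⟩

end Ledger

end Run

theorem Step.inst_execBlock {s s' : State M} {V : M.Val} {X : M.RA} (h : Step (.execBlock V X) s s') :
    (s'.ra V X).inst = (s.ra V X).inst + 1 := by
  cases h
  simp [State.execBlock, State.toPools]

/-! ### Bookkeeping of decisions, queues and log at `V.A`. -/

namespace Run

variable {r : Run M}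

/-- What holds for the transactions that pass through `V.A`. -/
structure Tracked (r : Run M) (s : State M) (V : M.Val) (A : M.UA) : Prop where
  pob : ∀ sn tx, (s.ua V A).pobDecided sn = some tx → tx.sender = A ∧ tx.sn = sn ∧
    (tx ∈ (s.ua V A).proofs ∨ (s.ua V A).taDecided sn = some (some tx))
  pending : ∀ tx ∈ (s.ua V A).pending, (s.ua V A).pobDecided tx.sn = some tx ∧
    (tx.recipient = none → tx ∉ (s.ua V A).log)
  decided : ∀ sn tx, (s.ua V A).pobDecided sn = some tx → tx.recipient = none →
    tx ∈ (s.ua V A).pending ∨ tx ∈ (s.ua V A).log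
  inbox : ∀ m ∈ (s.ua V A).inbox, m.1.sender = A ∧ m.1 ∉ (s.ua V A).log ∧
    ∃ X, m.1.recipient = some X ∧ (Tx.user m.1, m.2) ∈ (r.ledger X (s.ra V X).inst).out
  log : ∀ tx ∈ (s.ua V A).log, tx.sender = A ∧ s.Certified tx ∧ r.Emitted tx ∧
    (tx.recipient = none → (s.ua V A).pobDecided tx.sn = some tx) ∧
    (∀ X, tx.recipient = some X → Tx.user tx ∈ (s.ra V X).log)
  nodup : (s.ua V A).log.Nodup
  prev : ∀ tx ∈ (s.ua V A).log, ∀ m, tx.sn = m + 1 → (s.ua V A).Executed m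

variable (hr : r.Admissible)
include hr

theorem Admissible.certified_of_pob {t : ℕ} {V : M.Val} {A : M.UA} {sn : ℕ} {tx : M.UTx}
    (hV : M.Honest V) (hA : tx.sender = A) (hsn : tx.sn = sn)
    (h : tx ∈ ((r.state t).ua V A).proofs ∨ ((r.state t).ua V A).taDecided sn = some (some tx)) :
    (r.state t).Certified tx := by
  subst hA hsn
  rcases h with h | h
  · exact hr.certified_of_pobProof (hr.exec.proofs_spec t V _ tx h).2
  · exact .inr ⟨V, hV, h⟩

/-- The clauses support each other: the log stays free of repetitions because queued transactions
are not in it, and they are not queued again because a slot is POB-decided once and `V.X` executes a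
transaction once. -/
theorem Admissible.tracked {V : M.Val} (hV : M.Honest V) (t : ℕ) :
    ∀ A, r.Tracked (r.state t) V A := by
  refine hr.exec.invariant (P := fun s => ∀ A, r.Tracked s V A) ?_ ?_ t
  · intro A
    constructor <;> simp [State.init]
  · intro t l _ hs ih A
    have hext := hs.extends
    have I := ih A
    have hinst : ∀ X, ((r.state t).ra V X).inst ≤ ((r.state (t + 1)).ra V X).inst :=
      fun X => (hext.ra V X).inst
    have oldpob : ∀ sn tx, ((r.state t).ua V A).pobDecided sn = some tx → tx.sender = A ∧ tx.sn = sn ∧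
        (tx ∈ ((r.state (t + 1)).ua V A).proofs ∨
          ((r.state (t + 1)).ua V A).taDecided sn = some (some tx)) := fun sn tx h => by
      obtain ⟨h1, h2, h3⟩ := I.pob sn tx h
      exact ⟨h1, h2, h3.imp (fun h => (hext.ua V A).proofs h) ((hext.ua V A).taDecided _ _)⟩
    have oldlog : ∀ tx ∈ ((r.state t).ua V A).log, tx.sender = A ∧ (r.state (t + 1)).Certified tx ∧
        r.Emitted tx ∧
        (tx.recipient = none → ((r.state (t + 1)).ua V A).pobDecided tx.sn = some tx) ∧
        (∀ X, tx.recipient = some X → Tx.user tx ∈ ((r.state (t + 1)).ra V X).log) :=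
      fun tx htx => by
        obtain ⟨h1, h2, h3, h4, h5⟩ := I.log tx htx
        exact ⟨h1, hext.certified h2, h3, fun h => (hext.ua V A).pobDecided _ _ (h4 h),
          fun X hX => (hext.ra V X).log (h5 X hX)⟩
    have oldinbox : ∀ m ∈ ((r.state t).ua V A).inbox, m.1.sender = A ∧
        ∃ X, m.1.recipient = some X ∧
          (Tx.user m.1, m.2) ∈ (r.ledger X ((r.state (t + 1)).ra V X).inst).out := fun m hm => by
      obtain ⟨h1, -, X, h2, h3⟩ := I.inbox m hm
      exact ⟨h1, X, h2, r.ledger_out_mono X (hinst X) h3⟩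
    have newinbox : ((r.state (t + 1)).ua V A).log = ((r.state t).ua V A).log →
        ∀ m ∈ ((r.state (t + 1)).ua V A).inbox,
        m.1.sender = A ∧ m.1 ∉ ((r.state (t + 1)).ua V A).log ∧ ∃ X, m.1.recipient = some X ∧
          (Tx.user m.1, m.2) ∈ (r.ledger X ((r.state (t + 1)).ra V X).inst).out := by
      intro hlog m hm
      rcases hs.inbox_cases hm with hm | ⟨h1, X, B, rfl, hB, h2⟩
      · obtain ⟨h1, h2⟩ := oldinbox m hm
        exact ⟨h1, by rw [hlog]; exact (I.inbox m hm).2.1, h2⟩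
      · have hout := hr.runBlock_out hV hB
        have hreg := r.ledger_regular X (((r.state t).ra V X).inst + 1)
        have hmem : (Tx.user m.1, m.2) ∈ (r.ledger X (((r.state t).ra V X).inst + 1)).out := by
          rw [hout]; exact List.mem_append_right _ h2
        have h3 := hs.inst_execBlock
        have hrec : m.1.recipient = some X := by
          have h5 := (hr.ledger_spec (t + 1) V X).2
          rw [h3] at h5
          have h6 : Tx.user m.1 ∈ ((r.state (t + 1)).ra V X).log := by
            rw [h5]; exact hreg.mem_log.2 ⟨_, hmem⟩
          exact (hr.raLog_spec (t + 1) V X _ h6).1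
        refine ⟨h1, fun hmlog => ?_, X, hrec, by rw [h3]; exact hmem⟩
        rw [hlog] at hmlog
        -- If `V.A` had executed the transaction already, it would be in the earlier part of the
        -- ledger of `X`, and the new block would repeat it.
        have h5 := (I.log _ hmlog).2.2.2.2 X hrec
        rw [(hr.ledger_spec t V X).2, (r.ledger_regular X _).mem_log] at h5
        obtain ⟨c, hc⟩ := h5
        have hn := hreg.nodup
        rw [hreg.log_eq, hout, List.map_append] at hn
        exact (List.nodup_append.1 hn).2.2 _ (List.mem_map_of_mem hc) _ (List.mem_map_of_mem h2) rfl
    rcases hs.pob_cases V A with ⟨h1, h2, h3⟩ | ⟨tx, h0, h1, hnone, h2, h3, h4⟩ |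
      ⟨tx, _, h0, h1, hready, h3, h4⟩
    · exact
      { pob := fun sn tx h => oldpob sn tx (h1 ▸ h)
        pending := by rw [h1, h2, h3]; exact I.pending
        decided := by rw [h1, h2, h3]; exact I.decided
        inbox := newinbox h3
        log := by rw [h3]; exact oldlog
        nodup := by rw [h3]; exact I.nodup
        prev := by unfold UAEntity.Executed; rw [h3]; exact I.prev }
    · have hiss : tx ∈ (r.state t).issued := by
        rcases h4 with ⟨-, h4 | h4⟩ | h4
        · exact hr.certified_issued (hr.certified_of_pobProof
            ((hr.exec.voted_quorum h4).mono le_rfl fun W _ hW => h0.symm ▸ hW))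
        · exact hr.certified_issued (hr.certified_of_pobProof h4)
        · exact hr.certified_issued (hr.certified_of_pob hV h0 rfl (.inr h4))
      have hnew : ((r.state (t + 1)).ua V A).pobDecided tx.sn = some tx := by rw [h1]; simp
      have hcases : ∀ sn tx', ((r.state (t + 1)).ua V A).pobDecided sn = some tx' →
          (sn = tx.sn ∧ tx' = tx) ∨ ((r.state t).ua V A).pobDecided sn = some tx' := by
        intro sn tx' h
        rw [h1] at h
        by_cases hsn : sn = tx.sn
        · subst hsn; exact .inl ⟨rfl, by simpa using h.symm⟩
        · exact .inr (by simpa [hsn] using h)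
      exact
      { pob := fun sn tx' h => by
          rcases hcases sn tx' h with ⟨rfl, rfl⟩ | h
          · exact ⟨h0, rfl, h4.imp And.left ((hext.ua V A).taDecided _ _)⟩
          · exact oldpob sn tx' h
        pending := by
          intro tx' h
          rw [h2] at h
          rw [h3]
          rcases h with h | ⟨rfl, -⟩
          · exact (I.pending tx' h).imp_left ((hext.ua V A).pobDecided _ _)
          -- An executed UA transaction would have been POB-decided before, but the slot was still
          -- undecided.
          · exact ⟨hnew, fun hrec hl => by
              rw [(I.log _ hl).2.2.2.1 hrec] at hnone; simp at hnone⟩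
        decided := fun sn tx' h hrec => by
          rw [h2, h3]
          rcases hcases sn tx' h with ⟨rfl, rfl⟩ | h
          · exact .inl (.inr ⟨rfl, hiss⟩)
          · exact (I.decided sn tx' h hrec).imp_left .inl
        inbox := newinbox h3
        log := by rw [h3]; exact oldlog
        nodup := by rw [h3]; exact I.nodup
        prev := by unfold UAEntity.Executed; rw [h3]; exact I.prev }
    · have hkey : tx ∉ ((r.state t).ua V A).log ∧ (r.state t).Certified tx ∧
          (tx.recipient = none → ((r.state t).ua V A).pobDecided tx.sn = some tx) ∧
          (∀ X, tx.recipient = some X → Tx.user tx ∈ ((r.state t).ra V X).log) := by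
        rcases h4 with ⟨hrec, hp, -, -⟩ | ⟨-, c, hc, -, -⟩
        · obtain ⟨h5, h6⟩ := I.pending tx hp
          refine ⟨h6 hrec, ?_, fun _ => h5, fun X hX => by rw [hrec] at hX; cases hX⟩
          obtain ⟨h7, h8, h9⟩ := I.pob _ _ h5
          exact hr.certified_of_pob hV h7 h8 h9
        · obtain ⟨-, h6, X, h7, h8⟩ := I.inbox _ hc
          have h9 : Tx.user tx ∈ ((r.state t).ra V X).log := by
            rw [(hr.ledger_spec t V X).2]
            exact (r.ledger_regular X _).mem_log.2 ⟨c, h8⟩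
          refine ⟨h6, ((hr.raLog_spec t V X _ h9).2 tx rfl).1, fun h => ?_, fun Y hY => ?_⟩
          · rw [h7] at h; cases h
          · rw [h7] at hY; cases hY; exact h9
      obtain ⟨hnot, hcert, hk1, hk2⟩ := hkey
      have hem : r.Emitted tx :=
        hr.exec.emitted (hr.certified_issued hcert) hV (h0.symm ▸ hready)
      have hold : ∀ m, ((r.state t).ua V A).Executed m → ((r.state (t + 1)).ua V A).Executed m :=
        fun m ⟨y, hy, hym⟩ => ⟨y, (hext.ua V A).log hy, hym⟩
      exact
      { pob := fun sn tx h => oldpob sn tx (h1 ▸ h)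
        pending := by
          intro tx' h
          rw [h1, h3]
          rcases h4 with ⟨hrec, hp, h5, -⟩ | ⟨h5, c, hc, -, -⟩
          · rw [h5] at h
            obtain ⟨h6, h7⟩ := I.pending tx' h.1
            refine ⟨h6, fun hr' hl => ?_⟩
            rcases List.mem_append.1 hl with hl | hl
            · exact h7 hr' hl
            · exact h.2 (List.mem_singleton.1 hl)
          · rw [h5] at h
            obtain ⟨h6, h7⟩ := I.pending tx' h
            refine ⟨h6, fun hr' hl => ?_⟩
            rcases List.mem_append.1 hl with hl | hl
            · exact h7 hr' hl
            · obtain ⟨-, -, X, h8, -⟩ := I.inbox _ hc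
              rw [List.mem_singleton.1 hl] at hr'
              rw [hr'] at h8; cases h8
        decided := fun sn tx' h hrec => by
          rw [h1] at h
          rw [h3]
          rcases I.decided sn tx' h hrec with h | h
          · by_cases he : tx' = tx
            · exact .inr (by simp [he])
            · left
              rcases h4 with ⟨-, -, h5, -⟩ | ⟨h5, -⟩
              · rw [h5]; exact ⟨h, he⟩
              · rw [h5]; exact h
          · exact .inr (List.mem_append_left _ h)
        inbox := fun m hm => by
          -- No message about `tx` survives its execution: a UA transaction has none, and all
          -- messages about a UA-RA transaction carry the same effects and thus equal the removed
          -- one.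
          have hm' : m ∈ ((r.state t).ua V A).inbox ∧ m.1 ≠ tx := by
            rcases h4 with ⟨hrec, -, -, rfl⟩ | ⟨-, c, hc, h5, rfl⟩
            · rcases hs.inbox_cases hm with h | ⟨-, X, B, h, -⟩
              · refine ⟨h, fun he => ?_⟩
                obtain ⟨-, -, X, h8, -⟩ := I.inbox _ h
                rw [he, hrec] at h8; cases h8
              · cases h
            · rw [h5] at hm
              refine ⟨hm.1, fun he => hm.2 ?_⟩
              obtain ⟨-, -, X, h8, h9⟩ := I.inbox _ hm.1
              obtain ⟨-, -, X', h8', h9'⟩ := I.inbox _ hc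
              rw [he] at h8 h9
              rw [h8] at h8'
              cases h8'
              exact Prod.ext he (r.ledger_unique X h9 h9')
          obtain ⟨h5, h6⟩ := oldinbox m hm'.1
          refine ⟨h5, fun hl => ?_, h6⟩
          rw [h3] at hl
          rcases List.mem_append.1 hl with hl | hl
          · exact (I.inbox m hm'.1).2.1 hl
          · exact hm'.2 (List.mem_singleton.1 hl)
        log := by
          intro tx' h
          rw [h3] at h
          rcases List.mem_append.1 h with h | h
          · exact oldlog tx' h
          · obtain rfl := List.mem_singleton.1 h
            exact ⟨h0, hext.certified hcert, hem, fun hrec => h1 ▸ hk1 hrec,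
              fun X hX => (hext.ra V X).log (hk2 X hX)⟩
        nodup := by
          rw [h3]
          exact List.nodup_append.2 ⟨I.nodup, List.nodup_singleton _, fun y hy z hz he =>
            hnot (List.mem_singleton.1 hz ▸ he ▸ hy)⟩
        prev := by
          intro tx' h m hm
          rw [h3] at h
          rcases List.mem_append.1 h with h | h
          · exact hold m (I.prev tx' h m hm)
          · obtain rfl := List.mem_singleton.1 h
            exact hold m (hready.1 m hm) }

/-! ### Integrity and agreement -/

theorem Admissible.certified_of_executes {V : M.Val} (hV : M.Honest V) {tx : M.UTx}
    (h : r.Executes V tx) : r.Emitted tx ∧ ∃ t, (r.state t).Certified tx := by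
  rcases h with ⟨A, t, h⟩ | ⟨X, t, h⟩
  · obtain ⟨-, h1, h2, -⟩ := (hr.tracked hV t A).log tx h
    exact ⟨h2, t, h1⟩
  · obtain ⟨h1, h2⟩ := (hr.raLog_spec t V X _ h).2 tx rfl
    exact ⟨h2, t, h1⟩

theorem Admissible.executesAtMostOnce {V : M.Val} (hV : M.Honest V) (tx : M.UTx) :
    r.ExecutesAtMostOnce V tx := by
  refine ⟨fun A ⟨t, h⟩ => ((hr.tracked hV t A).log tx h).1.symm,
    fun X ⟨t, h⟩ => (hr.raLog_spec t V X _ h).1, fun t => ⟨fun A => ?_, fun X => ?_⟩⟩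
  · exact List.nodup_iff_count_le_one.1 (hr.tracked hV t A).nodup tx
  · refine List.nodup_iff_count_le_one.1 ?_ _
    rw [(hr.ledger_spec t V X).2]
    exact (r.ledger_regular X _).nodup

theorem Admissible.agreement {V W : M.Val} (hV : M.Honest V) (hW : M.Honest W) {tx₁ tx₂ : M.UTx}
    (h₁ : r.Executes V tx₁) (h₂ : r.Executes W tx₂) (hA : tx₁.sender = tx₂.sender)
    (hsn : tx₁.sn = tx₂.sn) : tx₁ = tx₂ := by
  obtain ⟨-, t₁, h1⟩ := hr.certified_of_executes hV h₁
  obtain ⟨-, t₂, h2⟩ := hr.certified_of_executes hW h₂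
  exact hr.certified_unique h1 h2 hA hsn

end Run

/-! ### Ownership of objects -/

set_option linter.unusedSimpArgs false in
/-- How executions at `V` change the owned objects. -/
theorem Step.owned_cases {l : Label M} {s s' : State M} (h : Step l s s') (V : M.Val) :
    ((∀ A, (s'.ua V A).owned = (s.ua V A).owned ∧ (s'.ua V A).log = (s.ua V A).log) ∧
      ∀ X, (s'.ra V X).inst = (s.ra V X).inst) ∨
    (∃ tx c, ((c = M.runUA tx ∧ tx.recipient = none ∧ tx ∈ (s.ua V tx.sender).pending) ∨
        (tx, c) ∈ (s.ua V tx.sender).inbox) ∧ (s.ua V tx.sender).Ready tx ∧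
      (∀ A, (s'.ua V A).log = (if A = tx.sender then (s.ua V A).log ++ [tx] else (s.ua V A).log) ∧
        (s'.ua V A).owned = (if A = tx.sender then (s.ua V A).owned \ {o | o ∈ tx.consumed}
          else (s.ua V A).owned) ∪ {o | (A, o) ∈ c}) ∧
      ∀ X, (s'.ra V X).inst = (s.ra V X).inst) ∨
    (∃ X B, M.Honest V ∧ (s.ra V X).decided (s.ra V X).inst = some B ∧
      (∀ A, (s'.ua V A).log = (s.ua V A).log ∧ (s'.ua V A).owned = (s.ua V A).owned ∪
        {o | (A, o) ∈ createdByReactive ((s.ra V X).runBlock X B).out}) ∧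
      ∀ Y, (s'.ra V Y).inst = if Y = X then (s.ra V Y).inst + 1 else (s.ra V Y).inst) := by
  cases h with
  | execUA _ V' tx e hV he hp hrec hR =>
    subst he
    by_cases hv : V = V'
    · subst hv
      refine .inr (.inl ⟨tx, _, .inl ⟨rfl, hrec, hp⟩, hR, fun A => ?_, fun X => rfl⟩)
      by_cases hA : A = tx.sender
      · subst hA; simp [State.grant, UAEntity.execute]
      · simp [State.grant, State.setUA_ua, hA]
    · left; exact ⟨fun A => by simp [State.grant, State.setUA_ua, hv], fun X => rfl⟩
  | execUARA _ V' tx c e hV he hp hR =>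
    subst he
    by_cases hv : V = V'
    · subst hv
      refine .inr (.inl ⟨tx, c, .inr hp, hR, fun A => ?_, fun X => rfl⟩)
      by_cases hA : A = tx.sender
      · subst hA; simp [State.grant, UAEntity.execute]
      · simp [State.grant, State.setUA_ua, hA]
    · left; exact ⟨fun A => by simp [State.grant, State.setUA_ua, hv], fun X => rfl⟩
  | execBlock _ V' X B hV hB =>
    by_cases hv : V = V'
    · subst hv
      refine .inr (.inr ⟨X, B, hV, hB, fun A => ?_, fun Y => ?_⟩)
      · simp [State.execBlock, State.grant, State.report]
      · by_cases hY : Y = X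
        · subst hY; simp [State.execBlock, State.toPools]
        · simp [State.execBlock, State.toPools, State.setRA_ra, hY]
    · left
      exact ⟨fun A => by simp [State.execBlock, State.grant, State.report, hv],
        fun Y => by simp [State.execBlock, State.toPools, State.setRA_ra, hv]⟩
  | _ =>
    try subst ‹_ = s.ra _ _›
    subst_vars
    left
    refine ⟨fun A => ⟨?_, ?_⟩, fun X => ?_⟩ <;>
    first
    | rfl
    | (simp only [State.setUA, State.setRA, State.toPools, RAEntity.decide,
        UAEntity.tryFPLock, UAEntity.trySPLock, UAEntity.proposeTA, UAEntity.pobDecide]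
       split_ifs <;> first | rfl | (casesm* _ ∧ _; subst_vars; rfl))

namespace Run

variable {r : Run M}

/-- The entities of `V` have executed `x`, and the created objects `C` have been handed out. -/
def Handed (r : Run M) (s : State M) (V : M.Val) : M.Trans → Set (M.UA × M.Obj) → Prop
  | .user tx, C => tx ∈ (s.ua V tx.sender).log ∧ (tx.recipient = none → C = M.runUA tx) ∧
      ∀ X, tx.recipient = some X → (Tx.user tx, C) ∈ (r.ledger X (s.ra V X).inst).out
  | .reactive ρ, C => (Tx.reactive ρ, C) ∈ (r.ledger ρ.recipient (s.ra V ρ.recipient).inst).out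

/-- The object `o` has been handed to `V.A`, or `A` has it from the beginning. -/
def Obtained (r : Run M) (s : State M) (V : M.Val) (A : M.UA) (o : M.Obj) : Prop :=
  o ∈ M.genesis A ∨ ∃ x C, r.Handed s V x C ∧ (A, o) ∈ C

theorem Handed.origin {s : State M} {V : M.Val} {x : M.Trans} {C : Set (M.UA × M.Obj)}
    (h : r.Handed s V x C) {c : M.UA × M.Obj} (hc : c ∈ C) : M.origin c.2 = some x := by
  cases x with
  | user tx =>
    obtain ⟨-, h1, h2⟩ := h
    cases hrec : tx.recipient with
    | none => rw [h1 hrec] at hc; exact M.origin_runUA tx c hc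
    | some X => exact (r.ledger_regular X _).origin _ (h2 X hrec) c hc
  | reactive ρ => exact (r.ledger_regular _ _).origin _ h c hc

variable (hr : r.Admissible)
include hr

/-- `N` collects what the step newly hands out. It gives a uniform account of the three kinds of
execution and is empty for all other steps; its freshness is what prevents an object from
reappearing. -/
theorem Admissible.handed_step {V : M.Val} (hV : M.Honest V) {t : ℕ} {l : Label M}
    (hs : Step l (r.state t) (r.state (t + 1))) :
    ∃ N : M.Trans → Set (M.UA × M.Obj) → Prop,
      (∀ x C, r.Handed (r.state (t + 1)) V x C ↔ r.Handed (r.state t) V x C ∨ N x C) ∧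
      (∀ x C C', N x C → ¬ r.Handed (r.state t) V x C') ∧
      ∀ A, (∀ o, o ∈ ((r.state (t + 1)).ua V A).owned ↔
          (o ∈ ((r.state t).ua V A).owned ∧ ∀ tx ∈ ((r.state (t + 1)).ua V A).log,
            tx ∉ ((r.state t).ua V A).log → o ∉ tx.consumed) ∨ ∃ x C, N x C ∧ (A, o) ∈ C) ∧
        ∀ tx ∈ ((r.state (t + 1)).ua V A).log, tx ∉ ((r.state t).ua V A).log →
          ((r.state t).ua V A).Ready tx := by
  rcases hs.owned_cases V with ⟨h1, h2⟩ | ⟨tx, c, hc, hR, h1, h2⟩ | ⟨X, B, -, hB, h1, h2⟩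
  · refine ⟨fun _ _ => False, fun x C => ?_, fun _ _ _ h => h.elim, fun A => ⟨fun o => ?_, ?_⟩⟩
    · cases x <;> simp only [Handed, h1, h2, or_false]
    · rw [(h1 A).1, (h1 A).2]
      simp only [false_and, exists_false, or_false, iff_self_and]
      exact fun _ tx htx h => absurd htx h
    · rw [(h1 A).2]; exact fun tx htx h => absurd htx h
  · have hT := hr.tracked hV t tx.sender
    have hnot : tx ∉ ((r.state t).ua V tx.sender).log := by
      rcases hc with ⟨-, hrec, hp⟩ | hi
      · exact (hT.pending tx hp).2 hrec
      · exact (hT.inbox _ hi).2.1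
    have hC : ∀ C, ((tx.recipient = none → C = M.runUA tx) ∧ ∀ X, tx.recipient = some X →
        (Tx.user tx, C) ∈ (r.ledger X ((r.state t).ra V X).inst).out) ↔ C = c := by
      intro C
      rcases hc with ⟨rfl, hrec, -⟩ | hi
      · simp [hrec]
      · obtain ⟨-, -, X, hX, hX'⟩ := hT.inbox _ hi
        refine ⟨fun h => r.ledger_unique X (h.2 X hX) hX', ?_⟩
        rintro rfl
        refine ⟨fun h => (by rw [hX] at h; cases h), fun Y hY => ?_⟩
        rw [hX] at hY; cases hY; exact hX'
    have hlog : ∀ tx' : M.UTx, tx' ∈ ((r.state (t + 1)).ua V tx'.sender).log ↔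
        tx' ∈ ((r.state t).ua V tx'.sender).log ∨ tx' = tx := by
      intro tx'
      rw [(h1 tx'.sender).1]
      split_ifs with hA
      · simp
      · exact ⟨.inl, fun h => h.resolve_right fun he => hA (by rw [he])⟩
    refine ⟨fun x C => x = .user tx ∧ C = c, fun x C => ?_, ?_, fun A => ⟨fun o => ?_, ?_⟩⟩
    · cases x with
      | user tx' =>
        simp only [Handed, h2, hlog, Tx.user.injEq]
        rw [or_and_right]
        refine or_congr_right (and_congr_right fun he => ?_)
        subst he
        exact hC C
      | reactive ρ => simp [Handed, h2]
    · rintro x C C' ⟨rfl, -⟩ h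
      exact hnot h.1
    · rw [(h1 A).1, (h1 A).2]
      have hex : (∃ x C, (x = Tx.user tx ∧ C = c) ∧ (A, o) ∈ C) ↔ (A, o) ∈ c :=
        ⟨fun ⟨_, _, ⟨_, h⟩, h'⟩ => h ▸ h', fun h => ⟨_, _, ⟨rfl, rfl⟩, h⟩⟩
      rw [hex]
      refine or_congr_left ?_
      split_ifs with hA
      · subst hA
        refine and_congr_right fun _ => ⟨fun h tx' h' hn => ?_, fun h => h tx (by simp) hnot⟩
        rcases List.mem_append.1 h' with h' | h'
        · exact absurd h' hn
        · rw [List.mem_singleton.1 h']; exact h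
      · exact ⟨fun h => ⟨h, fun tx' h' hn => absurd h' hn⟩, And.left⟩
    · rw [(h1 A).1]
      split_ifs with hA
      · subst hA
        intro tx' h' hn
        rcases List.mem_append.1 h' with h' | h'
        · exact absurd h' hn
        · rw [List.mem_singleton.1 h']; exact hR
      · exact fun tx' h' hn => absurd h' hn
  · have hout := hr.runBlock_out hV hB
    have hreg := r.ledger_regular X (((r.state t).ra V X).inst + 1)
    have hrec : ∀ x C, (x, C) ∈ (((r.state t).ra V X).runBlock X B).out → x.recipient = some X := by
      intro x C hx
      refine (hr.raLog_spec (t + 1) V X x ?_).1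
      rw [(hr.ledger_spec (t + 1) V X).2, h2 X, if_pos rfl]
      exact hreg.mem_log.2 ⟨C, hout ▸ List.mem_append_right _ hx⟩
    -- Objects created by user transactions of the block are not handed out yet; that happens when
    -- their senders execute them.
    refine ⟨fun x C => (x, C) ∈ (((r.state t).ra V X).runBlock X B).out ∧ ∃ ρ, x = .reactive ρ,
      fun x C => ?_, ?_, fun A => ⟨fun o => ?_, ?_⟩⟩
    · cases x with
      | user tx =>
        simp only [Handed, h1, reduceCtorEq, exists_false, and_false, or_false]
        refine and_congr_right fun htx => and_congr_right fun _ => forall_congr' fun Y =>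
          forall_congr' fun hY => ?_
        -- A transaction in the log of `V.A` was already in the shorter ledger, with the same
        -- effects, so extending the ledger hands out nothing new for it.
        refine ⟨fun h => ?_, fun h => r.ledger_out_mono Y (by rw [h2 Y]; split_ifs <;> omega) h⟩
        have h5 := ((hr.tracked hV t _).log tx htx).2.2.2.2 Y hY
        rw [(hr.ledger_spec t V Y).2] at h5
        obtain ⟨c, hc⟩ := (r.ledger_regular Y _).mem_log.1 h5
        rwa [r.ledger_unique Y h hc]
      | reactive ρ =>
        simp only [Handed, h2, Tx.reactive.injEq, exists_eq', and_true]
        by_cases hρ : ρ.recipient = X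
        · subst hρ
          rw [if_pos rfl, hout, List.mem_append]
        · rw [if_neg hρ]
          refine ⟨.inl, fun h => h.resolve_right fun h => hρ ?_⟩
          exact Option.some.inj (hrec _ _ h)
    · rintro x C C' ⟨hx, ρ, rfl⟩ h
      have hρ : ρ.recipient = X := Option.some.inj (hrec _ _ hx)
      subst hρ
      have hn := hreg.nodup
      rw [hreg.log_eq, hout, List.map_append] at hn
      exact (List.nodup_append.1 hn).2.2 _ (List.mem_map_of_mem h) _ (List.mem_map_of_mem hx) rfl
    · rw [(h1 A).1, (h1 A).2]
      refine or_congr ⟨fun h => ⟨h, fun tx' h' hn => absurd h' hn⟩, And.left⟩ ?_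
      constructor
      · rintro ⟨ρ, C, h3, h4⟩; exact ⟨_, C, ⟨h3, ρ, rfl⟩, h4⟩
      · rintro ⟨_, C, ⟨h3, ρ, rfl⟩, h4⟩; exact ⟨ρ, C, h3, h4⟩
    · rw [(h1 A).1]; exact fun tx' h' hn => absurd h' hn

/-- `V.A` owns the objects that it has obtained and not consumed. -/
theorem Admissible.owned_spec {V : M.Val} (hV : M.Honest V) (t : ℕ) : ∀ A,
    (∀ o, o ∈ ((r.state t).ua V A).owned ↔ r.Obtained (r.state t) V A o ∧
      ∀ tx ∈ ((r.state t).ua V A).log, o ∉ tx.consumed) ∧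
    ∀ tx ∈ ((r.state t).ua V A).log, ∀ o ∈ tx.consumed, r.Obtained (r.state t) V A o := by
  refine hr.exec.invariant (P := fun s => ∀ A,
    (∀ o, o ∈ (s.ua V A).owned ↔ r.Obtained s V A o ∧ ∀ tx ∈ (s.ua V A).log, o ∉ tx.consumed) ∧
    ∀ tx ∈ (s.ua V A).log, ∀ o ∈ tx.consumed, r.Obtained s V A o) ?_ ?_ t
  · intro A
    refine ⟨fun o => ?_, fun tx htx => by simp [State.init] at htx⟩
    simp only [State.init, Obtained, List.not_mem_nil, false_implies, implies_true, and_true,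
      iff_self_or]
    rintro ⟨x, C, h, -⟩
    cases x with
    | user tx => exact absurd h.1 (by simp)
    | reactive ρ => simp [Handed, ledger] at h
  · intro t l _ hs ih A
    obtain ⟨N, hN, hfresh, hA⟩ := hr.handed_step hV hs
    obtain ⟨howned, hready⟩ := hA A
    obtain ⟨ih1, ih2⟩ := ih A
    have hob : ∀ o, r.Obtained (r.state (t + 1)) V A o ↔
        r.Obtained (r.state t) V A o ∨ ∃ x C, N x C ∧ (A, o) ∈ C := by
      intro o
      unfold Obtained
      simp only [hN, or_and_right, exists_or, or_assoc]
    -- An object names its creator: an initial object has none, and the creator of a new object had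
    -- handed out nothing before.
    have hnew : ∀ o, (∃ x C, N x C ∧ (A, o) ∈ C) → ¬ r.Obtained (r.state t) V A o := by
      rintro o ⟨x, C, h1, h2⟩ (h3 | ⟨x', C', h3, h4⟩)
      · have h5 := Handed.origin ((hN x C).2 (.inr h1)) h2
        rw [M.origin_genesis A o h3] at h5
        cases h5
      · have h5 := Handed.origin ((hN x C).2 (.inr h1)) h2
        rw [h3.origin h4] at h5
        cases h5
        exact hfresh _ _ _ h1 h3
    -- Even a transaction executed in this very step consumes only objects obtained before it. Hence
    -- no executed transaction has consumed a new object.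
    have hcons : ∀ tx ∈ ((r.state (t + 1)).ua V A).log, ∀ o ∈ tx.consumed,
        r.Obtained (r.state t) V A o := by
      intro tx htx o ho
      by_cases hold : tx ∈ ((r.state t).ua V A).log
      · exact ih2 tx hold o ho
      · exact ((ih1 o).1 ((hready tx htx hold).2 o ho)).1
    refine ⟨fun o => ?_, fun tx htx o ho => (hob o).2 (.inl (hcons tx htx o ho))⟩
    rw [howned, ih1, hob]
    constructor
    · rintro (⟨⟨h1, h2⟩, h3⟩ | h1)
      · refine ⟨.inl h1, fun tx htx => ?_⟩
        by_cases hold : tx ∈ ((r.state t).ua V A).log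
        · exact h2 tx hold
        · exact h3 tx htx hold
      · exact ⟨.inr h1, fun tx htx ho => hnew o h1 (hcons tx htx o ho)⟩
    · rintro ⟨h1 | h1, h2⟩
      · exact .inl ⟨⟨h1, fun tx htx => h2 tx ((hs.extends.ua V A).log htx)⟩, fun tx htx _ => h2 tx htx⟩
      · exact .inr h1

end Run

/-! ### Fairness -/

theorem eventually_honest {P : M.Val → ℕ → Prop} (h : ∀ V, M.Honest V → ∀ᶠ t in atTop, P V t) :
    ∀ᶠ t in atTop, ∀ V, M.Honest V → P V t :=
  eventually_all.2 fun V => eventually_imp_distrib_left.2 (h V)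

theorem eventually_block {P : M.UTx → ℕ → Prop} (B : M.Block)
    (h : ∀ tx : M.UTx, Tx.user tx ∈ B → ∀ᶠ t in atTop, P tx t) :
    ∀ᶠ t in atTop, ∀ tx : M.UTx, Tx.user tx ∈ B → P tx t := by
  have h1 : ∀ᶠ t in atTop, ∀ x ∈ B, ∀ tx : M.UTx, x = .user tx → P tx t := by
    refine (eventually_all_finset B).2 fun x hx => ?_
    cases x with
    | user tx =>
      filter_upwards [h tx hx] with t ht tx' he
      cases he
      exact ht
    | reactive ρ => exact Eventually.of_forall fun t tx he => by cases he
  filter_upwards [h1] with t ht tx htx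
  exact ht _ htx tx rfl

theorem System.sub_le_count {P : M.Val → Prop} (h : ∀ W, M.Honest W → P W)
    (hbyz : M.byz.card ≤ M.f) : M.n - M.f ≤ M.count P := by
  have := M.quorum_honest.le_count fun W _ hW => h W hW
  omega

set_option linter.unusedSimpArgs false in
/-- The fast path decides when it sets the proof. -/
theorem Step.decided_of_proof {l : Label M} {s s' : State M} (h : Step l s s') (V : M.Val) (X : M.RA)
    (k : ℕ) : (s'.ra V X).proof k = (s.ra V X).proof k ∨ (s'.ra V X).decided k ≠ none := by
  cases h with
  | fastDecide _ V' X' k' B e hV he h0 hc =>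
    subst he
    by_cases hva : V = V' ∧ X = X'
    · obtain ⟨rfl, rfl⟩ := hva
      by_cases hkk : k = k'
      · subst hkk
        right
        simp only [State.setRA_self, RAEntity.decide]
        split_ifs with hd <;> simp [hd]
      · left
        simp only [State.setRA_self, RAEntity.decide]
        split_ifs <;> simp [hkk]
    · exact .inl (by simp [State.setRA_ra, hva])
  | recvProof _ V' W' X' k' B e hV he h0 hc =>
    subst he
    by_cases hva : V = V' ∧ X = X'
    · obtain ⟨rfl, rfl⟩ := hva
      by_cases hkk : k = k'
      · subst hkk
        right
        simp only [State.setRA_self, RAEntity.decide]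
        split_ifs with hd <;> simp [hd]
      · left
        simp only [State.setRA_self, RAEntity.decide]
        split_ifs <;> simp [hkk]
    · exact .inl (by simp [State.setRA_ra, hva])
  | _ =>
    try subst ‹_ = s.ra _ _›
    subst_vars
    left
    first
    | rfl
    | (simp only [State.setUA, State.setRA, State.grant, State.toPools, State.report, State.execBlock,
        RAEntity.decide]
       split_ifs <;> first | rfl | (casesm* _ ∧ _; subst_vars; rfl))

namespace Run

variable {r : Run M}

theorem IsExecution.eventually (hr : r.IsExecution) {P : State M → Prop} (t : ℕ)
    (h : ∀ s, (r.state t).Extends s → P s) : ∀ᶠ t in atTop, P (r.state t) :=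
  eventually_atTop.2 ⟨t, fun _ ht => h _ (hr.extends ht)⟩

/-- An admissible run in which events that stay possible happen. -/
structure Live (r : Run M) : Prop extends Admissible r where
  fair : r.IsFair

variable (hr : r.Live)
include hr

/-- If `Q` failed at all late times, `l` would stay enabled, hence occur, and then `Q` would hold.
The precondition `P` serves events such as `execBlock`, whose label does not name the instance that
it completes. -/
theorem Live.eventually_of_ge {l : Label M} (hl : l.Fair) {P Q : State M → Prop}
    (hQ : ∀ s s', s.Extends s' → Q s → Q s') (h : ∀ᶠ t in atTop, P (r.state t))
    (hen : ∀ᶠ t in atTop, ¬ Q (r.state t) → ∃ s', Step l (r.state t) s')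
    (hocc : ∀ s s', P s → Step l s s' → Q s') : ∀ᶠ t in atTop, Q (r.state t) := by
  obtain ⟨T, hT⟩ := eventually_atTop.1 (h.and hen)
  by_cases h : ∃ t ≥ T, Q (r.state t)
  · obtain ⟨t, -, h⟩ := h
    exact hr.exec.eventually t fun s hs => hQ _ _ hs h
  · push Not at h
    obtain ⟨t, ht, hlt⟩ := hr.fair l hl T fun t ht => (hT t ht).2 (h t ht)
    exact absurd (hocc _ _ (hT t ht).1 (hr.exec.step t l hlt)) (h (t + 1) (ht.trans (Nat.le_succ t)))

theorem Live.eventually {l : Label M} (hl : l.Fair) {Q : State M → Prop}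
    (hQ : ∀ s s', s.Extends s' → Q s → Q s')
    (hen : ∀ᶠ t in atTop, ¬ Q (r.state t) → ∃ s', Step l (r.state t) s')
    (hocc : ∀ s s', Step l s s' → Q s') : ∀ᶠ t in atTop, Q (r.state t) :=
  hr.eventually_of_ge hl hQ (P := fun _ => True) (Eventually.of_forall fun _ => trivial) hen
    fun s s' _ => hocc s s'

/-! ### Totality of Parallel Optimistic Agreement -/

omit hr in
theorem IsExecution.decided_of_proof (hr : r.IsExecution) (t : ℕ) : ∀ V X k,
    ((r.state t).ra V X).proof k ≠ none → ((r.state t).ra V X).decided k ≠ none := by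
  refine hr.invariant (P := fun s => ∀ V X k, (s.ra V X).proof k ≠ none →
    (s.ra V X).decided k ≠ none) ?_ ?_ t
  · intro V X k h; simp [State.init] at h
  · intro t l _ hs ih V X k h
    rcases hs.decided_of_proof V X k with he | h1
    · rw [he] at h
      have h1 := ih V X k h
      rwa [((hs.extends.ra V X).decided k).eq_of_ne_none h1]
    · exact h1

omit hr in
-- An instance is left only by executing its decided block.
theorem IsExecution.decided_of_lt_inst (hr : r.IsExecution) (t : ℕ) : ∀ V X k,
    k < ((r.state t).ra V X).inst → ((r.state t).ra V X).decided k ≠ none := by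
  refine hr.invariant (P := fun s => ∀ V X k, k < (s.ra V X).inst →
    (s.ra V X).decided k ≠ none) ?_ ?_ t
  · intro V X k h; simp [State.init] at h
  · intro t l _ hs ih V X k h
    have old : ((r.state t).ra V X).decided k ≠ none →
        ((r.state (t + 1)).ra V X).decided k ≠ none := fun h1 => by
      rwa [((hs.extends.ra V X).decided k).eq_of_ne_none h1]
    rcases hs.inst_cases V X with ⟨he, -⟩ | ⟨B, -, -, hB, -, h1, -⟩
    · exact old (ih V X k (he ▸ h))
    · rw [h1] at h
      rcases Nat.lt_succ_iff_lt_or_eq.1 h with h | rfl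
      · exact old (ih V X k h)
      · exact old (by rw [hB]; simp)

theorem Live.taDecided_total {t : ℕ} {V W : M.Val} {A : M.UA} {sn : ℕ} {d : Option M.UTx}
    (hV : M.Honest V) (hW : M.Honest W) (h : ((r.state t).ua V A).taDecided sn = some d) :
    ∀ᶠ t in atTop, ((r.state t).ua W A).taDecided sn = some d := by
  obtain ⟨d', t', h'⟩ := hr.ta.totality A sn V d hV ⟨t, h⟩ W hW
  obtain rfl := hr.ta.agreement A sn V W d d' hV hW ⟨t, h⟩ ⟨t', h'⟩
  exact hr.exec.eventually t' fun s hs => (hs.ua W A).taDecided _ _ h'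

theorem Live.decided_of_qcDecided {V : M.Val} (hV : M.Honest V) {X : M.RA} {k : ℕ} {B : M.Block}
    (hqc : ∀ᶠ t in atTop, ((r.state t).ra V X).qcDecided k = some B)
    (hta : ∀ᶠ t in atTop, ∀ tx : M.UTx, Tx.user tx ∈ B →
      ((r.state t).ua V tx.sender).taDecided tx.sn ≠ none) :
    ∀ᶠ t in atTop, ((r.state t).ra V X).decided k ≠ none := by
  refine hr.eventually (l := .slowDecide V X k) trivial
    (Q := fun s => (s.ra V X).decided k ≠ none) (fun s s' hs h => ?_) ?_ ?_
  · rwa [((hs.ra V X).decided k).eq_of_ne_none h]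
  · filter_upwards [hqc, hta] with t h1 h2 h3
    exact ⟨_, .slowDecide _ _ _ _ B _ hV rfl h1 (not_not.1 h3) h2⟩
  · intro s s' hs
    cases hs with
    | slowDecide _ _ _ _ B e hV he _ h0 _ =>
      subst he
      simp [RAEntity.decide, h0]

theorem Live.inst_succ {V : M.Val} (hV : M.Honest V) {X : M.RA} {k : ℕ}
    (h : ∀ᶠ t in atTop, k ≤ ((r.state t).ra V X).inst)
    (hd : ∀ᶠ t in atTop, ((r.state t).ra V X).decided k ≠ none) :
    ∀ᶠ t in atTop, k + 1 ≤ ((r.state t).ra V X).inst := by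
  refine hr.eventually_of_ge (l := .execBlock V X) trivial
    (Q := fun s => k + 1 ≤ (s.ra V X).inst) (fun s s' hs h => h.trans (hs.ra V X).inst)
    (h := h) (P := fun s => k ≤ (s.ra V X).inst) ?_ ?_
  · filter_upwards [h, hd] with t h1 h2 h3
    have h4 : ((r.state t).ra V X).inst = k := by omega
    obtain ⟨B, hB⟩ := Option.ne_none_iff_exists'.1 h2
    exact ⟨_, .execBlock _ _ _ B hV (h4.symm ▸ hB)⟩
  · intro s s' h hs
    rw [hs.inst_execBlock]
    exact Nat.succ_le_succ h

/-- A fast decision leaves a proof that `V.X` broadcasts; a slow one depends only on Quorum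
Consensus and Transaction Agreement, which decide everywhere once they decide somewhere. -/
theorem Live.decided_total {t : ℕ} {V W : M.Val} {X : M.RA} {k : ℕ} (hV : M.Honest V)
    (hW : M.Honest W) (h : ((r.state t).ra V X).decided k ≠ none) :
    ∀ᶠ t in atTop, ((r.state t).ra W X).decided k ≠ none := by
  obtain ⟨B, hB⟩ := Option.ne_none_iff_exists'.1 h
  rcases hr.decided_spec t V X k B hB with hp | ⟨B₀, h1, h2, -⟩
  · have hpr := hr.exec.proof_spec t V X k B hp
    have hev : ∀ᶠ t in atTop, ((r.state t).ra W X).proof k ≠ none := by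
      refine hr.eventually (l := .recvProof W V X k B) hV
        (Q := fun s => (s.ra W X).proof k ≠ none) (fun s s' hs h => ?_) ?_ ?_
      · rwa [((hs.ra W X).proof k).eq_of_ne_none h]
      · refine hr.exec.eventually (P := fun s => ¬ (s.ra W X).proof k ≠ none →
          ∃ s', Step (.recvProof W V X k B) s s') t fun s hs h => ?_
        exact ⟨_, .recvProof _ _ _ _ _ _ _ hW rfl (not_not.1 h) (hs.poaProof hpr)
          fun _ => (hs.ra V X).proof _ _ hp⟩
      · intro s s' hs
        cases hs with
        | recvProof _ _ _ _ _ _ e hV he h0 _ _ =>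
          subst he
          simp only [State.setRA_self, RAEntity.decide]
          split_ifs <;> simp
    filter_upwards [hev] with t' ht'
    exact hr.exec.decided_of_proof t' W X k ht'
  · obtain ⟨B', t', hB'⟩ := hr.qc.totality X k V B₀ hV ⟨t, h1⟩ W hW
    obtain rfl := hr.qc.agreement X k V W B₀ B' hV hW ⟨t, h1⟩ ⟨t', hB'⟩
    have hqc : ∀ᶠ t in atTop, ((r.state t).ra W X).qcDecided k = some B₀ :=
      hr.exec.eventually (P := fun s => (s.ra W X).qcDecided k = some B₀) t'
        fun s hs => (hs.ra W X).qcDecided _ _ hB'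
    have hta := eventually_block B₀
      (P := fun tx t => ((r.state t).ua W tx.sender).taDecided tx.sn ≠ none) fun tx htx => by
        obtain ⟨d, hd⟩ := Option.ne_none_iff_exists'.1 (h2 tx htx)
        filter_upwards [hr.taDecided_total hV hW hd] with t ht
        rw [ht]; simp
    exact hr.decided_of_qcDecided hW hqc hta

/-- Honest validators follow the one that is ahead. -/
theorem Live.inst_total {V W : M.Val} (hV : M.Honest V) (hW : M.Honest W) {t : ℕ} {X : M.RA} {k : ℕ}
    (h : k ≤ ((r.state t).ra V X).inst) : ∀ᶠ t in atTop, k ≤ ((r.state t).ra W X).inst := by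
  induction k with
  | zero => exact Eventually.of_forall fun t => Nat.zero_le _
  | succ k ih =>
    exact hr.inst_succ hW (ih (by omega))
      (hr.decided_total hV hW (hr.exec.decided_of_lt_inst t V X k h))

theorem Live.raLog_total {V W : M.Val} (hV : M.Honest V) (hW : M.Honest W) {t : ℕ} {X : M.RA}
    {x : M.Trans} (h : x ∈ ((r.state t).ra V X).log) :
    ∀ᶠ t in atTop, x ∈ ((r.state t).ra W X).log := by
  filter_upwards [hr.inst_total hV hW (le_refl ((r.state t).ra V X).inst)] with t' ht'
  rw [(hr.ledger_spec t V X).2] at h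
  rw [(hr.ledger_spec t' W X).2]
  obtain ⟨c, hc⟩ := (r.ledger_regular X _).mem_log.1 h
  exact (r.ledger_regular X _).mem_log.2 ⟨c, r.ledger_out_mono X ht' hc⟩

end Run

/-! ### The transactions that a user actor can execute -/

theorem UAEntity.Extends.executed {e e' : UAEntity M} (h : e.Extends e') {sn : ℕ}
    (hx : e.Executed sn) : e'.Executed sn :=
  hx.imp fun _ => And.imp_left fun h' => h.log h'

/-- `V.A` is ready for `tx`, or has executed a transaction with its sequence number. -/
def UAEntity.Due (e : UAEntity M) (tx : M.UTx) : Prop := e.Ready tx ∨ e.Executed tx.sn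

/-- `Executed` messages are kept until they are processed. -/
theorem Step.inbox_subset {l : Label M} {s s' : State M} (h : Step l s s') {V : M.Val} {A : M.UA}
    {m : M.UTx × Set (M.UA × M.Obj)} (hm : m ∈ (s.ua V A).inbox) :
    m ∈ (s'.ua V A).inbox ∨ m.1 ∈ (s'.ua V A).log := by
  revert hm
  cases h with
  | execUARA _ V' tx c e hV he hp hR =>
    subst he
    by_cases hva : V = V' ∧ A = tx.sender
    · obtain ⟨rfl, rfl⟩ := hva
      intro hm
      by_cases hmc : m = (tx, c)
      · subst hmc; right; simp [State.grant, UAEntity.execute]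
      · left; simp [State.grant, UAEntity.execute, hm, hmc]
    · intro hm
      left
      simp only [State.grant, State.setUA_ua, hva, if_false]
      split_ifs <;> exact hm
  | execBlock _ V' X B hV hB =>
    intro hm
    left
    simp only [State.execBlock, State.grant, State.report, State.toPools_ua, State.setRA_ua]
    split_ifs with hv
    · exact .inl hm
    · exact hm
  | _ =>
    subst_vars
    refine fun hm => Or.inl ?_
    revert hm
    first
    | exact id
    | (simp only [State.setUA, State.setRA, State.grant, State.toPools,
        UAEntity.tryFPLock, UAEntity.trySPLock, UAEntity.proposeTA, UAEntity.pobDecide, UAEntity.execute]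
       split_ifs <;> first | exact id | (casesm* _ ∧ _; subst_vars; exact id))

theorem Batch.mem_out_foldl (X : M.RA) (l : List M.Trans) (b : Batch M) {x : M.Trans}
    (h : x ∈ (l.foldl (Batch.run X) b).log) (h' : x ∉ b.log) :
    ∃ c, (x, c) ∈ (l.foldl (Batch.run X) b).out := by
  suffices H : ∀ (l : List M.Trans) (b : Batch M), (x ∈ b.log → ∃ c, (x, c) ∈ b.out) →
      x ∈ (l.foldl (Batch.run X) b).log → ∃ c, (x, c) ∈ (l.foldl (Batch.run X) b).out from
    H l b (fun hx => absurd hx h') h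
  intro l
  induction l with
  | nil => exact fun b hb => hb
  | cons a l ih =>
    refine fun b hb => ih _ fun hx => ?_
    unfold Batch.run at hx ⊢
    split_ifs at hx ⊢ with ha
    · exact hb hx
    · rcases List.mem_append.1 hx with hx | hx
      · exact (hb hx).imp fun c hc => List.mem_append_left _ hc
      · rw [List.mem_singleton] at hx
        subst hx
        exact ⟨_, List.mem_append_right _ (List.mem_singleton_self _)⟩

theorem Step.report_of_execBlock {V : M.Val} {X : M.RA} {B : M.Block} {s : State M} {tx : M.UTx}
    (h : Tx.user tx ∉ (s.ra V X).log) (h' : Tx.user tx ∈ ((s.execBlock V X B).ra V X).log) :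
    (∃ c, (tx, c) ∈ ((s.execBlock V X B).ua V tx.sender).inbox) ∨
      ((s.execBlock V X B).ua V tx.sender).Executed tx.sn := by
  have h1 : Tx.user tx ∈ ((s.ra V X).runBlock X B).log := by
    simpa [State.execBlock, State.toPools] using h'
  obtain ⟨c, hc⟩ := Batch.mem_out_foldl X B.toList _ h1 h
  by_cases hx : (s.ua V tx.sender).Executed tx.sn
  · right
    simpa [State.execBlock, State.grant, State.report, UAEntity.Executed] using hx
  · left
    refine ⟨c, ?_⟩
    simp only [State.execBlock, State.grant, State.report, State.toPools_ua, State.setRA_ua, if_true]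
    exact .inr ⟨rfl, hx, hc⟩

theorem Step.pobDecided_of_proofs {l : Label M} {s s' : State M} (h : Step l s s') (V : M.Val)
    (A : M.UA) (tx : M.UTx) : tx ∈ (s'.ua V A).proofs →
      tx ∈ (s.ua V A).proofs ∨ (s'.ua V A).pobDecided tx.sn ≠ none := by
  cases h with
  | pobFast _ V' tx' e hV he _ hc =>
    subst he
    by_cases hva : V = V' ∧ A = tx'.sender
    · obtain ⟨rfl, rfl⟩ := hva
      simp only [State.setUA_self, UAEntity.pobDecide]
      split_ifs
      rintro (rfl | ht)
      · right; simp
      · exact .inl ht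
    · simp only [State.setUA_ua, hva, if_false]; exact .inl
  | pobRecvProof _ V' W' tx' e hV he _ hc =>
    subst he
    by_cases hva : V = V' ∧ A = tx'.sender
    · obtain ⟨rfl, rfl⟩ := hva
      simp only [State.setUA_self, UAEntity.pobDecide]
      split_ifs with hd
      · rintro (rfl | ht)
        · right; simp
        · exact .inl ht
      · rintro (rfl | ht)
        · exact .inr hd
        · exact .inl ht
    · simp only [State.setUA_ua, hva, if_false]; exact .inl
  | _ =>
    subst_vars
    refine fun hm => Or.inl ?_
    revert hm
    first
    | exact id
    | (simp only [State.setUA, State.setRA, State.grant, State.toPools, State.report, State.execBlock,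
        UAEntity.tryFPLock, UAEntity.trySPLock, UAEntity.proposeTA, UAEntity.pobDecide, UAEntity.execute]
       split_ifs <;> first | exact id | (casesm* _ ∧ _; subst_vars; exact id))

namespace Run

variable {r : Run M}

section
variable (hr : r.Admissible)
include hr

theorem Admissible.executed_mono {V : M.Val} (hV : M.Honest V) {t : ℕ} {A : M.UA} {m m' : ℕ}
    (hm : m ≤ m') (h : ((r.state t).ua V A).Executed m') : ((r.state t).ua V A).Executed m := by
  induction m', hm using Nat.le_induction with
  | base => exact h
  | succ m' _ ih =>
    obtain ⟨tx, htx, hsn⟩ := h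
    exact ih ((hr.tracked hV t A).prev tx htx m' hsn)

/-- Whatever fills the slot is certified too, so it is `tx` itself. -/
theorem Admissible.mem_of_executed {V : M.Val} (hV : M.Honest V) {t t' : ℕ} {tx : M.UTx}
    (hc : (r.state t').Certified tx) (h : ((r.state t).ua V tx.sender).Executed tx.sn) :
    tx ∈ ((r.state t).ua V tx.sender).log := by
  obtain ⟨tx', htx', hsn⟩ := h
  obtain ⟨h1, h2, -⟩ := (hr.tracked hV t _).log tx' htx'
  obtain rfl := hr.certified_unique h2 hc h1 hsn
  exact htx'

/-- A report is ignored only if the slot is executed, and a message disappears only when it is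
processed. -/
theorem Admissible.reported (t : ℕ) : ∀ V X tx, M.Honest V → Tx.user tx ∈ ((r.state t).ra V X).log →
    (∃ c, (tx, c) ∈ ((r.state t).ua V tx.sender).inbox) ∨
      ((r.state t).ua V tx.sender).Executed tx.sn := by
  refine hr.exec.invariant (P := fun s => ∀ V X tx, M.Honest V → Tx.user tx ∈ (s.ra V X).log →
    (∃ c, (tx, c) ∈ (s.ua V tx.sender).inbox) ∨ (s.ua V tx.sender).Executed tx.sn) ?_ ?_ t
  · intro V X tx _ h; simp [State.init] at h
  · intro t l _ hs ih V X tx hV h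
    by_cases hold : Tx.user tx ∈ ((r.state t).ra V X).log
    · rcases ih V X tx hV hold with ⟨c, hc⟩ | hx
      · exact (hs.inbox_subset hc).imp (fun h => ⟨c, h⟩) fun h => ⟨tx, h, rfl⟩
      · exact .inr ((hs.extends.ua _ _).executed hx)
    · rcases hs.inst_cases V X with ⟨-, -, he⟩ | ⟨B, -, -, -, he, -⟩
      · exact absurd (he ▸ h) hold
      · rw [he] at h ⊢
        exact Step.report_of_execBlock hold h

end

variable (hr : r.Live)
include hr

theorem Live.executes_ua {V : M.Val} (hV : M.Honest V) {tx : M.UTx} (hrec : tx.recipient = none)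
    (hd : ∀ᶠ t in atTop, ((r.state t).ua V tx.sender).pobDecided tx.sn = some tx)
    (hdue : ∀ᶠ t in atTop, ((r.state t).ua V tx.sender).Due tx) :
    ∀ᶠ t in atTop, tx ∈ ((r.state t).ua V tx.sender).log := by
  refine hr.eventually (l := .execUA V tx) trivial (Q := fun s => tx ∈ (s.ua V tx.sender).log)
    (fun s s' hs h => (hs.ua _ _).log h) ?_ ?_
  · filter_upwards [hd, hdue] with t h1 h2 h3
    have hT := hr.tracked hV t tx.sender
    have hp := (hT.decided _ _ h1 hrec).resolve_right h3
    have hc := hr.certified_of_pob hV rfl rfl (hT.pob _ _ h1).2.2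
    have hR := h2.resolve_right fun hx => h3 (hr.mem_of_executed hV hc hx)
    exact ⟨_, .execUA _ _ _ _ hV rfl hp hrec hR⟩
  · intro s s' hs
    cases hs with
    | execUA _ _ _ e hV he _ _ _ =>
      subst he
      simp [State.grant, UAEntity.execute]

theorem Live.executes_uara {V : M.Val} (hV : M.Honest V) {tx : M.UTx} {X : M.RA}
    (hd : ∀ᶠ t in atTop, Tx.user tx ∈ ((r.state t).ra V X).log)
    (hdue : ∀ᶠ t in atTop, ((r.state t).ua V tx.sender).Due tx) :
    ∀ᶠ t in atTop, tx ∈ ((r.state t).ua V tx.sender).log := by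
  by_contra hcon
  have hnot : ∀ t, tx ∉ ((r.state t).ua V tx.sender).log := fun t ht =>
    hcon (hr.exec.eventually t fun s hs => (hs.ua V tx.sender).log ht)
  have hin : ∀ᶠ t in atTop, (∃ c, (tx, c) ∈ ((r.state t).ua V tx.sender).inbox) ∧
      ((r.state t).ua V tx.sender).Ready tx := by
    filter_upwards [hd, hdue] with t h1 h2
    have hc := ((hr.raLog_spec t V X _ h1).2 tx rfl).1
    have hx : ¬ ((r.state t).ua V tx.sender).Executed tx.sn :=
      fun hx => hnot t (hr.mem_of_executed hV hc hx)
    exact ⟨(hr.reported t V X tx hV h1).resolve_right hx, h2.resolve_right hx⟩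
  obtain ⟨T, ⟨c, hc⟩, -⟩ := hin.exists
  -- Fairness concerns one fixed label, which includes the effects. The ledger determines them, so
  -- the same event stays enabled.
  have huniq : ∀ t c', (tx, c') ∈ ((r.state t).ua V tx.sender).inbox → c' = c := fun t c' h' => by
    obtain ⟨-, -, Y, hY, h1⟩ := (hr.tracked hV t tx.sender).inbox _ h'
    obtain ⟨-, -, Z, hZ, h2⟩ := (hr.tracked hV T tx.sender).inbox _ hc
    obtain rfl : Y = Z := Option.some.inj (hY.symm.trans hZ)
    exact r.ledger_unique Y h1 h2
  refine hcon (hr.eventually (l := .execUARA V tx c) trivial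
    (Q := fun s => tx ∈ (s.ua V tx.sender).log) (fun s s' hs h => (hs.ua _ _).log h) ?_ ?_)
  · filter_upwards [hin] with t ht _
    obtain ⟨⟨c', hc'⟩, hR⟩ := ht
    obtain rfl := huniq t c' hc'
    exact ⟨_, .execUARA _ _ _ _ _ hV rfl hc' hR⟩
  · intro s s' hs
    cases hs with
    | execUARA _ _ _ _ e hV he _ _ =>
      subst he
      simp [State.grant, UAEntity.execute]

omit hr in
theorem IsExecution.pobDecided_of_proofs (hr : r.IsExecution) (t : ℕ) : ∀ V A tx,
    tx ∈ ((r.state t).ua V A).proofs → ((r.state t).ua V A).pobDecided tx.sn ≠ none := by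
  refine hr.invariant (P := fun s => ∀ V A tx, tx ∈ (s.ua V A).proofs →
    (s.ua V A).pobDecided tx.sn ≠ none) ?_ ?_ t
  · intro V A tx h; simp [State.init] at h
  · intro t l _ hs ih V A tx h
    rcases hs.pobDecided_of_proofs V A tx h with h | h
    · have h1 := ih V A tx h
      rwa [((hs.extends.ua V A).pobDecided tx.sn).eq_of_ne_none h1]
    · exact h

theorem Live.pobDecided_of_taDecided {V : M.Val} (hV : M.Honest V) {tx : M.UTx}
    (h : ∀ᶠ t in atTop, ((r.state t).ua V tx.sender).taDecided tx.sn = some (some tx)) :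
    ∀ᶠ t in atTop, ((r.state t).ua V tx.sender).pobDecided tx.sn ≠ none := by
  refine hr.eventually (l := .pobSlow V tx) trivial
    (Q := fun s => (s.ua V tx.sender).pobDecided tx.sn ≠ none) (fun s s' hs h => ?_) ?_ ?_
  · rwa [((hs.ua _ _).pobDecided _).eq_of_ne_none h]
  · filter_upwards [h] with t h1 h2
    exact ⟨_, .pobSlow _ _ _ _ hV rfl (not_not.1 h2) h1⟩
  · intro s s' hs
    cases hs with
    | pobSlow _ _ _ e hV he h0 _ =>
      subst he
      simp [UAEntity.pobDecide, h0]

/-- The broadcast proof or the Transaction Agreement decision reaches `W`, and certification leaves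
only `tx` as the decision of `W`. -/
theorem Live.pobDecided_total {V W : M.Val} (hV : M.Honest V) (hW : M.Honest W) {tx : M.UTx} {t : ℕ}
    (h : ((r.state t).ua V tx.sender).pobDecided tx.sn = some tx) :
    ∀ᶠ t in atTop, ((r.state t).ua W tx.sender).pobDecided tx.sn = some tx := by
  have h0 := ((hr.tracked hV t tx.sender).pob _ _ h).2.2
  have hc := hr.certified_of_pob hV rfl rfl h0
  suffices hs : ∀ᶠ t in atTop, ((r.state t).ua W tx.sender).pobDecided tx.sn ≠ none by
    filter_upwards [hs] with t' ht'
    obtain ⟨tx', htx'⟩ := Option.ne_none_iff_exists'.1 ht'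
    obtain ⟨h1, h2, h3⟩ := (hr.tracked hW t' tx.sender).pob _ _ htx'
    obtain rfl := hr.certified_unique (hr.certified_of_pob hW h1 h2 h3) hc h1 h2
    exact htx'
  rcases h0 with h0 | h0
  · have hpr := (hr.exec.proofs_spec t V _ tx h0).2
    have hev : ∀ᶠ t in atTop, tx ∈ ((r.state t).ua W tx.sender).proofs := by
      refine hr.eventually (l := .pobRecvProof W V tx) hV
        (Q := fun s => tx ∈ (s.ua W tx.sender).proofs) (fun s s' hs h => (hs.ua _ _).proofs h) ?_ ?_
      · refine hr.exec.eventually (P := fun s => tx ∉ (s.ua W tx.sender).proofs →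
          ∃ s', Step (.pobRecvProof W V tx) s s') t fun s hs h => ?_
        exact ⟨_, .pobRecvProof _ _ _ _ _ hW rfl h (hs.pobProof hpr)
          fun _ => (hs.ua V _).proofs h0⟩
      · intro s s' hs
        cases hs with
        | pobRecvProof _ _ _ _ e hV he _ _ _ =>
          subst he
          simp only [State.setUA_self, UAEntity.pobDecide]
          split_ifs <;> exact Set.mem_insert _ _
    filter_upwards [hev] with t' ht'
    exact hr.exec.pobDecided_of_proofs t' W _ tx ht'
  · exact hr.pobDecided_of_taDecided hW (hr.taDecided_total hV hW h0)

theorem Live.obtained_total {t : ℕ} (ih : ∀ V W tx, M.Honest V → M.Honest W →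
      tx ∈ ((r.state t).ua V tx.sender).log →
      ∀ᶠ t in atTop, tx ∈ ((r.state t).ua W tx.sender).log)
    {V W : M.Val} (hV : M.Honest V) (hW : M.Honest W) {A : M.UA} {o : M.Obj}
    (h : r.Obtained (r.state t) V A o) : ∀ᶠ t in atTop, r.Obtained (r.state t) W A o := by
  rcases h with h | ⟨x, C, h, ho⟩
  · exact Eventually.of_forall fun t => .inl h
  suffices hs : ∀ᶠ t in atTop, r.Handed (r.state t) W x C by
    filter_upwards [hs] with t' ht'
    exact .inr ⟨x, C, ht', ho⟩
  cases x with
  | user tx =>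
    obtain ⟨h1, h2, h3⟩ := h
    have h4 := ih V W tx hV hW h1
    cases hrec : tx.recipient with
    | none =>
      filter_upwards [h4] with t' h4
      exact ⟨h4, h2, fun X hX => by rw [hrec] at hX; cases hX⟩
    | some X =>
      filter_upwards [h4, hr.inst_total hV hW (le_refl ((r.state t).ra V X).inst)] with t' h4 h5
      refine ⟨h4, h2, fun Y hY => ?_⟩
      obtain rfl : X = Y := Option.some.inj (hrec.symm.trans hY)
      exact r.ledger_out_mono X h5 (h3 X hrec)
  | reactive ρ =>
    filter_upwards [hr.inst_total hV hW (le_refl ((r.state t).ra V ρ.recipient).inst)] with t' h5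
    exact r.ledger_out_mono _ h5 h

/-- The previous transaction and the objects of `tx` reach `W` because their executions do. `W` may
have executed the slot before all of this is observed, and then it is no longer ready; hence the
conclusion is `Due`. -/
theorem Live.due_total {t : ℕ} (ih : ∀ V W tx, M.Honest V → M.Honest W →
      tx ∈ ((r.state t).ua V tx.sender).log →
      ∀ᶠ t in atTop, tx ∈ ((r.state t).ua W tx.sender).log)
    {V W : M.Val} (hV : M.Honest V) (hW : M.Honest W) {tx : M.UTx}
    (h : ((r.state t).ua V tx.sender).Ready tx) :
    ∀ᶠ t in atTop, ((r.state t).ua W tx.sender).Due tx := by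
  obtain ⟨h1, h2⟩ := h
  have hprev : ∀ᶠ t in atTop, ∀ m, tx.sn = m + 1 → ((r.state t).ua W tx.sender).Executed m := by
    by_cases h0 : ∃ m, tx.sn = m + 1
    · obtain ⟨m, hm⟩ := h0
      obtain ⟨tx', h3, h4⟩ := h1 m hm
      have hs := ((hr.tracked hV t _).log tx' h3).1
      have h5 := ih V W tx' hV hW (hs ▸ h3)
      filter_upwards [h5] with t' h5 m' hm'
      obtain rfl : m' = m := by omega
      exact ⟨tx', hs ▸ h5, h4⟩
    · exact Eventually.of_forall fun t m hm => absurd ⟨m, hm⟩ h0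
  have hob : ∀ᶠ t in atTop, ∀ o ∈ tx.consumed.toFinset, r.Obtained (r.state t) W tx.sender o :=
    (eventually_all_finset _).2 fun o ho => hr.obtained_total ih hV hW
      (((hr.owned_spec hV t tx.sender).1 o).1 (h2 o (List.mem_toFinset.1 ho))).1
  filter_upwards [hprev, hob] with t' hp ho
  by_cases hx : ((r.state t').ua W tx.sender).Executed tx.sn
  · exact .inr hx
  refine .inl ⟨hp, fun o hoc => ((hr.owned_spec hW t' tx.sender).1 o).2
    ⟨ho o (List.mem_toFinset.2 hoc), fun tx' htx' => ?_⟩⟩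
  -- As the slot of `tx` is empty at `W` and slots are filled in order, everything executed at `W`
  -- has a smaller number.
  have hlt : tx'.sn < tx.sn := by
    by_contra hle
    exact hx (hr.executed_mono hW (not_lt.1 hle) ⟨tx', htx', rfl⟩)
  obtain ⟨hs, hc, -⟩ := (hr.tracked hW t' tx.sender).log tx' htx'
  -- `V`, being ready for `tx`, has filled all smaller slots, and with the same transactions. So
  -- `tx'` is executed at `V` too and cannot have consumed an object that `V.A` still owns.
  have hV' := hr.executed_mono hV (m := tx'.sn) (by omega) (h1 (tx.sn - 1) (by omega))
  exact (((hr.owned_spec hV t tx.sender).1 o).1 (h2 o hoc)).2 tx'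
    (hs ▸ hr.mem_of_executed hV hc (hs.symm ▸ hV'))

/-- Everything that an honest `V.A` has executed is executed at all honest validators. -/
theorem Live.uaLog_total (t : ℕ) : ∀ V W tx, M.Honest V → M.Honest W →
    tx ∈ ((r.state t).ua V tx.sender).log → ∀ᶠ t in atTop, tx ∈ ((r.state t).ua W tx.sender).log := by
  induction t with
  | zero => intro V W tx _ _ h; rw [hr.exec.init] at h; simp [State.init] at h
  | succ t ih =>
    intro V W tx hV hW h
    by_cases hold : tx ∈ ((r.state t).ua V tx.sender).log
    · exact ih V W tx hV hW hold
    rcases hr.exec.step' t with he | ⟨l, -, hs⟩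
    · rw [he] at h; exact absurd h hold
    obtain ⟨N, -, -, hA⟩ := hr.handed_step hV hs
    have hready := (hA tx.sender).2 tx h hold
    -- `V.A` was ready in the state before the step, so the induction hypothesis for time `t` covers
    -- all that this readiness rests on.
    have hdue := hr.due_total ih hV hW hready
    obtain ⟨-, -, -, h1, h2⟩ := (hr.tracked hV (t + 1) tx.sender).log tx h
    cases hrec : tx.recipient with
    | none => exact hr.executes_ua hW hrec (hr.pobDecided_total hV hW (h1 hrec)) hdue
    | some X => exact hr.executes_uara hW (hr.raLog_total hV hW (h2 X hrec)) hdue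

end Run

namespace Run

variable {r : Run M} (hr : r.Live)
include hr

/-! ### Progress of Parallel Optimistic Agreement -/

theorem Live.qcDecided_total {V W : M.Val} (hV : M.Honest V) (hW : M.Honest W) {t : ℕ} {X : M.RA}
    {k : ℕ} {B : M.Block} (h : ((r.state t).ra V X).qcDecided k = some B) :
    ∀ᶠ t in atTop, ((r.state t).ra W X).qcDecided k = some B := by
  obtain ⟨B', t', hB'⟩ := hr.qc.totality X k V B hV ⟨t, h⟩ W hW
  obtain rfl := hr.qc.agreement X k V W B B' hV hW ⟨t, h⟩ ⟨t', hB'⟩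
  exact hr.exec.eventually (P := fun s => (s.ra W X).qcDecided k = some B) t'
    fun s hs => (hs.ra W X).qcDecided _ _ hB'

/-- All votes of honest validators arrive. -/
theorem Live.votesFrom_ne_none {V W : M.Val} (hV : M.Honest V) (hW : M.Honest W) {X : M.RA} {k t : ℕ}
    (h : ((r.state t).ra W X).vote k ≠ none) :
    ∀ᶠ t in atTop, ((r.state t).ra V X).votesFrom k W ≠ none := by
  obtain ⟨v, hv⟩ := Option.ne_none_iff_exists'.1 h
  refine hr.eventually (l := .recvVote V W X k v) hW
    (Q := fun s => (s.ra V X).votesFrom k W ≠ none) (fun s s' hs h => ?_) ?_ ?_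
  · rwa [((hs.ra V X).votesFrom k W).eq_of_ne_none h]
  · refine hr.exec.eventually (P := fun s => ¬ (s.ra V X).votesFrom k W ≠ none →
      ∃ s', Step (.recvVote V W X k v) s s') t fun s hs h => ?_
    exact ⟨_, .recvVote _ _ _ _ _ _ _ hV rfl (not_not.1 h) fun _ => (hs.ra W X).vote _ _ hv⟩
  · intro s s' hs
    cases hs with
    | recvVote _ _ _ _ _ _ e _ he _ _ => simp

/-- The slow path ends with a proposal to Quorum Consensus. -/
theorem Live.qcProposed_of_votes {V : M.Val} (hV : M.Honest V) {X : M.RA} {k : ℕ}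
    (hinst : ∀ᶠ t in atTop, ((r.state t).ra V X).inst = k)
    (hvotes : ∀ᶠ t in atTop, M.n - M.f ≤ ((r.state t).ra V X).votesTotal k) :
    ∀ᶠ t in atTop, ((r.state t).ra V X).qcProposed k ≠ none := by
  have hstart : ∀ᶠ t in atTop, ((r.state t).ra V X).cand k ≠ none ∨
      ((r.state t).ra V X).candFb k ≠ none := by
    refine hr.eventually (l := .startSlow V X k) trivial
      (Q := fun s => (s.ra V X).cand k ≠ none ∨ (s.ra V X).candFb k ≠ none)
      (fun s s' hs h => ?_) ?_ ?_
    · refine h.imp (fun h => ?_) fun h => ?_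
      · rwa [((hs.ra V X).cand k).eq_of_ne_none h]
      · rwa [((hs.ra V X).candFb k).eq_of_ne_none h]
    · filter_upwards [hinst, hvotes] with t h1 h2 h3
      rw [not_or, not_not, not_not] at h3
      by_cases h4 : ∃ B, M.n - M.p - 2 * M.f ≤ ((r.state t).ra V X).votesFor k B
      · obtain ⟨B, h4⟩ := h4
        exact ⟨_, .startSlow_cand _ _ _ _ B _ hV rfl h1 h3.1 h3.2 h2 h4⟩
      · push Not at h4
        exact ⟨_, .startSlow_fallback _ _ _ _ _ hV rfl h1 h3.1 h3.2 h2 h4⟩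
    · intro s s' hs
      cases hs with
      | startSlow_cand => left; simp
      | startSlow_fallback => right; simp
  have hfallback : ∀ t B, ((r.state t).ra V X).candFb k = some B →
      ∀ᶠ t in atTop, ((r.state t).ra V X).qcProposed k ≠ none := by
    intro t B hB
    have hcand : ∀ᶠ t in atTop, ((r.state t).ra V X).candFb k = some B :=
      hr.exec.eventually (P := fun s => (s.ra V X).candFb k = some B) t
        fun s hs => (hs.ra V X).candFb _ _ hB
    have hrep := eventually_block B
      (P := fun tx t => ((r.state t).ra V X).replyFb k tx ≠ none) fun tx htx => by
        refine hr.eventually (l := .spLockFb V X k tx) trivial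
          (Q := fun s => (s.ra V X).replyFb k tx ≠ none) (fun s s' hs h => ?_) ?_ ?_
        · rwa [((hs.ra V X).replyFb k tx).eq_of_ne_none h]
        · filter_upwards [hcand] with t h1 h2
          exact ⟨_, .spLockFb _ _ _ _ _ B _ _ hV rfl h1 htx (not_not.1 h2) rfl⟩
        · intro s s' hs
          cases hs with
          | spLockFb => simp
    refine hr.eventually (l := .endFallback V X k) trivial
      (Q := fun s => (s.ra V X).qcProposed k ≠ none) (fun s s' hs h => ?_) ?_ ?_
    · rwa [((hs.ra V X).qcProposed k).eq_of_ne_none h]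
    · filter_upwards [hcand, hrep] with t h1 h2 h3
      exact ⟨_, .endFallback _ _ _ _ B _ hV rfl h1 (not_not.1 h3) h2⟩
    · intro s s' hs
      cases hs with
      | endFallback => simp
  -- The event `endCand` needs the fallback candidate to be unset. If that candidate ever appears,
  -- its own branch leads to a proposal; otherwise `endCand` stays enabled until there is one.
  by_cases hfb : ∃ t, ((r.state t).ra V X).candFb k ≠ none
  · obtain ⟨t, ht⟩ := hfb
    obtain ⟨B, hB⟩ := Option.ne_none_iff_exists'.1 ht
    exact hfallback t B hB
  push Not at hfb
  obtain ⟨T, hT⟩ := hstart.exists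
  obtain ⟨B, hB⟩ := Option.ne_none_iff_exists'.1 (hT.resolve_right fun h => h (hfb T))
  have hcand : ∀ᶠ t in atTop, ((r.state t).ra V X).cand k = some B :=
    hr.exec.eventually (P := fun s => (s.ra V X).cand k = some B) T
      fun s hs => (hs.ra V X).cand _ _ hB
  have hrep := eventually_block B
    (P := fun tx t => ((r.state t).ra V X).reply k tx ≠ none) fun tx htx => by
      refine hr.eventually (l := .spLock V X k tx) trivial
        (Q := fun s => (s.ra V X).reply k tx ≠ none) (fun s s' hs h => ?_) ?_ ?_
      · rwa [((hs.ra V X).reply k tx).eq_of_ne_none h]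
      · filter_upwards [hcand] with t h1 h2
        exact ⟨_, .spLock _ _ _ _ _ B _ _ hV rfl h1 htx (not_not.1 h2) rfl⟩
      · intro s s' hs
        cases hs with
        | spLock => simp
  have hend : ∀ᶠ t in atTop, ((r.state t).ra V X).qcProposed k ≠ none ∨
      ((r.state t).ra V X).candFb k ≠ none := by
    refine hr.eventually (l := .endCand V X k) trivial
      (Q := fun s => (s.ra V X).qcProposed k ≠ none ∨ (s.ra V X).candFb k ≠ none)
      (fun s s' hs h => ?_) ?_ ?_
    · refine h.imp (fun h => ?_) fun h => ?_
      · rwa [((hs.ra V X).qcProposed k).eq_of_ne_none h]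
      · rwa [((hs.ra V X).candFb k).eq_of_ne_none h]
    · filter_upwards [hcand, hrep] with t h1 h2 h3
      rw [not_or, not_not, not_not] at h3
      by_cases h4 : ∃ tx : M.UTx, Tx.user tx ∈ B ∧ ((r.state t).ra V X).reply k tx = some false
      · exact ⟨_, .endCand_failure _ _ _ _ B _ hV rfl h1 h3.2 h3.1 h2 h4⟩
      · refine ⟨_, .endCand_success _ _ _ _ B _ hV rfl h1 h3.2 h3.1 fun tx htx => ?_⟩
        obtain ⟨b, hb⟩ := Option.ne_none_iff_exists'.1 (h2 tx htx)
        cases b with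
        | true => exact hb
        | false => exact absurd ⟨tx, htx, hb⟩ h4
    · intro s s' hs
      cases hs with
      | endCand_success => left; simp
      | endCand_failure => right; simp
  filter_upwards [hend] with t ht
  exact ht.resolve_right fun h => h (hfb t)

/-- A block decided by Quorum Consensus leads to decisions of the Transaction Agreements. -/
theorem Live.taDecided_of_qcDecided {X : M.RA} {k t : ℕ} {V : M.Val} {B : M.Block} (hV : M.Honest V)
    (hB : ((r.state t).ra V X).qcDecided k = some B) {tx : M.UTx} (htx : Tx.user tx ∈ B) {W : M.Val}
    (hW : M.Honest W) : ∀ᶠ t in atTop, ((r.state t).ua W tx.sender).taDecided tx.sn ≠ none := by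
  -- All honest validators learn the decided block. After the attempt to SP-lock, the slot holds
  -- some transaction, so there is something to propose even if `tx` lost.
  have hprop : ∀ W, M.Honest W → ∃ tx', r.TAProposes W tx.sender tx.sn tx' := by
    intro W hW
    have hev : ∀ᶠ t in atTop, ((r.state t).ua W tx.sender).taProposed tx.sn ≠ none := by
      refine hr.eventually (l := .uaInitiate W X k tx) trivial
        (Q := fun s => (s.ua W tx.sender).taProposed tx.sn ≠ none) (fun s s' hs h => ?_) ?_ ?_
      · rwa [((hs.ua W _).taProposed _).eq_of_ne_none h]
      · filter_upwards [hr.qcDecided_total hV hW hB] with t h1 h2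
        exact ⟨_, .uaInitiate _ _ _ _ _ B _ hW h1 htx (not_not.1 h2) rfl⟩
      · intro s s' hs
        cases hs with
        | uaInitiate _ _ _ _ _ B d _ _ _ h0 hd =>
          subst hd
          rw [State.setUA_self, UAEntity.proposeTA,
            if_pos (by rw [UAEntity.taProposed_trySPLock]; exact h0)]
          dsimp only
          rw [Function.update_self]
          exact UAEntity.spLocked_trySPLock_ne_none _ _
    obtain ⟨t, ht⟩ := hev.exists
    obtain ⟨tx', htx'⟩ := Option.ne_none_iff_exists'.1 ht
    exact ⟨tx', t, htx'⟩
  obtain ⟨d, t', hd⟩ := hr.ta.termination _ _ hprop W hW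
  filter_upwards [hr.taDecided_total hW hW hd] with t ht
  rw [ht]; simp

/-- If nobody decided, nobody would leave instance `k`. All honest validators would vote, for `⊥` if
need be, receive `n - f` votes and propose, and termination of the primitives would produce a
decision. -/
theorem Live.exists_decided (X : M.RA) (k : ℕ)
    (h : ∀ V, M.Honest V → ∀ᶠ t in atTop, k ≤ ((r.state t).ra V X).inst) :
    ∃ V t, M.Honest V ∧ ((r.state t).ra V X).decided k ≠ none := by
  by_contra hcon
  push Not at hcon
  have := hr.size
  have := hr.byz
  have hinst : ∀ V, M.Honest V → ∀ᶠ t in atTop, ((r.state t).ra V X).inst = k := fun V hV => by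
    filter_upwards [h V hV] with t ht
    by_contra hne
    exact hr.exec.decided_of_lt_inst t V X k (by omega) (hcon V t hV)
  have hvote : ∀ V, M.Honest V → ∀ᶠ t in atTop, ((r.state t).ra V X).vote k ≠ none := by
    intro V hV
    refine hr.eventually (l := .voteBot V X k) trivial
      (Q := fun s => (s.ra V X).vote k ≠ none) (fun s s' hs h => ?_) ?_ ?_
    · rwa [((hs.ra V X).vote k).eq_of_ne_none h]
    · filter_upwards [hinst V hV] with t h1 h2
      exact ⟨_, .voteBot _ _ _ _ _ hV rfl h1 (not_not.1 h2)⟩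
    · intro s s' hs
      cases hs with
      | voteBot => simp
  have hprop : ∀ V, M.Honest V → ∃ B, r.QCProposes V X k B := by
    intro V hV
    have hvotes : ∀ᶠ t in atTop, M.n - M.f ≤ ((r.state t).ra V X).votesTotal k := by
      filter_upwards [eventually_honest fun W hW =>
        hr.votesFrom_ne_none hV hW (hvote W hW).exists.choose_spec] with t ht
      exact System.sub_le_count ht hr.byz
    obtain ⟨t, ht⟩ := (hr.qcProposed_of_votes hV (hinst V hV) hvotes).exists
    obtain ⟨B, hB⟩ := Option.ne_none_iff_exists'.1 ht
    exact ⟨B, t, hB⟩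
  obtain ⟨V, hV, -⟩ := M.quorum_honest.exists (by omega)
  obtain ⟨B, t, hB⟩ := hr.qc.termination X k hprop V hV
  obtain ⟨t', ht'⟩ := (hr.decided_of_qcDecided hV (hr.qcDecided_total hV hV hB)
    (eventually_block B fun tx htx => hr.taDecided_of_qcDecided hV hB htx hV)).exists
  exact ht' (hcon V t' hV)

/-- Every instance is completed by all honest validators. -/
theorem Live.inst_unbounded (X : M.RA) (k : ℕ) : ∀ V, M.Honest V →
    ∀ᶠ t in atTop, k ≤ ((r.state t).ra V X).inst := by
  induction k with
  | zero => exact fun V _ => Eventually.of_forall fun t => Nat.zero_le _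
  | succ k ih =>
    obtain ⟨W, t, hW, ht⟩ := hr.exists_decided X k ih
    exact fun V hV => hr.inst_succ hV (ih V hV) (hr.decided_total hW hV ht)

end Run

/-! ### Transactions of correct users -/

theorem Step.nextSn_cases {l : Label M} {s s' : State M} (h : Step l s s') :
    (s'.issued = s.issued ∧ s'.nextSn = s.nextSn) ∨
    ∃ tx, (tx.sender ∈ M.correctUser → tx.sn = s.nextSn tx.sender) ∧ s'.issued = insert tx s.issued ∧
      s'.nextSn = Function.update s.nextSn tx.sender (s.nextSn tx.sender + 1) := by
  cases h with
  | issue _ tx _ h => exact .inr ⟨tx, h, rfl, rfl⟩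
  | _ => exact .inl ⟨rfl, rfl⟩

theorem Step.mem_issued_of_issue {s s' : State M} {tx : M.UTx} (h : Step (.issue tx) s s') :
    tx ∈ s'.issued := by
  cases h
  exact Set.mem_insert _ _

namespace Run

variable {r : Run M}

section

variable (hr : r.IsExecution)
include hr

/-- A correct user signs with the current value of the counter, which then exceeds every number used
so far. -/
theorem IsExecution.nextSn_spec (t : ℕ) :
    (∀ tx ∈ (r.state t).issued, tx.sender ∈ M.correctUser → tx.sn < (r.state t).nextSn tx.sender) ∧
    ∀ tx ∈ (r.state t).issued, ∀ tx' ∈ (r.state t).issued, tx.sender ∈ M.correctUser →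
      tx'.sender = tx.sender → tx'.sn = tx.sn → tx' = tx := by
  refine hr.invariant (P := fun s =>
    (∀ tx ∈ s.issued, tx.sender ∈ M.correctUser → tx.sn < s.nextSn tx.sender) ∧
    ∀ tx ∈ s.issued, ∀ tx' ∈ s.issued, tx.sender ∈ M.correctUser →
      tx'.sender = tx.sender → tx'.sn = tx.sn → tx' = tx) ?_ ?_ t
  · exact ⟨fun tx h => absurd h (Set.notMem_empty _), fun tx h => absurd h (Set.notMem_empty _)⟩
  · rintro t l _ hs ⟨ih1, ih2⟩
    rcases hs.nextSn_cases with ⟨h1, h2⟩ | ⟨tx₀, h0, h1, h2⟩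
    · rw [h1, h2]; exact ⟨ih1, ih2⟩
    · rw [h1, h2]
      constructor
      · rintro tx (rfl | htx) hc
        · rw [Function.update_self, h0 hc]; exact Nat.lt_succ_self _
        · by_cases hA : tx.sender = tx₀.sender
          · rw [hA, Function.update_self, ← hA]
            exact (ih1 tx htx hc).trans (Nat.lt_succ_self _)
          · rw [Function.update_of_ne hA]; exact ih1 tx htx hc
      · rintro tx (rfl | htx) tx' (rfl | htx') hc hA hsn
        · rfl
        · have h3 := ih1 tx' htx' (hA ▸ hc)
          rw [hA, hsn, h0 hc] at h3
          exact absurd h3 (lt_irrefl _)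
        · have h3 := ih1 tx htx hc
          rw [← hA, ← hsn, h0 (hA ▸ hc)] at h3
          exact absurd h3 (lt_irrefl _)
        · exact ih2 tx htx tx' htx' hc hA hsn

theorem IsExecution.issued_unique {t t' : ℕ} {tx tx' : M.UTx} (h : tx ∈ (r.state t).issued)
    (h' : tx' ∈ (r.state t').issued) (hc : tx.sender ∈ M.correctUser) (hA : tx'.sender = tx.sender)
    (hsn : tx'.sn = tx.sn) : tx' = tx :=
  (hr.nextSn_spec (max t t')).2 tx ((hr.extends (le_max_left t t')).issued h) tx'
    ((hr.extends (le_max_right t t')).issued h') hc hA hsn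

/-- A vote carries the pool at a moment of its instance. -/
theorem IsExecution.vote_pool (t : ℕ) : ∀ V X k v, ((r.state t).ra V X).vote k = some v →
    ∃ t', ((r.state t').ra V X).inst = k ∧ ((r.state t').ra V X).pool = v.2 := by
  refine hr.invariant (P := fun s => ∀ V X k v, (s.ra V X).vote k = some v →
    ∃ t', ((r.state t').ra V X).inst = k ∧ ((r.state t').ra V X).pool = v.2) ?_ ?_ t
  · intro V X k v h; simp [State.init] at h
  · intro t l _ hs ih V X k v h
    rcases hs.vote_cases V X k with he | ⟨-, h1, v', h2, -⟩
    · exact ih V X k v (he ▸ h)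
    · rw [h2] at h
      cases h
      exact ⟨t, h1, rfl⟩

theorem IsExecution.proposal_pool (t : ℕ) : ∀ V X k B, ((r.state t).ra V X).proposal k = some B →
    ∃ t', ((r.state t').ra V X).inst = k ∧ ((r.state t').ra V X).pool = B := by
  refine hr.invariant (P := fun s => ∀ V X k B, (s.ra V X).proposal k = some B →
    ∃ t', ((r.state t').ra V X).inst = k ∧ ((r.state t').ra V X).pool = B) ?_ ?_ t
  · intro V X k v h; simp [State.init] at h
  · intro t l _ hs ih V X k B h
    rcases hs.proposal_cases V X k with he | ⟨h1, h2⟩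
    · exact ih V X k B (he ▸ h)
    · rw [h2] at h
      cases h
      exact ⟨t, h1, rfl⟩

theorem IsExecution.forwarded_spec (t : ℕ) : ∀ V A tx X, tx ∈ ((r.state t).ua V A).forwarded →
    tx.recipient = some X →
      Tx.user tx ∈ ((r.state t).ra V X).pool ∨ Tx.user tx ∈ ((r.state t).ra V X).log := by
  refine hr.invariant (P := fun s => ∀ V A tx X, tx ∈ (s.ua V A).forwarded → tx.recipient = some X →
      Tx.user tx ∈ (s.ra V X).pool ∨ Tx.user tx ∈ (s.ra V X).log) ?_ ?_ t
  · intro V A tx X h; simp [State.init] at h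
  · intro t l _ hs ih V A tx X h hX
    rcases hs.forwarded_cases h with h | ⟨-, h⟩
    · rcases ih V A tx X h hX with h | h
      · exact hs.pool_subset h
      · exact .inr ((hs.extends.ra V X).log h)
    · exact h X hX

end

variable (hr : r.Live)
include hr

theorem Live.due_of_ready {V W : M.Val} (hV : M.Honest V) (hW : M.Honest W) {t : ℕ} {tx : M.UTx}
    (h : ((r.state t).ua V tx.sender).Ready tx) :
    ∀ᶠ t in atTop, ((r.state t).ua W tx.sender).Due tx :=
  hr.due_total (hr.uaLog_total t) hV hW h

section

variable {T : ℕ} {tx : M.UTx} (hc : tx.sender ∈ M.correctUser) (hi : tx ∈ (r.state T).issued)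
include hc hi

theorem Live.eq_of_certified {t : ℕ} {tx' : M.UTx} (h : (r.state t).Certified tx')
    (hA : tx'.sender = tx.sender) (hsn : tx'.sn = tx.sn) : tx' = tx :=
  hr.exec.issued_unique hi (hr.certified_issued h) hc hA hsn

/-- An SP-lock goes back to an FP-lock of an honest validator, hence to a signature, and a correct
user signs only `tx` in this slot. -/
theorem Live.eq_of_spLocked {t : ℕ} {V : M.Val} {tx' : M.UTx}
    (h : ((r.state t).ua V tx.sender).spLocked tx.sn = some tx') : tx' = tx := by
  have := hr.size
  have := hr.byz
  obtain ⟨h1, h2, h3⟩ := hr.spLocked_spec t V _ _ tx' h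
  obtain ⟨W, -, hW⟩ := h3.exists (by omega)
  exact hr.exec.issued_unique hi (hr.exec.fpLocked_spec t W _ _ tx' hW).2.2.2 hc h1 h2

/-- All honest proposals are `tx`, so validity excludes even the empty decision. -/
theorem Live.eq_of_taDecided {t : ℕ} {V : M.Val} (hV : M.Honest V) {d : Option M.UTx}
    (h : ((r.state t).ua V tx.sender).taDecided tx.sn = some d) : d = some tx :=
  hr.ta.validity_all _ _ V d tx hV ⟨t, h⟩ fun W tx' _ ⟨t', h'⟩ =>
    hr.eq_of_spLocked hc hi (hr.taProposed_spec t' W _ _ tx' h')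

theorem Live.received {V : M.Val} (hV : M.Honest V) :
    ∀ᶠ t in atTop, tx ∈ ((r.state t).ua V tx.sender).received ∧ (r.state t).FP V tx := by
  have hrec : ∀ᶠ t in atTop, tx ∈ ((r.state t).ua V tx.sender).received := by
    refine hr.eventually (l := .recvTx V tx) hc (Q := fun s => tx ∈ (s.ua V tx.sender).received)
      (fun s s' hs h => (hs.ua _ _).received h) ?_ ?_
    · refine hr.exec.eventually (P := fun s => tx ∉ (s.ua V tx.sender).received →
        ∃ s', Step (.recvTx V tx) s s') T fun s hs h => ?_
      exact ⟨_, .recvTx _ _ _ _ hV (hs.issued hi) h rfl⟩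
    · intro s s' hs
      cases hs with
      | recvTx => simp
  filter_upwards [hrec] with t h
  refine ⟨h, ?_⟩
  obtain ⟨tx', h1⟩ := Option.ne_none_iff_exists'.1 (hr.exec.received_spec t V _ tx h).2.2.1
  obtain ⟨-, h2, h3, h4⟩ := hr.exec.fpLocked_spec t V _ _ tx' h1
  obtain rfl := hr.exec.issued_unique hi h4 hc h2 h3
  exact h1

/-- The slow path suffices, as all honest validators vote for `tx` and propose it. Should the fast
path decide earlier, the decided transaction is certified and therefore again `tx`. -/
theorem Live.pobDecided_of_issued (hrec : tx.recipient = none) {V : M.Val} (hV : M.Honest V) :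
    ∀ᶠ t in atTop, ((r.state t).ua V tx.sender).pobDecided tx.sn = some tx := by
  have := hr.size
  have := hr.byz
  have hvoted : ∀ W, M.Honest W → ∀ᶠ t in atTop, tx ∈ ((r.state t).ua W tx.sender).voted := by
    intro W hW
    filter_upwards [hr.received hc hi hW] with t h
    exact (hr.exec.received_spec t W _ tx h.1).2.2.2 hrec h.2
  have hprop : ∀ V, M.Honest V → ∃ tx', r.TAProposes V tx.sender tx.sn tx' := by
    intro V hV
    have hvotes : ∀ᶠ t in atTop, M.n - M.f ≤
        M.count fun W => tx ∈ ((r.state t).ua V tx.sender).votesFrom W := by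
      have : ∀ᶠ t in atTop, ∀ W, M.Honest W → tx ∈ ((r.state t).ua V tx.sender).votesFrom W := by
        refine eventually_honest fun W hW => ?_
        refine hr.eventually (l := .pobRecvVote V W tx) hW
          (Q := fun s => tx ∈ (s.ua V tx.sender).votesFrom W)
          (fun s s' hs h => (hs.ua _ _).votesFrom W h) ?_ ?_
        · filter_upwards [hvoted W hW] with t h1 h2
          exact ⟨_, .pobRecvVote _ _ _ _ _ hV rfl h2 fun _ => h1⟩
        · intro s s' hs
          cases hs with
          | pobRecvVote => simp
      filter_upwards [this] with t ht
      exact System.sub_le_count ht hr.byz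
    have hev : ∀ᶠ t in atTop, ((r.state t).ua V tx.sender).taProposed tx.sn ≠ none := by
      refine hr.eventually (l := .pobPropose V tx) trivial
        (Q := fun s => (s.ua V tx.sender).taProposed tx.sn ≠ none) (fun s s' hs h => ?_) ?_ ?_
      · rwa [((hs.ua V _).taProposed _).eq_of_ne_none h]
      · filter_upwards [hvotes] with t h1 h2
        -- The `n - f` honest votes exceed the threshold `n - p - 2f`, and an SP-lock on the slot
        -- can only be on `tx`.
        refine ⟨_, .pobPropose _ _ _ _ hV rfl (not_not.1 h2) (by omega) ?_⟩
        by_cases h3 : ((r.state t).ua V tx.sender).spLocked tx.sn = none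
        · exact .inl h3
        · obtain ⟨tx', h4⟩ := Option.ne_none_iff_exists'.1 h3
          exact .inr (hr.eq_of_spLocked hc hi h4 ▸ h4)
      · intro s s' hs
        cases hs with
        | pobPropose _ _ _ e _ he h0 _ _ =>
          subst he
          rw [State.setUA_self, UAEntity.proposeTA,
            if_pos (by rw [UAEntity.taProposed_trySPLock]; exact h0)]
          simp
    obtain ⟨t, ht⟩ := hev.exists
    obtain ⟨tx', htx'⟩ := Option.ne_none_iff_exists'.1 ht
    exact ⟨tx', t, htx'⟩
  obtain ⟨d, t, hd⟩ := hr.ta.termination _ _ hprop V hV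
  obtain rfl := hr.eq_of_taDecided hc hi hV hd
  filter_upwards [hr.pobDecided_of_taDecided hV (hr.taDecided_total hV hV hd)] with t ht
  obtain ⟨tx', htx'⟩ := Option.ne_none_iff_exists'.1 ht
  obtain ⟨h1, h2, h3⟩ := (hr.tracked hV t tx.sender).pob _ _ htx'
  obtain rfl := hr.eq_of_certified hc hi (hr.certified_of_pob hV h1 h2 h3) h1 h2
  exact htx'

/-- `V.A` may have executed `tx` through a block of others before forwarding it and then never be
ready for it again. In that case `V.X` has executed it. -/
theorem Live.pooled {X : M.RA} (hrec : tx.recipient = some X) {V : M.Val} (hV : M.Honest V)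
    (hdue : ∀ᶠ t in atTop, ((r.state t).ua V tx.sender).Due tx) :
    ∀ᶠ t in atTop, Tx.user tx ∈ ((r.state t).ra V X).pool ∨ Tx.user tx ∈ ((r.state t).ra V X).log := by
  have hev : ∀ᶠ t in atTop, tx ∈ ((r.state t).ua V tx.sender).forwarded ∨
      Tx.user tx ∈ ((r.state t).ra V X).log := by
    refine hr.eventually (l := .forward V tx) trivial
      (Q := fun s => tx ∈ (s.ua V tx.sender).forwarded ∨ Tx.user tx ∈ (s.ra V X).log)
      (fun s s' hs h => h.imp (fun h => (hs.ua _ _).forwarded h) fun h => (hs.ra _ _).log h) ?_ ?_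
    · filter_upwards [hr.received hc hi hV, hdue] with t h1 h2 h3
      rw [not_or] at h3
      refine ⟨_, .forward _ _ _ X _ hV rfl hrec h1.1 h3.1 h1.2 (h2.resolve_right ?_)⟩
      rintro ⟨tx', h4, h5⟩
      obtain ⟨h6, h7, -, -, h8⟩ := (hr.tracked hV t tx.sender).log tx' h4
      obtain rfl := hr.eq_of_certified hc hi h7 h6 h5
      exact h3.2 (h8 X hrec)
    · intro s s' hs
      cases hs with
      | forward => left; simp
  filter_upwards [hev] with t ht
  exact ht.elim (fun h => hr.exec.forwarded_spec t V _ tx X h hrec) .inr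

/-- If all honest pools contain `tx` from the beginning of an instance with an honest leader on, the
decided block contains `tx`. -/
theorem Live.mem_decided {X : M.RA} {k : ℕ} (hk : M.Honest (M.leader k))
    (hpool : ∀ W t, M.Honest W → ((r.state t).ra W X).inst = k →
      Tx.user tx ∈ ((r.state t).ra W X).pool)
    {V : M.Val} (hV : M.Honest V) {t : ℕ} {B : M.Block} (hB : ((r.state t).ra V X).decided k = some B) :
    Tx.user tx ∈ B := by
  have := hr.size
  have := hr.byz
  -- An honest vote for a block under an honest leader is a vote for that leader's pool during
  -- instance `k`.
  have hvoted : ∀ {t q B}, M.byz.card < q →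
      M.Quorum q (fun W => (r.state t).VotedFor W X k B) → Tx.user tx ∈ B := by
    intro t q B hq h
    obtain ⟨W, -, hW⟩ := h.exists hq
    have h1 := (hr.exec.block_spec t W X k B (hr.exec.votedFor_spec t W X k B hW).1).2 hk
    obtain ⟨t', h2, h3⟩ := hr.exec.proposal_pool t _ X k B h1
    exact h3 ▸ hpool _ t' hk h2
  rcases hr.decided_spec t V X k B hB with hp | ⟨B₀, h1, h2, h3⟩
  · exact hvoted (q := M.n - M.p) (by omega) (hr.exec.proof_spec t V X k B hp)
  · have hmem : Tx.user tx ∈ B₀ := by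
      refine hr.qc.validity_all X k V B₀ _ hV ⟨t, h1⟩ fun W B' hW ⟨t', h4⟩ => ?_
      rcases (hr.qcProposed_spec t' W X k B' h4).2 with h5 | ⟨Bf, h5, h6, h7⟩
      · exact hvoted (by omega) (hr.exec.cand_spec t' W X k B' h5).2
      · have h8 : Tx.user tx ∈ Bf := by
          -- A transaction is missing from the fallback candidate only if some honest vote lacks it,
          -- but honest votes carry pools from instance `k`.
          refine ((hr.candFb_spec t' W X k Bf h5).2.1 (Tx.user tx)).resolve_right ?_
          rintro ⟨W', hW', v, hv, hx⟩
          obtain ⟨t'', h9, h10⟩ := hr.exec.vote_pool t' W' X k v hv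
          exact hx (h10 ▸ hpool W' t'' hW' h9)
        refine (h7 _).2 ⟨h8, fun tx' he => ?_⟩
        cases he
        obtain ⟨tx', h9⟩ := Option.ne_none_iff_exists'.1 (h6 tx h8)
        exact hr.eq_of_spLocked hc hi h9 ▸ h9
    refine (h3 _).2 ⟨hmem, fun tx' he => ?_⟩
    cases he
    obtain ⟨d, hd⟩ := Option.ne_none_iff_exists'.1 (h2 tx hmem)
    rw [hd, hr.eq_of_taDecided hc hi hV hd]

/-- Were `tx` never executed at `X`, it would from some time on lie in every honest pool, and the
next instance with an honest leader would decide it. -/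
theorem Live.exists_executesRA (hleader : ∀ k : ℕ, ∃ k' ≥ k, M.Honest (M.leader k')) {X : M.RA}
    (hrec : tx.recipient = some X)
    (hdue : ∀ V, M.Honest V → ∀ᶠ t in atTop, ((r.state t).ua V tx.sender).Due tx) :
    ∃ V, M.Honest V ∧ r.ExecutesRA V X tx := by
  by_contra hcon
  push Not at hcon
  obtain ⟨T', hT'⟩ := eventually_atTop.1
    (eventually_honest fun V hV => hr.pooled hc hi hrec hV (hdue V hV))
  obtain ⟨k, hk, hkl⟩ := hleader ((Finset.univ.sup fun V => ((r.state T').ra V X).inst) + 1)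
  -- `k` exceeds every instance number reached at time `T'`, so a validator in instance `k` is past
  -- `T'`, when all pools contain `tx`.
  have hpool : ∀ W t, M.Honest W → ((r.state t).ra W X).inst = k →
      Tx.user tx ∈ ((r.state t).ra W X).pool := by
    intro W t hW hWk
    have h1 : ((r.state T').ra W X).inst < k :=
      (Nat.lt_succ_of_le (Finset.le_sup (f := fun V => ((r.state T').ra V X).inst)
        (Finset.mem_univ W))).trans_le hk
    have h2 : T' ≤ t := by
      by_contra hlt
      have := ((hr.exec.extends (not_le.1 hlt).le).ra W X).inst
      omega
    exact (hT' t h2 W hW).resolve_right fun h => hcon W hW ⟨t, h⟩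
  obtain ⟨t, ht⟩ := (hr.inst_unbounded X (k + 1) _ hkl).exists
  obtain ⟨B, hB⟩ := Option.ne_none_iff_exists'.1 (hr.exec.decided_of_lt_inst t _ X k ht)
  have hmem := hr.mem_decided hc hi hkl hpool hkl hB
  refine hcon _ hkl ⟨t, ?_⟩
  have h1 : Tx.user tx ∈ (r.ledger X (k + 1)).log := by
    rw [ledger, hr.blockAt_eq hkl hB]
    exact Batch.mem_log_foldl X _ _ (Finset.mem_toList.2 hmem)
  rw [(hr.ledger_spec t _ X).2]
  obtain ⟨c, hcm⟩ := (r.ledger_regular X _).mem_log.1 h1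
  exact (r.ledger_regular X _).mem_log.2 ⟨c, r.ledger_out_mono X ht hcm⟩

end

theorem Live.validity (hleader : ∀ k : ℕ, ∃ k' ≥ k, M.Honest (M.leader k')) {tx : M.UTx}
    (hc : tx.sender ∈ M.correctUser) (hem : r.Emitted tx) {V : M.Val} (hV : M.Honest V) :
    r.ExecutesFully V tx := by
  obtain ⟨t, hl, W, hW, t', -, hR⟩ := hem
  have hi := (hr.exec.step t _ hl).mem_issued_of_issue
  have hdue := fun V (hV : M.Honest V) => hr.due_of_ready hW hV hR
  cases hrec : tx.recipient with
  | none =>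
    obtain ⟨t, ht⟩ := (hr.executes_ua hV hrec (hr.pobDecided_of_issued hc hi hrec hV)
      (hdue V hV)).exists
    exact ⟨⟨t, ht⟩, fun X hX => by rw [hrec] at hX; cases hX⟩
  | some X =>
    obtain ⟨W', hW', t₁, ht₁⟩ := hr.exists_executesRA hc hi hleader hrec hdue
    have hlog := hr.raLog_total hW' hV ht₁
    obtain ⟨t, ht⟩ := (hr.executes_uara hV hlog (hdue V hV)).exists
    obtain ⟨t₂, ht₂⟩ := hlog.exists
    refine ⟨⟨t, ht⟩, fun Y hY => ?_⟩
    obtain rfl : X = Y := Option.some.inj (hrec.symm.trans hY)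
    exact ⟨t₂, ht₂⟩

end Run

end Mangrove

theorem mainTheorem7 (M : Mangrove.System.{u})
    (hbyz : M.byz.card ≤ M.f)
    (hn : 3 * M.f + 2 * M.p + 1 ≤ M.n)
    (hleader : ∀ k : ℕ, ∃ k' ≥ k, M.Honest (M.leader k'))
    (r : Mangrove.Run M) (hexec : r.IsExecution) (hfair : r.IsFair)
    (hqc : r.QuorumConsensusSpec) (hta : r.TransactionAgreementSpec) :
    -- validity
    (∀ tx : M.UTx, tx.sender ∈ M.correctUser → r.Emitted tx →
      ∀ V, M.Honest V → r.ExecutesFully V tx) ∧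
    -- integrity
    (∀ V, M.Honest V → ∀ tx : M.UTx,
      r.ExecutesAtMostOnce V tx ∧ (r.Executes V tx → r.Emitted tx)) ∧
    -- agreement
    (∀ (A : M.UA) (V₁ V₂ : M.Val) (tx₁ tx₂ : M.UTx), M.Honest V₁ → M.Honest V₂ →
      tx₁.sender = A → tx₂.sender = A → tx₁.sn = tx₂.sn →
      r.Executes V₁ tx₁ → r.Executes V₂ tx₂ → tx₁ = tx₂) := by
  have ha : r.Admissible := ⟨hbyz, hn, hexec, hqc, hta⟩
  have hl : r.Live := ⟨ha, hfair⟩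
  refine ⟨fun tx hc hem V hV => hl.validity hleader hc hem hV,
    fun V hV tx => ⟨ha.executesAtMostOnce hV tx, fun h => (ha.certified_of_executes hV h).1⟩, ?_⟩
  rintro A V₁ V₂ tx₁ tx₂ hV₁ hV₂ rfl hA hsn h₁ h₂
  exact ha.agreement hV₁ hV₂ h₁ h₂ hA.symm hsn
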